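/- **Setting.** Let $u_0<-2$, $u_0<u_1<0$, $\delta>0$. Consider a smooth solution $(\mathcal D,g)$ of the Einstein vacuum equations $\mathrm{Ric}(g)=0$ on the region $u_0\le u\le u_1$, $u<\underline u\le\delta$, foliated by spheres $S_{\underline u,u}$, in the canonical double null gauge $$g=-2\Omega^2(d\underline u\otimes du+du\otimes d\underline u)+\slashed g_{AB}(d\theta^A-b^Ad\underline u)\otimes(d\theta^B-b^Bd\underline u),$$ where $\Omega>0$, $\slashed g$ is positive definite, $\Omega=1$ and $b=0$ on $C_{u_0}=\{u=u_0\}$, and $\theta$ ranges over two stereographic charts of $S^2$. For $\underline u\le 0$ the metric is Minkowskian: $\Omega=1$, $b=0$, $\slashed g=(\underline u-u)^2\mathring\gamma$, where $\mathring\gamma=(1+\frac14|\theta|^2)^{-2}\delta_{AB}\,d\theta^Ad\theta^B$ is the unit round metric. On $C_{u_0}$, for $0\le\underline u\le\delta$, the data are short pulse data with seed $\psi_0$: there is a function $\phi>0$ with $$\slashed g_{AB}(\underline u,u_0,\theta)=\phi^2\,\frac{|u_0|^2}{(1+\frac14|\theta|^2)^2}\,(\exp\psi)_{AB},\qquad \psi(\underline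 u,\theta)=\frac{\delta^{1/2}}{|u_0|}\,\psi_0\!\left(\frac{\underline u}{\delta},\theta\right),$$ where $\psi_0\in C_c^\infty((0,1)\times S^2)$ takes values in the symmetric trace-free $2\times2$ matrices (its two chart representatives agree as tensors on the overlap). Put $e_3=\Omega^{-1}\partial_u$, $e_4=\Omega^{-1}(\partial_{\underline u}+b^A\partial_{\theta^A})$, and for tangential $e_A$ let $\chi_{AB}=g(\nabla_Ae_4,e_B)$ with trace $\mathrm{tr}\chi$ and trace-free part $\widehat\chi$, and $$\alpha_{AB}=R(e_A,e_4,e_B,e_4),\quad \beta_A=\tfrac12R(e_A,e_4,e_3,e_4),\quad \rho=\tfrac14R(e_3,e_4,e_3,e_4),\quad \sigma=\tfrac14R(e_3,e_4,e_A,e_B)\,\slashed\epsilon^{AB},$$ with $R(W,Z,X,Y)=g(W,R(X,Y)Z)$ and $\slashed\epsilon$ the area form of $\slashed g$. Let $\slashed\nabla$ and $|\cdot|$ be the covariant derivative and the pointwise norm of $\slashed g$ on the spheres. **Statement.** There are a universal integer $N$, a number $\delta_0>0$ depending only on a bound for the $C^N$ norm of $\psi_0$, and for each integer $k\ge0$ a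 constant $C_k$ depending only on bounds for the $C^N$ and $C^{k+N}$ norms of $\psi_0$, such that the following holds for every $0<\delta\le\delta_0$ and every $m_0$. Suppose the incoming energy per solid angle equals $4m_0$ in every direction, $$|u_0|^2\int_0^\delta|\widehat\chi(\underline u,u_0,\theta)|^2_{\slashed g}\,d\underline u=4m_0\quad\text{for all }\theta,$$ or, alternatively, that the seed satisfies $\int_0^1|\partial_s\psi_0(s,\theta)|^2\,ds=16m_0$ for all $\theta$. Then on the sphere $S_{\delta,u_0}$ one has $\alpha\equiv0$ and, for every $k\ge 0$, each of $$|u_0|^k\left|\slashed\nabla^k\!\left(\mathrm{tr}\chi-\left(\tfrac{2}{|u_0|}-\tfrac{4m_0}{|u_0|^2}\right)\right)\right|,\quad |u_0|^k|\slashed\nabla^k\beta|,\quad |u_0|^{k+1}\left|\slashed\nabla^k\!\left(\rho+\tfrac{2m_0}{|u_0|^3}\right)\right|,\quad |u_0|^{k+1}|\slashed\nabla^k\sigma|$$ is at most $C_k\,\delta^{1/2}|u_0|^{-2}$ at every point of $S_{\delta,u_0}$. (The subtracted values are those of a sphere of radius $|u_0|$ in the Schwarzschild space-time of mass $m_0$,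 where $\beta=0$ and $\sigma=0$.) -/

import Mathlib

open scoped ContDiff

noncomputable section

namespace NullGeom

/-! ### Pseudo-Riemannian geometry in a coordinate chart -/

section Chart

variable {ι : Type} [Fintype ι] [DecidableEq ι]

/-- The coordinate derivative `∂_i f`. -/
def pd (f : (ι → ℝ) → ℝ) (i : ι) (x : ι → ℝ) : ℝ :=
  fderiv ℝ f x (Pi.single i 1)

/-- The Christoffel symbols `Γ^k_{ij}` of the metric with components `g`. -/
def christoffel (g : (ι → ℝ) → Matrix ι ι ℝ) (x : ι → ℝ) (k i j : ι) : ℝ :=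
  (1 / 2) * ∑ l, (g x)⁻¹ k l *
    (pd (fun y => g y j l) i x + pd (fun y => g y i l) j x - pd (fun y => g y i j) l x)

/-- The curvature components `R^k_{lij}`, where `R(∂_i, ∂_j) ∂_l = R^k_{lij} ∂_k` and
`R(X, Y) = ∇_X ∇_Y - ∇_Y ∇_X - ∇_{[X, Y]}`. -/
def curvUp (g : (ι → ℝ) → Matrix ι ι ℝ) (x : ι → ℝ) (k l i j : ι) : ℝ :=
  pd (fun y => christoffel g y k j l) i x - pd (fun y => christoffel g y k i l) j x
    + ∑ m, (christoffel g x k i m * christoffel g x m j l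
      - christoffel g x k j m * christoffel g x m i l)

/-- The curvature tensor `R(W, Z, X, Y) = g(W, R(X, Y) Z)` on four tangent vectors at `x`. -/
def riem (g : (ι → ℝ) → Matrix ι ι ℝ) (x : ι → ℝ) (W Z X Y : ι → ℝ) : ℝ :=
  ∑ n, ∑ k, ∑ l, ∑ i, ∑ j, g x n k * curvUp g x k l i j * W n * Z l * X i * Y j

/-- The Ricci tensor `Ric_{lj} = R^k_{lkj}`. -/
def ricci (g : (ι → ℝ) → Matrix ι ι ℝ) (x : ι → ℝ) (l j : ι) : ℝ :=
  ∑ k, curvUp g x k l k j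

/-- The covariant derivative `∇_V Y` at `x` of the vector field `Y` along the vector `V`. -/
def covVec (g : (ι → ℝ) → Matrix ι ι ℝ) (V : ι → ℝ) (Y : (ι → ℝ) → ι → ℝ)
    (x : ι → ℝ) (k : ι) : ℝ :=
  (∑ i, V i * pd (fun y => Y y k) i x) + ∑ i, ∑ j, christoffel g x k i j * V i * Y x j

/-- The components of an `r`-covariant tensor field. -/
abbrev TensorField (ι : Type) (r : ℕ) : Type := (ι → ℝ) → (Fin r → ι) → ℝ

/-- The covariant derivative `∇T` of a covariant tensor field, the new index being the first:
`∇_c T_{a_1 … a_r} = ∂_c T_{a_1 … a_r} - ∑_j Γ^d_{c a_j} T_{a_1 … d … a_r}`. -/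
def covTensor (g : (ι → ℝ) → Matrix ι ι ℝ) {r : ℕ} (T : TensorField ι r) :
    TensorField ι (r + 1) :=
  fun x a => pd (fun y => T y (Fin.tail a)) (a 0) x
    - ∑ j : Fin r, ∑ d, christoffel g x d (a 0) (Fin.tail a j)
        * T x (Function.update (Fin.tail a) j d)

/-- The iterated covariant derivative `∇^k T`. -/
def iterCov (g : (ι → ℝ) → Matrix ι ι ℝ) {r : ℕ} (T : TensorField ι r) :
    (k : ℕ) → TensorField ι (r + k)
  | 0 => T
  | k + 1 => covTensor g (iterCov g T k)

/-- The squared length `g^{a_1 b_1} ⋯ g^{a_r b_r} T_{a_1 … a_r} T_{b_1 … b_r}` at `x`. -/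
def normSq (g : (ι → ℝ) → Matrix ι ι ℝ) {r : ℕ} (T : TensorField ι r) (x : ι → ℝ) : ℝ :=
  ∑ a : Fin r → ι, ∑ c : Fin r → ι, (∏ j, (g x)⁻¹ (a j) (c j)) * T x a * T x c

/-- The pointwise length `|∇^k T|` at `x`. -/
def covNorm (g : (ι → ℝ) → Matrix ι ι ℝ) {r : ℕ} (T : TensorField ι r) (k : ℕ)
    (x : ι → ℝ) : ℝ :=
  Real.sqrt (normSq g (iterCov g T k) x)

end Chart

/-! ### The sphere in stereographic coordinates -/

/-- `|θ|²` -/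
def eucSq (θ : Fin 2 → ℝ) : ℝ := θ 0 ^ 2 + θ 1 ^ 2

/-- In either stereographic chart the unit round metric is `roundFactor θ ^ 2 * δ_{AB}`. -/
def roundFactor (θ : Fin 2 → ℝ) : ℝ := (1 + eucSq θ / 4)⁻¹

/-- The change of coordinates between the two stereographic charts, `z ↦ 4 / z` on `ℂ`: each
chart covers the sphere minus one pole, the closed discs `|θ| ≤ 2` are the two closed
hemispheres, and the second chart is reflected so that the atlas is oriented. -/
def transition (θ : Fin 2 → ℝ) : Fin 2 → ℝ :=
  ![4 * θ 0 / eucSq θ, -(4 * θ 1 / eucSq θ)]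

/-- The Jacobian matrix `∂ τ^C / ∂ θ^A` of the change of coordinates. -/
def transJac (θ : Fin 2 → ℝ) : Matrix (Fin 2) (Fin 2) ℝ :=
  fun C A => pd (fun y => transition y C) A θ

/-- The seed `ψ₀ ∈ C_c^∞((0,1) × S²)`, with values in the symmetric trace-free matrices. It is
given by its representatives `ψ 0`, `ψ 1` in the two stereographic charts, which agree on the
overlap as symmetric `2`-tensors once multiplied by the conformal factor. -/
structure Seed where
  ψ : Fin 2 → ℝ → (Fin 2 → ℝ) → Matrix (Fin 2) (Fin 2) ℝ
  smooth : ∀ i A B, ContDiff ℝ ∞ fun p : ℝ × (Fin 2 → ℝ) => ψ i p.1 p.2 A B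
  symm : ∀ i s θ, (ψ i s θ).IsSymm
  traceless : ∀ i s θ, (ψ i s θ).trace = 0
  compact_support : ∃ a c : ℝ, 0 < a ∧ c < 1 ∧ ∀ i s θ, s ∉ Set.Icc a c → ψ i s θ = 0
  compat : ∀ s θ, θ ≠ 0 →
    roundFactor θ ^ 2 • ψ 0 s θ = (transJac θ).transpose
      * (roundFactor (transition θ) ^ 2 • ψ 1 s (transition θ)) * transJac θ

/-- The `C^n` norm of the seed over `[0,1] × S²` is at most `F`. -/
def Seed.NormLE (S : Seed) (n : ℕ) (F : ℝ) : Prop :=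
  ∀ i, ∀ s ∈ Set.Icc (0 : ℝ) 1, ∀ θ, eucSq θ ≤ 4 → ∀ j ≤ n, ∀ A B,
    ‖iteratedFDeriv ℝ j (fun p : ℝ × (Fin 2 → ℝ) => S.ψ i p.1 p.2 A B) (s, θ)‖ ≤ F

/-! ### Metrics in double null form -/

/-- The point with coordinates `(u̲, u, θ¹, θ²)`; here `ub` stands for `u̲`. -/
def pt (ub u : ℝ) (θ : Fin 2 → ℝ) : Fin 4 → ℝ := ![ub, u, θ 0, θ 1]

/-- The angular coordinates of a point. -/
def ang (x : Fin 4 → ℝ) : Fin 2 → ℝ := ![x 2, x 3]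

/-- The position of the angular coordinate `θ^A` among the four coordinates. -/
def sph : Fin 2 → Fin 4 := ![2, 3]

/-- The coordinate vector `∂/∂θ^A`. -/
def eA (A : Fin 2) : Fin 4 → ℝ := Pi.single (sph A) 1

/-- The components, in one coordinate chart `(u̲, u, θ¹, θ²)`, of a metric in double null form
`-2 Ω² (du̲ ⊗ du + du ⊗ du̲) + gs_{AB} (dθ^A - b^A du̲) ⊗ (dθ^B - b^B du̲)`. -/
structure DoubleNull where
  Ω : (Fin 4 → ℝ) → ℝ
  b : (Fin 4 → ℝ) → Fin 2 → ℝ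
  gs : (Fin 4 → ℝ) → Matrix (Fin 2) (Fin 2) ℝ

namespace DoubleNull

variable (M : DoubleNull)

/-- The component vector of the `1`-form `dθ^A - b^A du̲`. -/
def coframe (x : Fin 4 → ℝ) (A : Fin 2) : Fin 4 → ℝ :=
  Pi.single (sph A) 1 - M.b x A • Pi.single 0 1

/-- The components `g_{μν}` of the space-time metric. -/
def metric (x : Fin 4 → ℝ) : Matrix (Fin 4) (Fin 4) ℝ := fun μ ν =>
  -2 * M.Ω x ^ 2 * ((Pi.single 0 1 : Fin 4 → ℝ) μ * (Pi.single 1 1 : Fin 4 → ℝ) ν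
      + (Pi.single 1 1 : Fin 4 → ℝ) μ * (Pi.single 0 1 : Fin 4 → ℝ) ν)
    + ∑ A, ∑ B, M.gs x A B * M.coframe x A μ * M.coframe x B ν

/-- `e₃ = Ω⁻¹ ∂_u` -/
def e3 (x : Fin 4 → ℝ) : Fin 4 → ℝ := (M.Ω x)⁻¹ • Pi.single 1 1

/-- `e₄ = Ω⁻¹ (∂_{u̲} + b^A ∂_A)` -/
def e4 (x : Fin 4 → ℝ) : Fin 4 → ℝ :=
  (M.Ω x)⁻¹ • (Pi.single 0 1 + ∑ A, M.b x A • eA A)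

/-- The metric induced on the sphere `S_{u̲,u}`, in the coordinates `θ`. -/
def sphereMetric (ub u : ℝ) (θ : Fin 2 → ℝ) : Matrix (Fin 2) (Fin 2) ℝ := M.gs (pt ub u θ)

/-- `χ_{AB} = g(∇_A e₄, e_B)` -/
def chi (x : Fin 4 → ℝ) (A B : Fin 2) : ℝ :=
  ∑ μ, ∑ ν, M.metric x μ ν * covVec M.metric (eA A) M.e4 x μ * eA B ν

/-- `tr χ` -/
def trchi (x : Fin 4 → ℝ) : ℝ := ∑ A, ∑ B, (M.gs x)⁻¹ A B * M.chi x A B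

/-- The trace-free part of `χ`. -/
def chih (x : Fin 4 → ℝ) (A B : Fin 2) : ℝ := M.chi x A B - (1 / 2) * M.trchi x * M.gs x A B

/-- `α_{AB} = R(e_A, e₄, e_B, e₄)` -/
def alpha (x : Fin 4 → ℝ) (A B : Fin 2) : ℝ :=
  riem M.metric x (eA A) (M.e4 x) (eA B) (M.e4 x)

/-- `β_A = ½ R(e_A, e₄, e₃, e₄)` -/
def beta (x : Fin 4 → ℝ) (A : Fin 2) : ℝ :=
  (1 / 2) * riem M.metric x (eA A) (M.e4 x) (M.e3 x) (M.e4 x)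

/-- `ρ = ¼ R(e₃, e₄, e₃, e₄)` -/
def rho (x : Fin 4 → ℝ) : ℝ :=
  (1 / 4) * riem M.metric x (M.e3 x) (M.e4 x) (M.e3 x) (M.e4 x)

/-- The area form with raised indices, `ε^{AB}`. -/
def epsUp (x : Fin 4 → ℝ) : Matrix (Fin 2) (Fin 2) ℝ :=
  (Real.sqrt (M.gs x).det)⁻¹ • !![0, 1; -1, 0]

/-- `σ = ¼ R(e₃, e₄, e_A, e_B) ε^{AB}` -/
def sigma (x : Fin 4 → ℝ) : ℝ :=
  (1 / 4) * ∑ A, ∑ B, riem M.metric x (M.e3 x) (M.e4 x) (eA A) (eA B) * M.epsUp x A B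

/-- A function on space-time restricted to the sphere `S_{u̲,u}`. -/
def onSphere (f : (Fin 4 → ℝ) → ℝ) (ub u : ℝ) : TensorField (Fin 2) 0 :=
  fun θ _ => f (pt ub u θ)

/-- A tangential `1`-form restricted to the sphere `S_{u̲,u}`. -/
def onSphere₁ (f : (Fin 4 → ℝ) → Fin 2 → ℝ) (ub u : ℝ) : TensorField (Fin 2) 1 :=
  fun θ a => f (pt ub u θ) (a 0)

/-- A tangential `2`-tensor restricted to the sphere `S_{u̲,u}`. -/
def onSphere₂ (f : (Fin 4 → ℝ) → Fin 2 → Fin 2 → ℝ) (ub u : ℝ) : TensorField (Fin 2) 2 :=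
  fun θ a => f (pt ub u θ) (a 0) (a 1)

/-- `|χ̂|²` at the point `θ` of `S_{u̲,u}`. -/
def shearSq (ub u : ℝ) (θ : Fin 2 → ℝ) : ℝ :=
  normSq (M.sphereMetric ub u) (onSphere₂ M.chih ub u) θ

end DoubleNull

/-- The region `u₀ ≤ u ≤ u₁`, `u < u̲ ≤ δ` of a chart. -/
def region (u₀ u₁ δ : ℝ) : Set (Fin 4 → ℝ) :=
  {x | u₀ ≤ x 1 ∧ x 1 ≤ u₁ ∧ x 1 < x 0 ∧ x 0 ≤ δ}

/-- A smooth vacuum space-time on `u₀ ≤ u ≤ u₁`, `u < u̲ ≤ δ`, foliated by spheres, in the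
canonical double null gauge based on `C_{u₀}`, and Minkowskian to the past of `u̲ = 0`.
It is described in the two charts `(u̲, u, θ)` with `θ` stereographic. Smoothness up to the
boundary means that the components extend smoothly; every condition is imposed only on the
region, and the derivatives there do not depend on the extension. -/
structure Development (u₀ u₁ δ : ℝ) where
  M : Fin 2 → DoubleNull
  smooth_Ω : ∀ i, ContDiff ℝ ∞ (M i).Ω
  smooth_b : ∀ i A, ContDiff ℝ ∞ fun x => (M i).b x A
  smooth_gs : ∀ i A B, ContDiff ℝ ∞ fun x => (M i).gs x A B
  Ω_pos : ∀ i, ∀ x ∈ region u₀ u₁ δ, 0 < (M i).Ω x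
  gs_posDef : ∀ i, ∀ x ∈ region u₀ u₁ δ, ((M i).gs x).PosDef
  compat_Ω : ∀ x ∈ region u₀ u₁ δ, ang x ≠ 0 →
    (M 0).Ω x = (M 1).Ω (pt (x 0) (x 1) (transition (ang x)))
  compat_b : ∀ x ∈ region u₀ u₁ δ, ang x ≠ 0 →
    (M 1).b (pt (x 0) (x 1) (transition (ang x))) = (transJac (ang x)).mulVec ((M 0).b x)
  compat_gs : ∀ x ∈ region u₀ u₁ δ, ang x ≠ 0 →
    (M 0).gs x = (transJac (ang x)).transpose
      * (M 1).gs (pt (x 0) (x 1) (transition (ang x))) * transJac (ang x)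
  vacuum : ∀ i, ∀ x ∈ region u₀ u₁ δ, ∀ μ ν, ricci (M i).metric x μ ν = 0
  gauge : ∀ i, ∀ x ∈ region u₀ u₁ δ, x 1 = u₀ → (M i).Ω x = 1 ∧ (M i).b x = 0
  minkowski : ∀ i, ∀ x ∈ region u₀ u₁ δ, x 0 ≤ 0 → (M i).Ω x = 1 ∧ (M i).b x = 0 ∧
    (M i).gs x = ((x 0 - x 1) * roundFactor (ang x)) ^ 2 • (1 : Matrix (Fin 2) (Fin 2) ℝ)

namespace Development

variable {u₀ u₁ δ : ℝ} (D : Development u₀ u₁ δ)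

/-- The short pulse ansatz: on `C_{u₀}` the conformal class of the induced metric is given by
`|u₀|² (1 + |θ|²/4)⁻² exp ψ` with `ψ(u̲, θ) = δ^{1/2} |u₀|⁻¹ ψ₀(u̲ / δ, θ)`. -/
def IsShortPulse (S : Seed) : Prop :=
  ∀ i, ∀ ub ∈ Set.Icc 0 δ, ∀ θ, ∃ φ : ℝ, 0 < φ ∧
    (D.M i).gs (pt ub u₀ θ) = (φ ^ 2 * (|u₀| * roundFactor θ) ^ 2) •
      NormedSpace.exp ((Real.sqrt δ / |u₀|) • S.ψ i (ub / δ) θ)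

/-- The incoming energy per solid angle is `4 m₀` in every direction:
`|u₀|² ∫₀^δ |χ̂(u̲, u₀, θ)|² du̲ = 4 m₀`. -/
def ShearEnergy (m₀ : ℝ) : Prop :=
  ∀ i θ, |u₀| ^ 2 * ∫ ub in (0 : ℝ)..δ, (D.M i).shearSq ub u₀ θ = 4 * m₀

end Development

/-- The same condition expressed through the seed: `∫₀¹ |∂_s ψ₀(s, θ)|² ds = 16 m₀`. -/
def Seed.Energy (S : Seed) (m₀ : ℝ) : Prop :=
  ∀ i θ, ∫ s in (0 : ℝ)..1, ∑ A, ∑ B, deriv (fun t => S.ψ i t θ A B) s ^ 2 = 16 * m₀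

end NullGeom

end

set_option linter.unusedSimpArgs false
set_option linter.unusedSectionVars false

namespace NullGeom

open Set

/-! ### Smooth functions on the strip `[0,1] × ℝ²` -/

/-! Everything takes place on the initial cone. There `Ω = 1` and `b = 0`, so all their tangential
derivatives vanish, and a suitable list of curvature components involves only the induced metric,
its `∂_u` derivative and the one-form `z_A = gs_{AB} ∂_u b^B` (`twist`), with neither `∂_u Ω` nor a
second `∂_u` derivative. The vacuum equations for these components become ordinary differential
equations along the generators.

Put `L = |u₀|` and `u̲ = δ s`, with a prime for `∂_s`, and write the induced metric as `L² φ² r² E`,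
where `r` is the round factor and `E = exp ψ` has determinant one. Three equations carry the proof.
Raychaudhuri gives `φ'' = -source φ` with `source = -(1/4) det E'` (`φ_ode`), which is `δ² |χ̂|² /
2` (`shearSq_eq`). Codazzi transports `z` with a source linear in the derivative of the metric
(`dS_tw`). The trace of the Ricci equation on the spheres transports the incoming expansion weighted
by the area (`dS_Sy`).

The small parameters are the amplitude `ε = δ^{1/2} / L` and `μ = δ / L`, the initial value of `T =
φ' / φ`; here `tr χ = (2 / δ) T`, and `ε² ≤ μ ≤ ε`. Since `T' = -source - T²` and `T = O(μ)`, one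
has `T(1) = μ - ∫ source + O(μ²)`. The energy hypothesis evaluates `∫ source` as `2 m₀ ε²`, exactly
for the shear and up to `O(ε³)` for the seed, because `source = (ε² / 8) |∂_s ψ₀|² + O(ε³)`.
Multiplication by `2 / δ` gives `2 / L - 4 m₀ / L²` with an error `O(δ^{1/2} L⁻²)`. As `m₀` does not
depend on the direction, the angular derivatives obey the same estimate.

At `s = 1` the pulse is over and `E` is the identity to all orders, so the sphere is conformally
round. There `α` is a multiple of `φ'' = 0`; `β = δ⁻¹ (∂T + T z / 4)`; `σ` is a multiple of the curl
of `z`; and the Gauss equation gives `ρ` through the scalar curvature and the product of the two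
expansions (`alpha_late`, `beta_late`, `sigma_late`, `rho_late`). In `ρ` the leading terms `-L⁻²`
and `+L⁻²` cancel and leave `-2 m₀ / L³`.

Uniformity comes from treating all pulses with the given bounds as one family: in `Bd` the constant
is chosen before the member of the family, so it can depend only on the bounds defining the family.
Estimates are propagated by `Bd.integrate` and `Bd.ode`. The sole smallness condition on `δ`,
besides `δ ≤ 1`, is the one ensuring `φ ≥ 1/2` (`exists_lower`). -/

/-- The parameter space of `C_{u₀}`: rescaled `u̲` and the angular coordinates. -/
abbrev Strip : Type := ℝ × (Fin 2 → ℝ)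

/-- The derivative of `f` in the direction `v`. -/
noncomputable def dirD (v : Strip) (f : Strip → ℝ) : Strip → ℝ := fun x => fderiv ℝ f x v

/-- The first coordinate vector. -/
def vS : Strip := (1, 0)

/-- The angular coordinate vectors. -/
def vT (A : Fin 2) : Strip := (0, Pi.single A 1)

/-- The derivative in the first variable. -/
notation:max "dS" => dirD vS

/-- The angular derivatives. -/
notation:max "dT" A:max => dirD (vT A)

/-- The strip `[0,1] × ℝ²`. -/
def strip : Set Strip := Icc (0 : ℝ) 1 ×ˢ univ

/-- The part of the strip over the closed disc `|θ| ≤ 2`. -/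
def disc : Set Strip := Icc (0 : ℝ) 1 ×ˢ {θ | eucSq θ ≤ 4}

lemma disc_subset : disc ⊆ strip := prod_mono le_rfl (subset_univ _)

lemma mem_strip {x : Strip} : x ∈ strip ↔ x.1 ∈ Icc (0 : ℝ) 1 := by simp [strip]

lemma uniqueDiffOn_strip : UniqueDiffOn ℝ strip :=
  (uniqueDiffOn_Icc zero_lt_one).prod uniqueDiffOn_univ

/-- Smoothness near the strip. -/
def Sm (f : Strip → ℝ) : Prop := ∀ x ∈ strip, ContDiffAt ℝ ∞ f x

namespace Sm

variable {f g : Strip → ℝ}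

lemma of_contDiff (h : ContDiff ℝ ∞ f) : Sm f := fun _ _ => h.contDiffAt

lemma diff (hf : Sm f) {x : Strip} (hx : x ∈ strip) : DifferentiableAt ℝ f x :=
  (hf x hx).differentiableAt (by simp)

lemma const (c : ℝ) : Sm fun _ => c := fun _ _ => contDiffAt_const

lemma add (hf : Sm f) (hg : Sm g) : Sm fun x => f x + g x := fun x hx => (hf x hx).add (hg x hx)

lemma sub (hf : Sm f) (hg : Sm g) : Sm fun x => f x - g x := fun x hx => (hf x hx).sub (hg x hx)

lemma neg (hf : Sm f) : Sm fun x => - f x := fun x hx => (hf x hx).neg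

lemma mul (hf : Sm f) (hg : Sm g) : Sm fun x => f x * g x := fun x hx => (hf x hx).mul (hg x hx)

lemma pow (hf : Sm f) (n : ℕ) : Sm fun x => f x ^ n := fun x hx => (hf x hx).pow n

lemma inv (hf : Sm f) (h : ∀ x ∈ strip, f x ≠ 0) : Sm fun x => (f x)⁻¹ :=
  fun x hx => (hf x hx).inv (h x hx)

lemma sqrt (hf : Sm f) (h : ∀ x ∈ strip, f x ≠ 0) : Sm fun x => Real.sqrt (f x) :=
  fun x hx => (hf x hx).sqrt (h x hx)

lemma sum {α : Type*} {s : Finset α} {F : α → Strip → ℝ} (h : ∀ i ∈ s, Sm (F i)) :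
    Sm fun x => ∑ i ∈ s, F i x :=
  fun x hx => ContDiffAt.sum fun i hi => h i hi x hx

lemma dirD (hf : Sm f) (v : Strip) : Sm (dirD v f) := fun x hx =>
  ((hf x hx).fderiv_right (m := ∞) (by simp)).clm_apply contDiffAt_const

/-- The strip has unique derivatives, also at its faces `s = 0` and `s = 1`, so the values on it
determine the derivatives there. This permits differentiating identities known only for `s` in
`[0,1]`. -/
lemma dirD_congr (hf : Sm f) (hg : Sm g) (h : EqOn f g strip) (v : Strip) :
    EqOn (NullGeom.dirD v f) (NullGeom.dirD v g) strip := by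
  intro x hx
  have h1 := (hf.diff hx).fderivWithin (uniqueDiffOn_strip x hx)
  have h2 := (hg.diff hx).fderivWithin (uniqueDiffOn_strip x hx)
  simp only [NullGeom.dirD, ← h1, ← h2, fderivWithin_congr h (h hx)]

lemma dirD_comm (hf : Sm f) (v w : Strip) {x : Strip} (hx : x ∈ strip) :
    NullGeom.dirD v (NullGeom.dirD w f) x = NullGeom.dirD w (NullGeom.dirD v f) x := by
  have h1 : DifferentiableAt ℝ (fderiv ℝ f) x :=
    ((hf x hx).fderiv_right (m := 1) (by norm_cast)).differentiableAt (by simp)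
  have h2 : IsSymmSndFDerivAt ℝ f x := (hf x hx).isSymmSndFDerivAt (by simp; norm_cast)
  have h3 : ∀ u u' : Strip, NullGeom.dirD u (NullGeom.dirD u' f) x
      = fderiv ℝ (fderiv ℝ f) x u u' := by
    intro u u'
    unfold NullGeom.dirD
    rw [fderiv_clm_apply h1 (differentiableAt_const _)]
    simp
  rw [h3, h3, h2.eq]

end Sm

section Rules

variable {f g : Strip → ℝ} {x : Strip} (v : Strip)

lemma dirD_const (c : ℝ) (x : Strip) : dirD v (fun _ => c) x = 0 := by simp [dirD]

lemma dirD_add (hf : Sm f) (hg : Sm g) (hx : x ∈ strip) :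
    dirD v (fun y => f y + g y) x = dirD v f x + dirD v g x := by
  simp [dirD, fderiv_fun_add (hf.diff hx) (hg.diff hx)]

lemma dirD_sub (hf : Sm f) (hg : Sm g) (hx : x ∈ strip) :
    dirD v (fun y => f y - g y) x = dirD v f x - dirD v g x := by
  simp [dirD, fderiv_fun_sub (hf.diff hx) (hg.diff hx)]

lemma dirD_neg : dirD v (fun y => - f y) x = - dirD v f x := by
  simp [dirD, fderiv_fun_neg]

lemma dirD_mul (hf : Sm f) (hg : Sm g) (hx : x ∈ strip) :
    dirD v (fun y => f y * g y) x = dirD v f x * g x + f x * dirD v g x := by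
  simp [dirD, fderiv_fun_mul (hf.diff hx) (hg.diff hx)]; ring

lemma dirD_const_mul (hf : Sm f) (c : ℝ) (hx : x ∈ strip) :
    dirD v (fun y => c * f y) x = c * dirD v f x := by
  simp [dirD, fderiv_const_mul (hf.diff hx)]

lemma dirD_inv (hf : Sm f) (h : ∀ x ∈ strip, f x ≠ 0) (hx : x ∈ strip) :
    dirD v (fun y => (f y)⁻¹) x = - (f x)⁻¹ * (f x)⁻¹ * dirD v f x := by
  have h1 : EqOn (fun y => f y * (f y)⁻¹) (fun _ => 1) strip := fun y hy => mul_inv_cancel₀ (h y hy)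
  have h2 := (hf.mul (hf.inv h)).dirD_congr (Sm.const 1) h1 v hx
  rw [dirD_mul v hf (hf.inv h) hx, dirD_const] at h2
  have := h x hx
  field_simp at h2 ⊢
  linear_combination h2

end Rules

lemma Sm.hasDerivAt {f : Strip → ℝ} (hf : Sm f) {s : ℝ} {θ : Fin 2 → ℝ} (hx : s ∈ Icc (0 : ℝ) 1) :
    HasDerivAt (fun t => f (t, θ)) (dS f (s, θ)) s := by
  have h1 : HasFDerivAt f (fderiv ℝ f (s, θ)) (s, θ) := (hf.diff (mem_strip.2 hx)).hasFDerivAt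
  have h2 : HasDerivAt (fun t : ℝ => (t, θ)) ((1 : ℝ), (0 : Fin 2 → ℝ)) s :=
    (hasDerivAt_id s).prodMk (hasDerivAt_const s θ)
  exact h1.comp_hasDerivAt s h2

lemma Sm.angular_eq {f : Strip → ℝ} (hf : Sm f) {s : ℝ} (hs : s ∈ Icc (0 : ℝ) 1) (a : Fin 2)
    (θ : Fin 2 → ℝ) : dT a f (s, θ) = pd (fun θ' => f (s, θ')) a θ := by
  have : HasFDerivAt (fun θ' : Fin 2 → ℝ => f (s, θ'))
      ((fderiv ℝ f (s, θ)).comp (ContinuousLinearMap.inr ℝ ℝ (Fin 2 → ℝ))) θ :=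
    ((hf.diff (mem_strip.2 hs)).hasFDerivAt).comp θ
      ((hasFDerivAt_const s θ).prodMk (hasFDerivAt_id θ))
  simp [pd, this.fderiv]
  rfl

lemma Sm.angular_eq_zero_of_const {f : Strip → ℝ} (hf : Sm f) {c : ℝ} (h : ∀ θ, f (0, θ) = c)
    (a : Fin 2) (θ : Fin 2 → ℝ) : dT a f (0, θ) = 0 := by
  rw [hf.angular_eq (by simp)]
  simp [h, pd]

/-! ### Uniformly bounded families -/

section Families

variable {ι : Type*}

/-- The angular derivatives of order at most `k` of the members of the family `f` are
`O(κ)` on the disc. -/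
def Bd (κ : ι → ℝ) : ℕ → (ι → Strip → ℝ) → Prop
  | 0, f => (∀ p, Sm (f p)) ∧ ∃ C, ∀ p, ∀ x ∈ disc, |f p x| ≤ C * κ p
  | k + 1, f => (∀ p, Sm (f p)) ∧ (∃ C, ∀ p, ∀ x ∈ disc, |f p x| ≤ C * κ p) ∧
      ∀ a, Bd κ k fun p => dT a (f p)

namespace Bd

variable {κ κ' : ι → ℝ} {k : ℕ} {f g : ι → Strip → ℝ}

lemma sm (h : Bd κ k f) (p : ι) : Sm (f p) := by
  cases k with
  | zero => exact h.1 p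
  | succ k => exact h.1 p

lemma bound (h : Bd κ k f) : ∃ C, ∀ p, ∀ x ∈ disc, |f p x| ≤ C * κ p := by
  cases k with
  | zero => exact h.2
  | succ k => exact h.2.1

lemma ang (h : Bd κ (k + 1) f) (a : Fin 2) : Bd κ k fun p => dT a (f p) := h.2.2 a

lemma of_succ : ∀ {k : ℕ} {f : ι → Strip → ℝ}, Bd κ (k + 1) f → Bd κ k f
  | 0, _, h => ⟨h.1, h.2.1⟩
  | _ + 1, _, h => ⟨h.1, h.2.1, fun a => (h.2.2 a).of_succ⟩

lemma mono {l : ℕ} (h : Bd κ k f) (hl : l ≤ k) : Bd κ l f := by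
  induction k with
  | zero => simpa [Nat.le_zero.1 hl] using h
  | succ k ih =>
    rcases Nat.lt_or_ge l (k + 1) with h1 | h1
    · exact ih h.of_succ (by omega)
    · rwa [le_antisymm hl h1]

/-- Geometric identities are available on the strip only, which is enough for them to pass to the
angular derivatives. -/
lemma congr (h : Bd κ k f) (hg : ∀ p, Sm (g p)) (he : ∀ p, EqOn (f p) (g p) strip) :
    Bd κ k g := by
  induction k generalizing f g with
  | zero =>
    refine ⟨hg, h.2.imp fun C hC p x hx => ?_⟩
    rw [← he p (disc_subset hx)]; exact hC p x hx
  | succ k ih =>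
    refine ⟨hg, h.2.1.imp fun C hC p x hx => ?_, fun a => ?_⟩
    · rw [← he p (disc_subset hx)]; exact hC p x hx
    · exact ih (h.2.2 a) (fun p => (hg p).dirD _)
        (fun p => (h.sm p).dirD_congr (hg p) (he p) _)

lemma weaken (h : Bd κ k f) (B : ℝ) (hB : ∀ p, |κ p| ≤ B * κ' p) : Bd κ' k f := by
  have key : ∀ {f : ι → Strip → ℝ}, (∃ C, ∀ p, ∀ x ∈ disc, |f p x| ≤ C * κ p) →
      ∃ C, ∀ p, ∀ x ∈ disc, |f p x| ≤ C * κ' p := by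
    rintro f ⟨C, hC⟩
    refine ⟨|C| * B, fun p x hx => (hC p x hx).trans ?_⟩
    calc C * κ p ≤ |C * κ p| := le_abs_self _
      _ = |C| * |κ p| := abs_mul _ _
      _ ≤ |C| * (B * κ' p) := by gcongr; exact hB p
      _ = _ := by ring
  induction k generalizing f with
  | zero => exact ⟨h.1, key h.2⟩
  | succ k ih => exact ⟨h.1, key h.2.1, fun a => ih (h.2.2 a)⟩

lemma const_fun (c : ι → ℝ) (B : ℝ) (hB : ∀ p, |c p| ≤ B * κ p) (k : ℕ) :
    Bd κ k fun p _ => c p := by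
  have zero : ∀ k : ℕ, Bd κ k (fun (_ : ι) (_ : Strip) => (0 : ℝ)) := by
    intro k
    induction k with
    | zero => exact ⟨fun p => Sm.const 0, 0, by simp⟩
    | succ k ih =>
      refine ⟨fun p => Sm.const 0, ⟨0, by simp⟩, fun a => ?_⟩
      have : (fun (p : ι) => dT a (fun _ => (0 : ℝ))) = fun (_ : ι) (_ : Strip) => (0 : ℝ) := by
        ext p x; exact dirD_const _ _ _
      rw [this]; exact ih
  cases k with
  | zero => exact ⟨fun p => Sm.const _, B, fun p x _ => hB p⟩
  | succ k =>
    refine ⟨fun p => Sm.const _, ⟨B, fun p x _ => hB p⟩, fun a => ?_⟩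
    have : (fun (p : ι) => dT a (fun _ => c p)) = fun (_ : ι) (_ : Strip) => (0 : ℝ) := by
      ext p x; exact dirD_const _ _ _
    rw [this]; exact zero k

lemma add (hf : Bd κ k f) (hg : Bd κ k g) : Bd κ k fun p x => f p x + g p x := by
  have key : ∀ {f g : ι → Strip → ℝ}, (∃ C, ∀ p, ∀ x ∈ disc, |f p x| ≤ C * κ p) →
      (∃ C, ∀ p, ∀ x ∈ disc, |g p x| ≤ C * κ p) →
      ∃ C, ∀ p, ∀ x ∈ disc, |f p x + g p x| ≤ C * κ p := by
    rintro f g ⟨C, hC⟩ ⟨C', hC'⟩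
    refine ⟨C + C', fun p x hx => (abs_add_le _ _).trans ?_⟩
    rw [add_mul]
    exact add_le_add (hC p x hx) (hC' p x hx)
  induction k generalizing f g with
  | zero => exact ⟨fun p => (hf.sm p).add (hg.sm p), key hf.2 hg.2⟩
  | succ k ih =>
    refine ⟨fun p => (hf.sm p).add (hg.sm p), key hf.2.1 hg.2.1, fun a => ?_⟩
    exact (ih (hf.2.2 a) (hg.2.2 a)).congr (fun p => ((hf.sm p).add (hg.sm p)).dirD _)
      (fun p x hx => (dirD_add _ (hf.sm p) (hg.sm p) hx).symm)

lemma mul (hf : Bd κ k f) (hg : Bd κ' k g) :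
    Bd (fun p => κ p * κ' p) k fun p x => f p x * g p x := by
  have key : ∀ {f g : ι → Strip → ℝ}, (∃ C, ∀ p, ∀ x ∈ disc, |f p x| ≤ C * κ p) →
      (∃ C, ∀ p, ∀ x ∈ disc, |g p x| ≤ C * κ' p) →
      ∃ C, ∀ p, ∀ x ∈ disc, |f p x * g p x| ≤ C * (κ p * κ' p) := by
    rintro f g ⟨C, hC⟩ ⟨C', hC'⟩
    refine ⟨C * C', fun p x hx => ?_⟩
    calc |f p x * g p x| = |f p x| * |g p x| := abs_mul _ _
      _ ≤ (C * κ p) * (C' * κ' p) := mul_le_mul (hC p x hx) (hC' p x hx) (abs_nonneg _)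
          ((abs_nonneg _).trans (hC p x hx))
      _ = _ := by ring
  induction k generalizing f g with
  | zero => exact ⟨fun p => (hf.sm p).mul (hg.sm p), key hf.2 hg.2⟩
  | succ k ih =>
    refine ⟨fun p => (hf.sm p).mul (hg.sm p), key hf.2.1 hg.2.1, fun a => ?_⟩
    exact ((ih (hf.2.2 a) hg.of_succ).add (ih hf.of_succ (hg.2.2 a))).congr
      (fun p => ((hf.sm p).mul (hg.sm p)).dirD _)
      (fun p x hx => (dirD_mul _ (hf.sm p) (hg.sm p) hx).symm)

lemma smul (hf : Bd κ k f) (c : ι → ℝ) : Bd (fun p => |c p| * κ p) k fun p x => c p * f p x :=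
  (const_fun (κ := fun p => |c p|) c 1 (fun p => by simp) k).mul hf

lemma const_mul (hf : Bd κ k f) (c : ℝ) : Bd κ k fun p x => c * f p x := by
  have h := (const_fun (κ := fun _ : ι => (1 : ℝ)) (fun _ => c) |c| (fun p => by simp) k).mul hf
  simpa using h

lemma neg (hf : Bd κ k f) : Bd κ k fun p x => - f p x := by
  simpa using hf.const_mul (-1)

lemma sub (hf : Bd κ k f) (hg : Bd κ k g) : Bd κ k fun p x => f p x - g p x := by
  simpa [sub_eq_add_neg] using hf.add hg.neg

lemma zero (κ : ι → ℝ) (k : ℕ) : Bd κ k fun _ _ => 0 :=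
  const_fun (fun _ => 0) 0 (by simp) k

lemma sum {α : Type*} {s : Finset α} {F : α → ι → Strip → ℝ} (h : ∀ i ∈ s, Bd κ k (F i)) :
    Bd κ k fun p x => ∑ i ∈ s, F i p x := by
  classical
  induction s using Finset.induction_on with
  | empty => simpa using zero κ k
  | insert a s ha ih =>
    simp only [Finset.sum_insert ha]
    exact (h a (by simp)).add (ih fun i hi => h i (by simp [hi]))

/-- Products of families of order one. -/
lemma mul_one (hf : Bd (fun _ => 1) k f) (hg : Bd κ k g) : Bd κ k fun p x => f p x * g p x := by
  simpa using hf.mul hg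

lemma mul_one' (hf : Bd κ k f) (hg : Bd (fun _ => 1) k g) : Bd κ k fun p x => g p x * f p x :=
  hg.mul_one hf

lemma one_const (c : ℝ) (k : ℕ) : Bd (fun _ : ι => 1) k fun _ _ => c :=
  const_fun (fun _ => c) |c| (by simp) k

/-- Since `∂(1/f) = -f⁻² ∂f`, the derivatives of `1/f` need `1/f` itself to one order less, and the
induction closes. -/
lemma inv (hf : Bd (fun _ => 1) k f) (h0 : ∀ p, ∀ x ∈ strip, f p x ≠ 0) (c : ℝ) (hc : 0 < c)
    (h : ∀ p, ∀ x ∈ disc, c ≤ |f p x|) : Bd (fun _ => 1) k fun p x => (f p x)⁻¹ := by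
  have key : ∃ C : ℝ, ∀ p, ∀ x ∈ disc, |(f p x)⁻¹| ≤ C * 1 := by
    refine ⟨c⁻¹, fun p x hx => ?_⟩
    rw [abs_inv, _root_.mul_one]
    exact inv_anti₀ hc (h p x hx)
  induction k with
  | zero => exact ⟨fun p => (hf.sm p).inv (h0 p), key⟩
  | succ k ih =>
    refine ⟨fun p => (hf.sm p).inv (h0 p), key, fun a => ?_⟩
    have hi := ih hf.of_succ
    refine ((hi.mul_one hi).neg.mul_one (hf.ang a)).congr (fun p => ((hf.sm p).inv (h0 p)).dirD _) ?_
    intro p x hx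
    rw [dirD_inv _ (hf.sm p) (h0 p) hx]; ring

/-- A family which vanishes at `s = 0` is controlled by its derivative in `s`. -/
lemma integrate (hf : ∀ p, Sm (f p)) (h0 : ∀ p θ, f p (0, θ) = 0)
    (h : Bd κ k fun p => dS (f p)) : Bd κ k f := by
  have key : ∀ {f : ι → Strip → ℝ}, (∀ p, Sm (f p)) → (∀ p θ, f p (0, θ) = 0) →
      (∃ C, ∀ p, ∀ x ∈ disc, |dS (f p) x| ≤ C * κ p) →
      ∃ C, ∀ p, ∀ x ∈ disc, |f p x| ≤ C * κ p := by
    rintro f hf h0 ⟨C, hC⟩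
    refine ⟨C, fun p x hx => ?_⟩
    obtain ⟨s, θ⟩ := x
    obtain ⟨hs, hθ⟩ := hx
    have h1 := (convex_Icc (0 : ℝ) 1).norm_image_sub_le_of_norm_hasDerivWithin_le
      (f := fun t => f p (t, θ)) (f' := fun t => dS (f p) (t, θ)) (C := C * κ p)
      (fun t ht => ((hf p).hasDerivAt ht).hasDerivWithinAt)
      (fun t ht => by simpa using hC p (t, θ) ⟨ht, hθ⟩) (left_mem_Icc.2 zero_le_one) hs
    simp only [h0, sub_zero, Real.norm_eq_abs] at h1
    refine h1.trans ?_
    have h2 : 0 ≤ C * κ p := (abs_nonneg _).trans (hC p (s, θ) ⟨hs, hθ⟩)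
    calc C * κ p * |s| ≤ C * κ p * 1 := by
          gcongr; rw [abs_of_nonneg hs.1]; exact hs.2
      _ = _ := by ring
  induction k generalizing f with
  | zero => exact ⟨hf, key hf h0 h.2⟩
  | succ k ih =>
    refine ⟨hf, key hf h0 h.2.1, fun a => ?_⟩
    -- An angular derivative of `f` also vanishes at `s = 0`, and it commutes with `∂_s`.
    refine ih (fun p => (hf p).dirD _) (fun p θ => ?_) ?_
    · exact (hf p).angular_eq_zero_of_const (h0 p) a θ
    · exact (h.2.2 a).congr (fun p => ((hf p).dirD _).dirD _)
        (fun p x hx => (hf p).dirD_comm _ _ hx)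

end Bd

end Families


/-! ### Parametric integrals -/

section Parametric

variable {V E : Type*} [NormedAddCommGroup V] [NormedSpace ℝ V] [ProperSpace V]
  [NormedAddCommGroup E] [NormedSpace ℝ E]

lemma hasFDerivAt_integral_param {g : ℝ × V → E} (hg : ContDiff ℝ 1 g) (x : V) :
    HasFDerivAt (fun y => ∫ t in (0 : ℝ)..1, g (t, y))
      (∫ t in (0 : ℝ)..1, (fderiv ℝ g (t, x)).comp (ContinuousLinearMap.inr ℝ ℝ V)) x := by
  have hc : Continuous fun z : ℝ × V => (fderiv ℝ g z).comp (ContinuousLinearMap.inr ℝ ℝ V) :=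
    (hg.continuous_fderiv (by simp)).clm_comp continuous_const
  have hcomp : IsCompact (Icc (0 : ℝ) 1 ×ˢ Metric.closedBall x 1) :=
    isCompact_Icc.prod (isCompact_closedBall x 1)
  obtain ⟨B, hB⟩ := hcomp.exists_bound_of_continuousOn hc.continuousOn
  refine (intervalIntegral.hasFDerivAt_integral_of_dominated_of_fderiv_le
    (F := fun y t => g (t, y)) (bound := fun _ => B)
    (F' := fun y t => (fderiv ℝ g (t, y)).comp (ContinuousLinearMap.inr ℝ ℝ V))
    (Metric.ball_mem_nhds x one_pos) ?_ ?_ ?_ ?_ ?_ ?_)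
  · exact Filter.Eventually.of_forall fun y =>
      (hg.continuous.comp (by fun_prop)).aestronglyMeasurable
  · exact (hg.continuous.comp (by fun_prop : Continuous fun t : ℝ => (t, x))).intervalIntegrable _ _
  · exact (hc.comp (by fun_prop : Continuous fun t : ℝ => (t, x))).aestronglyMeasurable
  · refine Filter.Eventually.of_forall fun t ht y hy => hB (t, y) ⟨?_, Metric.ball_subset_closedBall hy⟩
    rw [uIoc_of_le zero_le_one] at ht
    exact ⟨ht.1.le, ht.2⟩
  · exact intervalIntegrable_const
  · refine Filter.Eventually.of_forall fun t _ y _ => ?_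
    exact ((hg.differentiable (by simp)).differentiableAt.hasFDerivAt).comp y
      ((hasFDerivAt_const t y).prodMk (hasFDerivAt_id y))

end Parametric

/-- Differentiation under the integral sign, iterated. The target space varies in the induction
because the derivative is again such an integral, with values in a space of linear maps. -/
lemma contDiff_integral_param {V : Type} [NormedAddCommGroup V] [NormedSpace ℝ V] [ProperSpace V]
    (n : ℕ) : ∀ {E : Type} [NormedAddCommGroup E] [NormedSpace ℝ E]
    {g : ℝ × V → E}, ContDiff ℝ ∞ g → ContDiff ℝ n fun y => ∫ t in (0 : ℝ)..1, g (t, y) := by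
  induction n with
  | zero =>
    intro E _ _ g hg
    refine contDiff_zero.2 (continuous_iff_continuousAt.2 fun x => ?_)
    exact (hasFDerivAt_integral_param (hg.of_le (by norm_cast)) x).continuousAt
  | succ n ih =>
    intro E _ _ g hg
    push_cast
    refine contDiff_succ_iff_fderiv.2 ⟨fun x => ?_, by simp, ?_⟩
    · exact (hasFDerivAt_integral_param (hg.of_le (by norm_cast)) x).differentiableAt
    · have h1 : fderiv ℝ (fun y => ∫ t in (0 : ℝ)..1, g (t, y)) = fun x =>
          ∫ t in (0 : ℝ)..1, (fderiv ℝ g (t, x)).comp (ContinuousLinearMap.inr ℝ ℝ V) := by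
        ext1 x
        exact (hasFDerivAt_integral_param (hg.of_le (by norm_cast)) x).fderiv
      rw [h1]
      exact ih (g := fun z => (fderiv ℝ g z).comp (ContinuousLinearMap.inr ℝ ℝ V))
        ((hg.fderiv_right (by simp)).clm_comp contDiff_const)

/-- The primitive in the first variable which vanishes at `s = 0`. -/
noncomputable def prim (f : Strip → ℝ) : Strip → ℝ := fun x => ∫ t in (0 : ℝ)..x.1, f (t, x.2)

lemma contDiff_prim {f : Strip → ℝ} (hf : ContDiff ℝ ∞ f) : ContDiff ℝ ∞ (prim f) := by
  -- Rescaling to a fixed interval moves the variable endpoint into the integrand.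
  have h : prim f = fun x : Strip => ∫ t in (0 : ℝ)..1, (fun z : ℝ × Strip =>
      z.2.1 * f (z.1 * z.2.1, z.2.2)) (t, x) := by
    ext x
    have := intervalIntegral.smul_integral_comp_mul_right (a := 0) (b := 1)
      (fun t => f (t, x.2)) x.1
    simp only [prim, intervalIntegral.integral_const_mul]
    simpa using this.symm
  rw [h]
  refine contDiff_infty.2 fun n => contDiff_integral_param (V := Strip) (E := ℝ) n
    (g := fun z : ℝ × Strip => z.2.1 * f (z.1 * z.2.1, z.2.2)) ?_
  exact contDiff_snd.fst.mul (hf.comp ((contDiff_fst.mul contDiff_snd.fst).prodMk contDiff_snd.snd))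

lemma prim_zero (f : Strip → ℝ) (θ : Fin 2 → ℝ) : prim f (0, θ) = 0 := by simp [prim]

lemma dS_prim {f : Strip → ℝ} (hf : ContDiff ℝ ∞ f) {x : Strip} (hx : x ∈ strip) :
    dS (prim f) x = f x := by
  have h1 := (Sm.of_contDiff (contDiff_prim hf)).hasDerivAt (θ := x.2) (mem_strip.1 hx)
  have hc : Continuous fun t => f (t, x.2) := hf.continuous.comp (by fun_prop)
  have h2 := (hc.integral_hasStrictDerivAt 0 x.1).hasDerivAt
  exact h1.unique h2

lemma dirD_comp_pair {G : ℝ × ℝ → ℝ} (hG : ContDiff ℝ ∞ G) {a b : Strip → ℝ} (ha : Sm a)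
    (hb : Sm b) (v : Strip) {x : Strip} (hx : x ∈ strip) :
    dirD v (fun y => G (a y, b y)) x = fderiv ℝ G (a x, b x) (1, 0) * dirD v a x
      + fderiv ℝ G (a x, b x) (0, 1) * dirD v b x := by
  have h1 : HasFDerivAt G (fderiv ℝ G (a x, b x)) (a x, b x) :=
    (hG.differentiable (by simp) _).hasFDerivAt
  have h2 := h1.comp x ((ha.diff hx).hasFDerivAt.prodMk (hb.diff hx).hasFDerivAt)
  have h3 : dirD v (fun y => G (a y, b y)) x
      = fderiv ℝ G (a x, b x) (dirD v a x, dirD v b x) := by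
    have := congrArg (fun l => l v) h2.fderiv
    simpa [dirD, Function.comp_def] using this
  have h4 : (dirD v a x, dirD v b x)
      = dirD v a x • ((1 : ℝ), (0 : ℝ)) + dirD v b x • ((0 : ℝ), (1 : ℝ)) := by simp
  rw [h3, h4, map_add, map_smul, map_smul]
  simp [mul_comm]

lemma Sm.comp_pair {G : ℝ × ℝ → ℝ} (hG : ContDiff ℝ ∞ G) {a b : Strip → ℝ} (ha : Sm a)
    (hb : Sm b) : Sm fun y => G (a y, b y) := fun x hx =>
  hG.contDiffAt.comp x ((ha x hx).prodMk (hb x hx))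

lemma isCompact_disc : IsCompact disc := by
  refine isCompact_Icc.prod (Metric.isCompact_of_isClosed_isBounded ?_ ?_)
  · exact isClosed_le (by unfold eucSq; fun_prop) continuous_const
  · refine (Metric.isBounded_closedBall (x := (0 : Fin 2 → ℝ)) (r := 2)).subset fun θ hθ => ?_
    rw [mem_closedBall_zero_iff, pi_norm_le_iff_of_nonneg (by norm_num)]
    intro A
    rw [Real.norm_eq_abs]
    refine abs_le_of_sq_le_sq ?_ (by norm_num)
    simp only [mem_ofPred_eq, eucSq] at hθ
    fin_cases A <;> simp <;> nlinarith [sq_nonneg (θ 0), sq_nonneg (θ 1)]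

namespace Bd

variable {ι : Type*} {κ : ι → ℝ} {k : ℕ}

lemma fixed {F : Strip → ℝ} (hF : ContDiff ℝ ∞ F) (k : ℕ) :
    Bd (fun _ : ι => 1) k fun _ => F := by
  have key : ∀ {F : Strip → ℝ}, ContDiff ℝ ∞ F →
      ∃ C : ℝ, ∀ _ : ι, ∀ x ∈ disc, |F x| ≤ C * 1 := by
    intro F hF
    obtain ⟨C, hC⟩ := isCompact_disc.exists_bound_of_continuousOn hF.continuous.continuousOn
    exact ⟨C, fun _ x hx => by simpa using hC x hx⟩
  induction k generalizing F with
  | zero => exact ⟨fun _ => Sm.of_contDiff hF, key hF⟩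
  | succ k ih =>
    exact ⟨fun _ => Sm.of_contDiff hF, key hF, fun a =>
      ih ((hF.fderiv_right (by simp)).clm_apply contDiff_const)⟩

/-- On the disc the pairs `(a, b)` stay in one compact rectangle, where `G` and its partial
derivatives are bounded; the chain rule does the rest. -/
lemma comp_pair {G : ℝ × ℝ → ℝ} (hG : ContDiff ℝ ∞ G) {a b : ι → Strip → ℝ}
    (ha : Bd (fun _ => 1) k a) (hb : Bd (fun _ => 1) k b) :
    Bd (fun _ => 1) k fun p x => G (a p x, b p x) := by
  have key : ∀ {G : ℝ × ℝ → ℝ}, ContDiff ℝ ∞ G →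
      ∃ C : ℝ, ∀ p, ∀ x ∈ disc, |G (a p x, b p x)| ≤ C * 1 := by
    intro G hG
    obtain ⟨Ca, hCa⟩ := ha.bound
    obtain ⟨Cb, hCb⟩ := hb.bound
    have hc : IsCompact (Icc (-Ca) Ca ×ˢ Icc (-Cb) Cb) := isCompact_Icc.prod isCompact_Icc
    obtain ⟨C, hC⟩ := hc.exists_bound_of_continuousOn hG.continuous.continuousOn
    refine ⟨C, fun p x hx => ?_⟩
    have h1 := hCa p x hx
    have h2 := hCb p x hx
    rw [_root_.mul_one] at h1 h2 ⊢
    exact hC (a p x, b p x) ⟨abs_le.1 h1, abs_le.1 h2⟩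
  induction k generalizing G with
  | zero => exact ⟨fun p => Sm.comp_pair hG (ha.sm p) (hb.sm p), key hG⟩
  | succ k ih =>
    refine ⟨fun p => Sm.comp_pair hG (ha.sm p) (hb.sm p), key hG, fun c => ?_⟩
    have hd : ∀ v : ℝ × ℝ, ContDiff ℝ ∞ fun z => fderiv ℝ G z v := fun v =>
      (hG.fderiv_right (by simp)).clm_apply contDiff_const
    have h := ((ih (hd (1, 0)) ha.of_succ hb.of_succ).mul_one (ha.ang c)).add
      ((ih (hd (0, 1)) ha.of_succ hb.of_succ).mul_one (hb.ang c))
    exact h.congr (fun p => (Sm.comp_pair hG (ha.sm p) (hb.sm p)).dirD _)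
      (fun p x hx => (dirD_comp_pair hG (ha.sm p) (hb.sm p) _ hx).symm)

/-- Grönwall for the pair `(f, f')` with `f'' = a f + g`. Angular derivatives of `f` solve an
equation of the same form, whose additional source `(∂a) f` is of lower order. -/
lemma ode (hf : ∀ p, Sm (f p)) {a g : ι → Strip → ℝ} (ha : Bd (fun _ => 1) k a) (hg : Bd κ k g)
    (c₀ c₁ : ι → ℝ) (B : ℝ) (hB₀ : ∀ p, |c₀ p| ≤ B * κ p) (hB₁ : ∀ p, |c₁ p| ≤ B * κ p)
    (h0 : ∀ p θ, f p (0, θ) = c₀ p) (h1 : ∀ p θ, dS (f p) (0, θ) = c₁ p)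
    (he : ∀ p, ∀ x ∈ strip, dS (dS (f p)) x = a p x * f p x + g p x) : Bd κ k f := by
  obtain ⟨M, hM⟩ := ha.bound
  have key : ∀ {f g : ι → Strip → ℝ} {c₀ c₁ : ι → ℝ} {B : ℝ}, (∀ p, Sm (f p)) →
      (∃ C, ∀ p, ∀ x ∈ disc, |g p x| ≤ C * κ p) → (∀ p, |c₀ p| ≤ B * κ p) →
      (∀ p, |c₁ p| ≤ B * κ p) → (∀ p θ, f p (0, θ) = c₀ p) → (∀ p θ, dS (f p) (0, θ) = c₁ p) →
      (∀ p, ∀ x ∈ strip, dS (dS (f p)) x = a p x * f p x + g p x) →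
      ∃ C, ∀ p, ∀ x ∈ disc, |f p x| ≤ C * κ p := by
    rintro f g c₀ c₁ B hf ⟨C, hC⟩ hB₀ hB₁ h0 h1 he
    -- The extra one accounts for the first component `f' = f'` of the system and keeps `K` away
    -- from zero in the Grönwall bound.
    set K : ℝ := |M| + 1 with hK
    have hK1 : 1 ≤ K := by simp [hK]
    refine ⟨B * Real.exp K + C / K * (Real.exp K - 1), fun p x hx => ?_⟩
    obtain ⟨s, θ⟩ := x
    obtain ⟨hs, hθ⟩ := hx
    have hd : ∀ t ∈ Icc (0 : ℝ) 1, HasDerivAt (fun t => (f p (t, θ), dS (f p) (t, θ)))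
        (dS (f p) (t, θ), dS (dS (f p)) (t, θ)) t := fun t ht =>
      ((hf p).hasDerivAt ht).prodMk (((hf p).dirD _).hasDerivAt ht)
    have hB : 0 ≤ B * κ p := (abs_nonneg _).trans (hB₀ p)
    have hCk : 0 ≤ C * κ p := (abs_nonneg _).trans (hC p (s, θ) ⟨hs, hθ⟩)
    have h2 := norm_le_gronwallBound_of_norm_deriv_right_le (a := 0) (b := 1) (δ := B * κ p)
      (K := K) (ε := C * κ p) (f := fun t => (f p (t, θ), dS (f p) (t, θ)))
      (f' := fun t => (dS (f p) (t, θ), dS (dS (f p)) (t, θ)))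
      (fun t ht => (hd t ht).continuousAt.continuousWithinAt)
      (fun t ht => (hd t ⟨ht.1, ht.2.le⟩).hasDerivWithinAt)
      (by
        simp only [Prod.norm_def, h0, h1, Real.norm_eq_abs]
        exact max_le (hB₀ p) (hB₁ p))
      (by
        intro t ht
        have ht' : t ∈ Icc (0 : ℝ) 1 := ⟨ht.1, ht.2.le⟩
        have hm := hM p (t, θ) ⟨ht', hθ⟩
        rw [_root_.mul_one] at hm
        have e1 : |f p (t, θ)| ≤ max |f p (t, θ)| |dS (f p) (t, θ)| := le_max_left _ _
        have e2 : |dS (f p) (t, θ)| ≤ max |f p (t, θ)| |dS (f p) (t, θ)| := le_max_right _ _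
        simp only [Prod.norm_def, Real.norm_eq_abs]
        set m := max |f p (t, θ)| |dS (f p) (t, θ)|
        have hm0 : 0 ≤ m := (abs_nonneg _).trans e1
        refine max_le ?_ ?_
        · nlinarith [abs_nonneg M]
        · rw [he p (t, θ) (mem_strip.2 ht')]
          refine (abs_add_le _ _).trans (add_le_add ?_ (hC p _ ⟨ht', hθ⟩))
          rw [abs_mul]
          exact mul_le_mul (hm.trans (by linarith [le_abs_self M])) e1 (abs_nonneg _) (by linarith))
      s hs
    have h3 : |f p (s, θ)| ≤ gronwallBound (B * κ p) K (C * κ p) (s - 0) :=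
      (le_max_left _ _).trans h2
    refine h3.trans ?_
    rw [gronwallBound_of_K_ne_0 (by linarith), sub_zero]
    have h4 : Real.exp (K * s) ≤ Real.exp K := Real.exp_le_exp.2 (by nlinarith [hs.2])
    have h5 : 0 ≤ C * κ p / K := by positivity
    calc B * κ p * Real.exp (K * s) + C * κ p / K * (Real.exp (K * s) - 1)
        ≤ B * κ p * Real.exp K + C * κ p / K * (Real.exp K - 1) := by gcongr
      _ = _ := by ring
  induction k generalizing f g c₀ c₁ B with
  | zero => exact ⟨hf, key hf hg.bound hB₀ hB₁ h0 h1 he⟩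
  | succ k ih =>
    have hfk : Bd κ k f := ih hf ha.of_succ hg.of_succ c₀ c₁ B hB₀ hB₁ h0 h1 he
    refine ⟨hf, key hf hg.bound hB₀ hB₁ h0 h1 he, fun b => ?_⟩
    have hκ : ∀ p, |(0 : ℝ)| ≤ B * κ p := fun p => by
      rw [abs_zero]; exact (abs_nonneg _).trans (hB₀ p)
    -- The initial data do not depend on `θ`, so the differentiated problem starts from zero.
    refine ih (f := fun p => dT b (f p)) (fun p => (hf p).dirD _) ha.of_succ
      ((hfk.mul_one' (ha.ang b)).add (hg.ang b)) (fun _ => 0) (fun _ => 0) B hκ hκ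
      (fun p θ => (hf p).angular_eq_zero_of_const (h0 p) b θ) (fun p θ => ?_) (fun p x hx => ?_)
    · rw [(hf p).dirD_comm _ _ (mem_strip.2 (by simp))]
      exact ((hf p).dirD _).angular_eq_zero_of_const (h1 p) b θ
    · have e1 : dT b (dS (dS (f p))) x
          = dT b (fun y => a p y * f p y + g p y) x :=
        (((hf p).dirD _).dirD _).dirD_congr (((ha.sm p).mul (hf p)).add (hg.sm p)) (he p) _ hx
      have e2 : dS (dS (dT b (f p))) x = dT b (dS (dS (f p))) x := by
        rw [((hf p).dirD vS).dirD_comm (vT b) vS hx]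
        exact (((hf p).dirD _).dirD _).dirD_congr (((hf p).dirD _).dirD _)
          (fun y hy => (hf p).dirD_comm _ _ hy) _ hx
      rw [e2, e1, dirD_add _ ((ha.sm p).mul (hf p)) (hg.sm p) hx, dirD_mul _ (ha.sm p) (hf p) hx]
      ring

end Bd

/-! ### From `C^n` norms to uniformly bounded families -/

lemma norm_iteratedFDeriv_dirD_le {f : Strip → ℝ} (hf : ContDiff ℝ ∞ f) {v : Strip} (hv : ‖v‖ ≤ 1)
    (j : ℕ) (x : Strip) :
    ‖iteratedFDeriv ℝ j (dirD v f) x‖ ≤ ‖iteratedFDeriv ℝ (j + 1) f x‖ := by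
  have h1 := norm_iteratedFDeriv_clm_apply_const (n := j) (N := ∞) (f := fderiv ℝ f) (c := v)
    (x := x) ((hf.fderiv_right (m := ∞) (by simp)).contDiffAt) (by norm_cast; exact le_top)
  rw [norm_iteratedFDeriv_fderiv] at h1
  refine h1.trans ?_
  exact mul_le_of_le_one_left (norm_nonneg _) hv

lemma norm_vT_le (A : Fin 2) : ‖vT A‖ ≤ 1 := by
  simp only [vT, Prod.norm_def, norm_zero]
  refine max_le zero_le_one ((pi_norm_le_iff_of_nonneg zero_le_one).2 fun B => ?_)
  by_cases h : B = A
  · subst h; simp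
  · simp [h]

lemma bd_of_iteratedFDeriv {ι : Type*} {F : ℝ} {n : ℕ} {f : ι → Strip → ℝ}
    (hf : ∀ p, ContDiff ℝ ∞ (f p))
    (h : ∀ p, ∀ x ∈ disc, ∀ j ≤ n, ‖iteratedFDeriv ℝ j (f p) x‖ ≤ F) :
    Bd (fun _ => 1) n f := by
  have key : ∃ C : ℝ, ∀ p, ∀ x ∈ disc, |f p x| ≤ C * 1 :=
    ⟨F, fun p x hx => by simpa using h p x hx 0 (Nat.zero_le _)⟩
  induction n generalizing f with
  | zero => exact ⟨fun p => Sm.of_contDiff (hf p), key⟩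
  | succ n ih =>
    have h2 : ∀ a : Fin 2, ∀ p, ∀ x ∈ disc, ∀ j ≤ n, ‖iteratedFDeriv ℝ j (dT a (f p)) x‖ ≤ F :=
      fun a p x hx j hj => (norm_iteratedFDeriv_dirD_le (hf p) (norm_vT_le a) j x).trans
        (h p x hx _ (by omega))
    refine ⟨fun p => Sm.of_contDiff (hf p), key, fun a => ih (fun p => ?_) (h2 a) ?_⟩
    · exact ((hf p).fderiv_right (by simp)).clm_apply contDiff_const
    · exact ⟨F, fun p x hx => by simpa using h2 a p x hx 0 (Nat.zero_le _)⟩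


/-! ### Curvature in a chart -/

section ChartRules

variable {ι : Type} [Fintype ι] [DecidableEq ι] {f h : (ι → ℝ) → ℝ} {x : ι → ℝ}

lemma contDiff_pd (hf : ContDiff ℝ ∞ f) (i : ι) : ContDiff ℝ ∞ (pd f i) :=
  (hf.fderiv_right (by simp)).clm_apply contDiff_const

lemma pd_comm (hf : ContDiff ℝ ∞ f) (i j : ι) (x : ι → ℝ) : pd (pd f i) j x = pd (pd f j) i x := by
  have h1 : DifferentiableAt ℝ (fderiv ℝ f) x :=
    ((hf.fderiv_right (m := ∞) (by simp)).differentiable (by simp)).differentiableAt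
  have h2 : IsSymmSndFDerivAt ℝ f x := hf.contDiffAt.isSymmSndFDerivAt (by simp; norm_cast)
  have h3 : ∀ u u' : ι, pd (pd f u') u x
      = fderiv ℝ (fderiv ℝ f) x (Pi.single u 1) (Pi.single u' 1) := by
    intro u u'
    unfold pd
    rw [fderiv_clm_apply h1 (differentiableAt_const _)]
    simp
  rw [h3, h3, h2.eq]

lemma pd_const (c : ℝ) (i : ι) : pd (fun _ => c) i = fun _ => 0 := by ext; simp [pd]

lemma pd_add_at (hf : DifferentiableAt ℝ f x) (hh : DifferentiableAt ℝ h x) (i : ι) :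
    pd (fun y => f y + h y) i x = pd f i x + pd h i x := by
  simp [pd, fderiv_fun_add hf hh]

lemma pd_mul_at (hf : DifferentiableAt ℝ f x) (hh : DifferentiableAt ℝ h x) (i : ι) :
    pd (fun y => f y * h y) i x = pd f i x * h x + f x * pd h i x := by
  simp [pd, fderiv_fun_mul hf hh]; ring

lemma pd_add (hf : ContDiff ℝ ∞ f) (hh : ContDiff ℝ ∞ h) (i : ι) :
    pd (fun y => f y + h y) i = fun y => pd f i y + pd h i y :=
  funext fun _ => pd_add_at (hf.differentiable (by simp) _) (hh.differentiable (by simp) _) i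

lemma pd_mul (hf : ContDiff ℝ ∞ f) (hh : ContDiff ℝ ∞ h) (i : ι) :
    pd (fun y => f y * h y) i = fun y => pd f i y * h y + f y * pd h i y :=
  funext fun _ => pd_mul_at (hf.differentiable (by simp) _) (hh.differentiable (by simp) _) i

lemma pd_neg (i : ι) : pd (fun y => - f y) i = fun y => - pd f i y := by
  ext; simp [pd, fderiv_fun_neg]

lemma pd_sum_at {α : Type*} {s : Finset α} {F : α → (ι → ℝ) → ℝ}
    (hF : ∀ a ∈ s, DifferentiableAt ℝ (F a) x) (i : ι) :
    pd (fun y => ∑ a ∈ s, F a y) i x = ∑ a ∈ s, pd (F a) i x := by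
  simp [pd, fderiv_fun_sum hF]

lemma pd_sum {α : Type*} {s : Finset α} {F : α → (ι → ℝ) → ℝ}
    (hF : ∀ a ∈ s, ContDiff ℝ ∞ (F a)) (i : ι) :
    pd (fun y => ∑ a ∈ s, F a y) i = fun y => ∑ a ∈ s, pd (F a) i y :=
  funext fun _ => pd_sum_at (fun a ha => (hF a ha).differentiable (by simp) _) i

lemma contDiff_det {m : Type*} [Fintype m] [DecidableEq m] {V : Type*} [NormedAddCommGroup V]
    [NormedSpace ℝ V] {g : V → Matrix m m ℝ} (hg : ∀ a b, ContDiff ℝ ∞ fun y => g y a b) :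
    ContDiff ℝ ∞ fun y => (g y).det := by
  simp only [Matrix.det_apply]
  exact ContDiff.sum fun σ _ => (contDiff_prod fun i _ => hg _ _).const_smul _

lemma contDiffAt_inv_apply {m : Type*} [Fintype m] [DecidableEq m] {V : Type*}
    [NormedAddCommGroup V] [NormedSpace ℝ V] {g : V → Matrix m m ℝ}
    (hg : ∀ a b, ContDiff ℝ ∞ fun y => g y a b) {x : V} (hx : (g x).det ≠ 0) (a b : m) :
    ContDiffAt ℝ ∞ (fun y => (g y)⁻¹ a b) x := by
  simp only [Matrix.inv_def, Ring.inverse_eq_inv', Matrix.smul_apply, smul_eq_mul,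
    Matrix.adjugate_apply]
  refine ((contDiff_det hg).contDiffAt.inv hx).mul (contDiff_det fun c d => ?_).contDiffAt
  by_cases h : c = b
  · subst h; simpa using contDiff_const
  · simpa [Matrix.updateRow_ne h] using hg c d

/-- The Christoffel symbols of the first kind, `Γ_{l,ij}`. -/
noncomputable def christoffelLow (g : (ι → ℝ) → Matrix ι ι ℝ) (x : ι → ℝ) (l i j : ι) : ℝ :=
  (1 / 2) * (pd (fun y => g y j l) i x + pd (fun y => g y i l) j x - pd (fun y => g y i j) l x)

lemma christoffel_eq (g : (ι → ℝ) → Matrix ι ι ℝ) (x : ι → ℝ) (k i j : ι) :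
    christoffel g x k i j = ∑ l, (g x)⁻¹ k l * christoffelLow g x l i j := by
  simp only [christoffel, christoffelLow, Finset.mul_sum]
  exact Finset.sum_congr rfl fun l _ => by ring

/-- The curvature with the first index lowered. -/
noncomputable def curvLow (g : (ι → ℝ) → Matrix ι ι ℝ) (x : ι → ℝ) (n l i j : ι) : ℝ :=
  ∑ k, g x n k * curvUp g x k l i j

variable {g : (ι → ℝ) → Matrix ι ι ℝ}

lemma contDiff_christoffelLow (hg : ∀ a b, ContDiff ℝ ∞ fun y => g y a b) (l i j : ι) :
    ContDiff ℝ ∞ fun x => christoffelLow g x l i j :=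
  contDiff_const.mul (((contDiff_pd (hg _ _) _).add (contDiff_pd (hg _ _) _)).sub
    (contDiff_pd (hg _ _) _))

lemma sum_mul_christoffel (hx : (g x).det ≠ 0) (n i j : ι) :
    ∑ k, g x n k * christoffel g x k i j = christoffelLow g x n i j := by
  have h1 : g x * (g x)⁻¹ = 1 := Matrix.mul_nonsing_inv _ (isUnit_iff_ne_zero.2 hx)
  have h2 : (fun k => christoffel g x k i j)
      = (g x)⁻¹.mulVec fun l => christoffelLow g x l i j := by
    ext k; simp [christoffel_eq, Matrix.mulVec, dotProduct]
  have h3 : (g x).mulVec (fun k => christoffel g x k i j) n = christoffelLow g x n i j := by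
    rw [h2, Matrix.mulVec_mulVec, h1, Matrix.one_mulVec]
  simpa [Matrix.mulVec, dotProduct] using h3

lemma differentiableAt_christoffel (hg : ∀ a b, ContDiff ℝ ∞ fun y => g y a b)
    (hx : (g x).det ≠ 0) (k i j : ι) : DifferentiableAt ℝ (fun y => christoffel g y k i j) x := by
  simp only [christoffel_eq]
  refine DifferentiableAt.fun_sum fun l _ => ?_
  exact ((contDiffAt_inv_apply hg hx k l).differentiableAt (by simp)).mul
    ((contDiff_christoffelLow hg l i j).differentiable (by simp) x)

/-- The product rule applied to `Γ_{n,ij} = g_{nk} Γ^k_{ij}`, which holds near `x` because the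
determinant stays nonzero there. -/
lemma pd_christoffelLow_eq (hg : ∀ a b, ContDiff ℝ ∞ fun y => g y a b) (hx : (g x).det ≠ 0)
    (n i j c : ι) : pd (fun y => christoffelLow g y n i j) c x
      = ∑ k, (pd (fun y => g y n k) c x * christoffel g x k i j
        + g x n k * pd (fun y => christoffel g y k i j) c x) := by
  have hev : (fun y => christoffelLow g y n i j)
      =ᶠ[nhds x] fun y => ∑ k, g y n k * christoffel g y k i j := by
    have := (contDiff_det hg).continuous.continuousAt.eventually_ne hx
    filter_upwards [this] with y hy using (sum_mul_christoffel hy n i j).symm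
  have hd : ∀ k, DifferentiableAt ℝ (fun y => g y n k) x := fun k =>
    (hg n k).differentiable (by simp) x
  rw [pd, hev.fderiv_eq, ← pd, pd_sum_at fun k _ =>
    (hd k).fun_mul (differentiableAt_christoffel hg hx _ _ _)]
  exact Finset.sum_congr rfl fun k _ => pd_mul_at (hd k) (differentiableAt_christoffel hg hx _ _ _) c

lemma pd_christoffelLow (hg : ∀ a b, ContDiff ℝ ∞ fun y => g y a b) (l i j c : ι) :
    pd (fun y => christoffelLow g y l i j) c x = (1 / 2) * (pd (pd (fun y => g y j l) i) c x
      + pd (pd (fun y => g y i l) j) c x - pd (pd (fun y => g y i j) l) c x) := by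
  have h : ∀ a b d, ContDiff ℝ ∞ (pd (fun y => g y a b) d) := fun a b d => contDiff_pd (hg a b) d
  have e : (fun y => christoffelLow g y l i j) = fun y => (1 / 2) * (pd (fun y => g y j l) i y
      + (pd (fun y => g y i l) j y + - pd (fun y => g y i j) l y)) := by
    ext y; unfold christoffelLow; ring
  rw [e, pd_mul contDiff_const ((h _ _ _).add ((h _ _ _).add (h _ _ _).neg)), pd_const,
    pd_add (h _ _ _) ((h _ _ _).add (h _ _ _).neg), pd_add (h _ _ _) (h _ _ _).neg, pd_neg]
  ring

/-- Lowering the index removes derivatives of the inverse metric and leaves second derivatives of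
`g` plus products of symbols of the first kind. Symmetry is required only of first derivatives at
the point: the components extended beyond the region need not be symmetric there. -/
lemma curvLow_eq (hg : ∀ a b, ContDiff ℝ ∞ fun y => g y a b) (hx : (g x).det ≠ 0)
    (hs : ∀ a b c, pd (fun y => g y a b) c x = pd (fun y => g y b a) c x) (n l i j : ι) :
    curvLow g x n l i j = (1 / 2) * (pd (pd (fun y => g y j n) l) i x
        - pd (pd (fun y => g y j l) n) i x - pd (pd (fun y => g y i n) l) j x
        + pd (pd (fun y => g y i l) n) j x)
      - ∑ p, ∑ r, (g x)⁻¹ p r * (christoffelLow g x p i n * christoffelLow g x r j l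
        - christoffelLow g x p j n * christoffelLow g x r i l) := by
  -- Metric compatibility of the connection.
  have hsym : ∀ m c, pd (fun y => g y n m) c x
      = christoffelLow g x n c m + christoffelLow g x m c n := by
    intro m c
    unfold christoffelLow
    rw [hs m n c, hs c n m, hs c m n, hs n c m, hs m c n]; ring
  have e1 := pd_christoffelLow_eq hg hx n j l i
  have e2 := pd_christoffelLow_eq hg hx n i l j
  rw [pd_christoffelLow hg] at e1 e2
  simp only [hsym, Finset.sum_add_distrib, add_mul] at e1 e2
  have e3 : curvLow g x n l i j
      = ∑ k, g x n k * pd (fun y => christoffel g y k j l) i x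
        - ∑ k, g x n k * pd (fun y => christoffel g y k i l) j x
        + (∑ m, christoffelLow g x n i m * christoffel g x m j l
          - ∑ m, christoffelLow g x n j m * christoffel g x m i l) := by
    simp only [curvLow, curvUp, mul_add, mul_sub, Finset.sum_add_distrib, Finset.sum_sub_distrib,
      Finset.mul_sum]
    congr 1
    rw [Finset.sum_comm, Finset.sum_comm (f := fun k m => g x n k * (christoffel g x k j m * _))]
    congr 1 <;>
    · refine Finset.sum_congr rfl fun m _ => ?_
      rw [← sum_mul_christoffel hx, Finset.sum_mul]
      exact Finset.sum_congr rfl fun k _ => by ring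
  have e4 : ∀ a b c d : ι, ∑ m, christoffelLow g x m a b * christoffel g x m c d
      = ∑ p, ∑ r, (g x)⁻¹ p r * (christoffelLow g x p a b * christoffelLow g x r c d) := by
    intro a b c d
    simp only [christoffel_eq, Finset.mul_sum]
    exact Finset.sum_congr rfl fun p _ => Finset.sum_congr rfl fun r _ => by ring
  simp only [mul_sub, Finset.sum_sub_distrib]
  rw [← e4, ← e4, e3]
  -- The terms `∂_i ∂_j g_{ln}` from the two differentiated symbols cancel.
  have e5 := pd_comm (hg l n) i j x
  linear_combination e2 - e1 - (1 / 2) * e5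

lemma curvLow_swap_left (hg : ∀ a b, ContDiff ℝ ∞ fun y => g y a b) (hx : (g x).det ≠ 0)
    (hs : ∀ a b c, pd (fun y => g y a b) c x = pd (fun y => g y b a) c x)
    (hi : ∀ a b, (g x)⁻¹ a b = (g x)⁻¹ b a) (n l i j : ι) :
    curvLow g x n l i j = - curvLow g x l n i j := by
  rw [curvLow_eq hg hx hs, curvLow_eq hg hx hs]
  have : ∑ p, ∑ r, (g x)⁻¹ p r * (christoffelLow g x p i n * christoffelLow g x r j l
        - christoffelLow g x p j n * christoffelLow g x r i l)
      = ∑ p, ∑ r, (g x)⁻¹ p r * (christoffelLow g x r i n * christoffelLow g x p j l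
        - christoffelLow g x r j n * christoffelLow g x p i l) := by
    rw [Finset.sum_comm]
    exact Finset.sum_congr rfl fun p _ => Finset.sum_congr rfl fun r _ => by rw [hi]
  rw [this]
  have h2 : ∀ a b c d : ℝ, (1 / 2) * (a - b - c + d) = - ((1 / 2) * (b - a - d + c)) := by
    intros; ring
  rw [h2, neg_sub, sub_eq_add_neg, add_comm, sub_eq_add_neg, ← Finset.sum_neg_distrib]
  congr 1
  refine Finset.sum_congr rfl fun p _ => ?_
  rw [← Finset.sum_neg_distrib]
  exact Finset.sum_congr rfl fun r _ => by ring

lemma curvLow_swap_right (g : (ι → ℝ) → Matrix ι ι ℝ) (x : ι → ℝ) (n l i j : ι) :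
    curvLow g x n l i j = - curvLow g x n l j i := by
  simp only [curvLow, curvUp, ← Finset.sum_neg_distrib]
  refine Finset.sum_congr rfl fun k _ => ?_
  rw [← mul_neg, neg_add, ← Finset.sum_neg_distrib]
  congr 2
  · ring
  · exact Finset.sum_congr rfl fun k _ => by ring

lemma riem_single (g : (ι → ℝ) → Matrix ι ι ℝ) (x : ι → ℝ) (n l i j : ι) :
    riem g x (Pi.single n 1) (Pi.single l 1) (Pi.single i 1) (Pi.single j 1)
      = curvLow g x n l i j := by
  simp [riem, curvLow, Pi.single_apply]

lemma ricci_eq (hx : (g x).det ≠ 0) (l j : ι) :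
    ricci g x l j = ∑ k, ∑ n, (g x)⁻¹ k n * curvLow g x n l k j := by
  have h1 : (g x)⁻¹ * g x = 1 := Matrix.nonsing_inv_mul _ (isUnit_iff_ne_zero.2 hx)
  refine Finset.sum_congr rfl fun k _ => ?_
  have h2 : (g x).mulVec (fun m => curvUp g x m l k j) = fun n => curvLow g x n l k j := by
    ext n; simp [curvLow, Matrix.mulVec, dotProduct]
  have h3 : (g x)⁻¹.mulVec (fun n => curvLow g x n l k j) k = curvUp g x k l k j := by
    rw [← h2, Matrix.mulVec_mulVec, h1, Matrix.one_mulVec]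
  rw [← h3]; simp [Matrix.mulVec, dotProduct]

end ChartRules


/-! ### Components of the double null metric -/

lemma pd_pd_mul {ι : Type} [Fintype ι] [DecidableEq ι] {f h : (ι → ℝ) → ℝ} (hf : ContDiff ℝ ∞ f)
    (hh : ContDiff ℝ ∞ h) (c d : ι) (x : ι → ℝ) :
    pd (pd (fun y => f y * h y) c) d x = pd (pd f c) d x * h x + pd f c x * pd h d x
      + pd f d x * pd h c x + f x * pd (pd h c) d x := by
  rw [pd_mul hf hh, pd_add ((contDiff_pd hf c).mul hh) (hf.mul (contDiff_pd hh c)),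
    pd_mul (contDiff_pd hf c) hh, pd_mul hf (contDiff_pd hh c)]
  ring

namespace DoubleNull

variable (M : DoubleNull)

lemma sum_four (f : Fin 4 → ℝ) : ∑ μ, f μ = f 0 + f 1 + ∑ A : Fin 2, f (sph A) := by
  simp [Fin.sum_univ_four, Fin.sum_univ_two, sph]; ring

lemma forall_four {P : Fin 4 → Prop} (h0 : P 0) (h1 : P 1) (h : ∀ A, P (sph A)) (μ : Fin 4) :
    P μ := by
  fin_cases μ
  exacts [h0, h1, h 0, h 1]

lemma sph_ne_zero (A : Fin 2) : sph A ≠ 0 := by fin_cases A <;> simp [sph]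

lemma sph_ne_one (A : Fin 2) : sph A ≠ 1 := by fin_cases A <;> simp [sph]

section MetricComponents

variable (x : Fin 4 → ℝ) (A B : Fin 2)

lemma metric_zero_zero : M.metric x 0 0 = ∑ A, ∑ B, M.gs x A B * M.b x A * M.b x B := by
  simp [metric, coframe, sph, Fin.sum_univ_two]

lemma metric_zero_one : M.metric x 0 1 = -2 * (M.Ω x * M.Ω x) := by
  simp [metric, coframe, sph, Fin.sum_univ_two]; ring

lemma metric_one_zero : M.metric x 1 0 = -2 * (M.Ω x * M.Ω x) := by
  simp [metric, coframe, sph, Fin.sum_univ_two]; ring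

lemma metric_one_one : M.metric x 1 1 = 0 := by
  simp [metric, coframe, sph, Fin.sum_univ_two]

lemma metric_zero_sph : M.metric x 0 (sph A) = -∑ B, M.gs x B A * M.b x B := by
  fin_cases A <;> simp [metric, coframe, sph, Fin.sum_univ_two] <;> ring

lemma metric_sph_zero : M.metric x (sph A) 0 = -∑ B, M.gs x A B * M.b x B := by
  fin_cases A <;> simp [metric, coframe, sph, Fin.sum_univ_two] <;> ring

lemma metric_one_sph : M.metric x 1 (sph A) = 0 := by
  fin_cases A <;> simp [metric, coframe, sph, Fin.sum_univ_two]

lemma metric_sph_one : M.metric x (sph A) 1 = 0 := by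
  fin_cases A <;> simp [metric, coframe, sph, Fin.sum_univ_two]

lemma metric_sph_sph : M.metric x (sph A) (sph B) = M.gs x A B := by
  fin_cases A <;> fin_cases B <;> simp [metric, coframe, sph, Fin.sum_univ_two]

end MetricComponents

/-- The `1`-form `z_A = gs_{AB} ∂_u b^B`, a multiple of the torsion where `Ω = 1`. -/
noncomputable def twist (A : Fin 2) (x : Fin 4 → ℝ) : ℝ :=
  ∑ B, M.gs x A B * pd (fun y => M.b y B) 1 x

/-- The Christoffel symbols of the first kind of the spheres. -/
noncomputable def sphereLow (x : Fin 4 → ℝ) (C A B : Fin 2) : ℝ :=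
  (1 / 2) * (pd (fun y => M.gs y B C) (sph A) x + pd (fun y => M.gs y A C) (sph B) x
    - pd (fun y => M.gs y A B) (sph C) x)

/-- The curvature of the spheres, with all indices lowered. -/
noncomputable def sphereCurv (x : Fin 4 → ℝ) (C A D B : Fin 2) : ℝ :=
  (1 / 2) * (pd (pd (fun y => M.gs y B C) (sph A)) (sph D) x
      - pd (pd (fun y => M.gs y B A) (sph C)) (sph D) x
      - pd (pd (fun y => M.gs y D C) (sph A)) (sph B) x
      + pd (pd (fun y => M.gs y D A) (sph C)) (sph B) x)
    - ∑ E, ∑ F, (M.gs x)⁻¹ E F * (M.sphereLow x E D C * M.sphereLow x F B A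
      - M.sphereLow x E B C * M.sphereLow x F D A)

/-- The components of the metric are smooth. -/
structure IsSmooth : Prop where
  Ω : ContDiff ℝ ∞ M.Ω
  b : ∀ A, ContDiff ℝ ∞ fun x => M.b x A
  gs : ∀ A B, ContDiff ℝ ∞ fun x => M.gs x A B

/-- The normalization of the gauge at a point of the initial cone. -/
structure AdaptedAt (q : Fin 4 → ℝ) : Prop extends M.IsSmooth where
  Ω_eq : M.Ω q = 1
  b_eq : ∀ A, M.b q A = 0
  gs_symm : ∀ A B, M.gs q A B = M.gs q B A
  gs_det : (M.gs q).det ≠ 0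
  pd_gs_symm : ∀ A B c, pd (fun y => M.gs y A B) c q = pd (fun y => M.gs y B A) c q
  pd_Ω : ∀ c, c ≠ 1 → pd M.Ω c q = 0
  pd_b : ∀ A c, c ≠ 1 → pd (fun y => M.b y A) c q = 0
  pd_pd_Ω : ∀ c d, c ≠ 1 → d ≠ 1 → pd (pd M.Ω c) d q = 0
  pd_pd_b : ∀ A c d, c ≠ 1 → d ≠ 1 → pd (pd (fun y => M.b y A) c) d q = 0

variable {M}

lemma IsSmooth.twist (h : M.IsSmooth) (A : Fin 2) : ContDiff ℝ ∞ (M.twist A) :=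
  ContDiff.sum fun B _ => (h.gs A B).mul (contDiff_pd (h.b B) 1)

lemma IsSmooth.metric (h : M.IsSmooth) : ∀ μ ν, ContDiff ℝ ∞ fun x => M.metric x μ ν := by
  refine forall_four (forall_four ?_ ?_ ?_) (forall_four ?_ ?_ ?_)
    (fun A => forall_four ?_ ?_ ?_)
  · simp only [metric_zero_zero]
    exact ContDiff.sum fun A _ => ContDiff.sum fun B _ => ((h.gs A B).mul (h.b A)).mul (h.b B)
  · simp only [metric_zero_one]; exact contDiff_const.mul (h.Ω.mul h.Ω)
  · intro A; simp only [metric_zero_sph]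
    exact (ContDiff.sum fun B _ => (h.gs B A).mul (h.b B)).neg
  · simp only [metric_one_zero]; exact contDiff_const.mul (h.Ω.mul h.Ω)
  · simp only [metric_one_one]; exact contDiff_const
  · intro A; simp only [metric_one_sph]; exact contDiff_const
  · simp only [metric_sph_zero]
    exact (ContDiff.sum fun B _ => (h.gs A B).mul (h.b B)).neg
  · simp only [metric_sph_one]; exact contDiff_const
  · intro B; simp only [metric_sph_sph]; exact h.gs A B

lemma pd_metric_one_one (c : Fin 4) : pd (fun y => M.metric y 1 1) c = fun _ => 0 := by
  simp only [metric_one_one]; exact pd_const 0 c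

lemma pd_metric_one_sph (A : Fin 2) (c : Fin 4) : pd (fun y => M.metric y 1 (sph A)) c = fun _ => 0 := by
  simp only [metric_one_sph]; exact pd_const 0 c

lemma pd_metric_sph_one (A : Fin 2) (c : Fin 4) : pd (fun y => M.metric y (sph A) 1) c = fun _ => 0 := by
  simp only [metric_sph_one]; exact pd_const 0 c

variable (M) in
/-- The inverse of the metric at a point where `Ω = 1` and `b = 0`. -/
noncomputable def inverseMetric (q : Fin 4 → ℝ) : Matrix (Fin 4) (Fin 4) ℝ := fun μ ν =>
  -(1 / 2) * ((Pi.single 0 1 : Fin 4 → ℝ) μ * (Pi.single 1 1 : Fin 4 → ℝ) ν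
      + (Pi.single 1 1 : Fin 4 → ℝ) μ * (Pi.single 0 1 : Fin 4 → ℝ) ν)
    + ∑ A, ∑ B, (M.gs q)⁻¹ A B * (Pi.single (sph A) 1 : Fin 4 → ℝ) μ
      * (Pi.single (sph B) 1 : Fin 4 → ℝ) ν

section InverseComponents

variable (q : Fin 4 → ℝ) (A B : Fin 2)

lemma inverseMetric_zero_zero : M.inverseMetric q 0 0 = 0 := by simp [inverseMetric, sph]

lemma inverseMetric_zero_one : M.inverseMetric q 0 1 = -(1 / 2) := by simp [inverseMetric, sph]

lemma inverseMetric_one_zero : M.inverseMetric q 1 0 = -(1 / 2) := by simp [inverseMetric, sph]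

lemma inverseMetric_one_one : M.inverseMetric q 1 1 = 0 := by simp [inverseMetric, sph]

lemma inverseMetric_zero_sph : M.inverseMetric q 0 (sph A) = 0 := by
  fin_cases A <;> simp [inverseMetric, sph]

lemma inverseMetric_sph_zero : M.inverseMetric q (sph A) 0 = 0 := by
  fin_cases A <;> simp [inverseMetric, sph]

lemma inverseMetric_one_sph : M.inverseMetric q 1 (sph A) = 0 := by
  fin_cases A <;> simp [inverseMetric, sph]

lemma inverseMetric_sph_one : M.inverseMetric q (sph A) 1 = 0 := by
  fin_cases A <;> simp [inverseMetric, sph]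

lemma inverseMetric_sph_sph : M.inverseMetric q (sph A) (sph B) = (M.gs q)⁻¹ A B := by
  fin_cases A <;> fin_cases B <;> simp [inverseMetric, sph, Fin.sum_univ_two]

end InverseComponents

/-! ### Derivatives of the metric at a point of the initial cone -/

namespace AdaptedAt

variable {q : Fin 4 → ℝ} (h : M.AdaptedAt q)

include h

/-- `g_{00}` is quadratic in `b`, so even its transversal first derivative vanishes where `b = 0`.
-/
lemma pd_zero_zero (c : Fin 4) : pd (fun y => M.metric y 0 0) c q = 0 := by
  simp only [metric_zero_zero]
  have h1 : ∀ A B, ContDiff ℝ ∞ fun y => M.gs y A B * M.b y A := fun A B => (h.gs A B).mul (h.b A)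
  rw [pd_sum fun A _ => ContDiff.sum fun B _ => (h1 A B).mul (h.b B)]
  refine Finset.sum_eq_zero fun A _ => ?_
  rw [pd_sum fun B _ => (h1 A B).mul (h.b B)]
  refine Finset.sum_eq_zero fun B _ => ?_
  rw [pd_mul (h1 A B) (h.b B)]
  simp [h.b_eq]

/-- Each of the two factors `b` must absorb a derivative, and only `∂_u b` is nonzero; hence only
`∂_u ∂_u` could survive. -/
lemma pd_pd_zero_zero (c d : Fin 4) (hcd : c ≠ 1 ∨ d ≠ 1) :
    pd (pd (fun y => M.metric y 0 0) c) d q = 0 := by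
  simp only [metric_zero_zero]
  have h1 : ∀ A B, ContDiff ℝ ∞ fun y => M.gs y A B * M.b y A := fun A B => (h.gs A B).mul (h.b A)
  rw [pd_sum fun A _ => ContDiff.sum fun B _ => (h1 A B).mul (h.b B),
    pd_sum fun A _ => contDiff_pd (ContDiff.sum fun B _ => (h1 A B).mul (h.b B)) c]
  refine Finset.sum_eq_zero fun A _ => ?_
  rw [pd_sum fun B _ => (h1 A B).mul (h.b B),
    pd_sum fun B _ => contDiff_pd ((h1 A B).mul (h.b B)) c]
  refine Finset.sum_eq_zero fun B _ => ?_
  rw [pd_pd_mul (h1 A B) (h.b B), pd_mul (h.gs A B) (h.b A), pd_mul (h.gs A B) (h.b A)]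
  rcases hcd with hc | hc <;> simp [h.b_eq, h.pd_b _ _ hc]

lemma pd_zero_one (c : Fin 4) (hc : c ≠ 1) : pd (fun y => M.metric y 0 1) c q = 0 := by
  simp only [metric_zero_one]
  rw [pd_mul contDiff_const (h.Ω.mul h.Ω), pd_mul h.Ω h.Ω, pd_const]
  simp [h.pd_Ω c hc]

lemma pd_one_zero (c : Fin 4) (hc : c ≠ 1) : pd (fun y => M.metric y 1 0) c q = 0 := by
  simpa only [metric_zero_one, metric_one_zero] using h.pd_zero_one c hc

lemma pd_pd_one_zero (c d : Fin 4) (hc : c ≠ 1) (hd : d ≠ 1) :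
    pd (pd (fun y => M.metric y 1 0) c) d q = 0 := by
  simp only [metric_one_zero]
  rw [pd_pd_mul contDiff_const (h.Ω.mul h.Ω), pd_pd_mul h.Ω h.Ω, pd_const, pd_const]
  simp [h.pd_Ω c hc, h.pd_Ω d hd, h.pd_pd_Ω c d hc hd, pd_const]

lemma pd_sph_zero (A : Fin 2) (c : Fin 4) : pd (fun y => M.metric y (sph A) 0) c
    = fun y => -∑ B, (pd (fun y => M.gs y A B) c y * M.b y B
      + M.gs y A B * pd (fun y => M.b y B) c y) := by
  simp only [metric_sph_zero]
  rw [pd_neg, pd_sum fun B _ => (h.gs A B).mul (h.b B)]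
  ext y
  simp only [pd_mul (h.gs _ _) (h.b _)]

lemma pd_zero_sph (A : Fin 2) (c : Fin 4) : pd (fun y => M.metric y 0 (sph A)) c
    = fun y => -∑ B, (pd (fun y => M.gs y B A) c y * M.b y B
      + M.gs y B A * pd (fun y => M.b y B) c y) := by
  simp only [metric_zero_sph]
  rw [pd_neg, pd_sum fun B _ => (h.gs B A).mul (h.b B)]
  ext y
  simp only [pd_mul (h.gs _ _) (h.b _)]

lemma pd_sph_zero_of_ne (A : Fin 2) (c : Fin 4) (hc : c ≠ 1) :
    pd (fun y => M.metric y (sph A) 0) c q = 0 := by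
  rw [h.pd_sph_zero]; simp [h.b_eq, h.pd_b _ c hc]

lemma pd_zero_sph_of_ne (A : Fin 2) (c : Fin 4) (hc : c ≠ 1) :
    pd (fun y => M.metric y 0 (sph A)) c q = 0 := by
  rw [h.pd_zero_sph]; simp [h.b_eq, h.pd_b _ c hc]

lemma pd_sph_zero_one (A : Fin 2) : pd (fun y => M.metric y (sph A) 0) 1 q = - M.twist A q := by
  rw [h.pd_sph_zero]; simp [h.b_eq, twist]

lemma pd_zero_sph_one (A : Fin 2) : pd (fun y => M.metric y 0 (sph A)) 1 q = - M.twist A q := by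
  rw [h.pd_zero_sph]; simp [h.b_eq, twist, h.gs_symm A]

lemma pd_pd_sph_zero_of_ne (A : Fin 2) (c d : Fin 4) (hc : c ≠ 1) (hd : d ≠ 1) :
    pd (pd (fun y => M.metric y (sph A) 0) c) d q = 0 := by
  simp only [metric_sph_zero, pd_neg]
  rw [pd_sum fun B _ => (h.gs A B).mul (h.b B),
    pd_sum fun B _ => contDiff_pd ((h.gs A B).mul (h.b B)) c, neg_eq_zero]
  refine Finset.sum_eq_zero fun B _ => ?_
  rw [pd_pd_mul (h.gs _ _) (h.b _)]
  simp [h.b_eq, h.pd_b _ c hc, h.pd_b _ d hd, h.pd_pd_b _ c d hc hd]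

lemma pd_pd_zero_sph_of_ne (A : Fin 2) (c d : Fin 4) (hc : c ≠ 1) (hd : d ≠ 1) :
    pd (pd (fun y => M.metric y 0 (sph A)) c) d q = 0 := by
  simp only [metric_zero_sph, pd_neg]
  rw [pd_sum fun B _ => (h.gs B A).mul (h.b B),
    pd_sum fun B _ => contDiff_pd ((h.gs B A).mul (h.b B)) c, neg_eq_zero]
  refine Finset.sum_eq_zero fun B _ => ?_
  rw [pd_pd_mul (h.gs _ _) (h.b _)]
  simp [h.b_eq, h.pd_b _ c hc, h.pd_b _ d hd, h.pd_pd_b _ c d hc hd]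

lemma pd_twist (A : Fin 2) (c : Fin 4) : pd (M.twist A) c q
    = ∑ B, (pd (fun y => M.gs y A B) c q * pd (fun y => M.b y B) 1 q
      + M.gs q A B * pd (pd (fun y => M.b y B) 1) c q) := by
  unfold twist
  rw [pd_sum fun B _ => (h.gs A B).mul (contDiff_pd (h.b B) 1)]
  simp only [pd_mul (h.gs _ _) (contDiff_pd (h.b _) 1)]

lemma pd_pd_sph_zero_one (A : Fin 2) (c : Fin 4) (hc : c ≠ 1) :
    pd (pd (fun y => M.metric y (sph A) 0) 1) c q = - pd (M.twist A) c q := by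
  rw [h.pd_twist]
  simp only [metric_sph_zero, pd_neg]
  rw [pd_sum fun B _ => (h.gs A B).mul (h.b B),
    pd_sum fun B _ => contDiff_pd ((h.gs A B).mul (h.b B)) 1]
  congr 1
  refine Finset.sum_congr rfl fun B _ => ?_
  rw [pd_pd_mul (h.gs _ _) (h.b _)]
  simp [h.b_eq, h.pd_b _ c hc]

lemma pd_pd_zero_sph_one (A : Fin 2) (c : Fin 4) (hc : c ≠ 1) :
    pd (pd (fun y => M.metric y 0 (sph A)) 1) c q = - pd (M.twist A) c q := by
  rw [h.pd_twist]
  simp only [metric_zero_sph, pd_neg]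
  rw [pd_sum fun B _ => (h.gs B A).mul (h.b B),
    pd_sum fun B _ => contDiff_pd ((h.gs B A).mul (h.b B)) 1]
  congr 1
  refine Finset.sum_congr rfl fun B _ => ?_
  rw [pd_pd_mul (h.gs _ _) (h.b _)]
  simp [h.b_eq, h.pd_b _ c hc, h.gs_symm A, h.pd_gs_symm A]

lemma pd_pd_sph_zero_one' (A : Fin 2) (c : Fin 4) (hc : c ≠ 1) :
    pd (pd (fun y => M.metric y (sph A) 0) c) 1 q = - pd (M.twist A) c q := by
  rw [pd_comm (h.metric _ _), h.pd_pd_sph_zero_one A c hc]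

lemma pd_pd_zero_sph_one' (A : Fin 2) (c : Fin 4) (hc : c ≠ 1) :
    pd (pd (fun y => M.metric y 0 (sph A)) c) 1 q = - pd (M.twist A) c q := by
  rw [pd_comm (h.metric _ _), h.pd_pd_zero_sph_one A c hc]

lemma metric_mul_inverseMetric : M.metric q * M.inverseMetric q = 1 := by
  have h1 : M.gs q * (M.gs q)⁻¹ = 1 := Matrix.mul_nonsing_inv _ (isUnit_iff_ne_zero.2 h.gs_det)
  have h2 := fun A B => congrFun (congrFun h1 A) B
  simp only [Matrix.mul_apply] at h2
  ext μ ν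
  rw [Matrix.mul_apply, sum_four]
  revert μ ν
  refine forall_four (forall_four ?_ ?_ ?_) (forall_four ?_ ?_ ?_)
    (fun A => forall_four ?_ ?_ fun B => ?_) <;> intros <;>
  simp [metric_zero_zero, metric_zero_one, metric_one_zero, metric_one_one, metric_zero_sph,
    metric_sph_zero, metric_one_sph, metric_sph_one, metric_sph_sph, h.b_eq, h.Ω_eq,
    inverseMetric_zero_zero, inverseMetric_zero_one, inverseMetric_one_zero, inverseMetric_one_one,
    inverseMetric_zero_sph, inverseMetric_sph_zero, inverseMetric_one_sph, inverseMetric_sph_one,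
    inverseMetric_sph_sph, h2, sph_ne_zero, sph_ne_one, (sph_ne_zero _).symm, (sph_ne_one _).symm]
  fin_cases A <;> fin_cases B <;> simp [sph, Matrix.one_apply]

lemma inv_metric : (M.metric q)⁻¹ = M.inverseMetric q :=
  Matrix.inv_eq_right_inv h.metric_mul_inverseMetric

lemma det_metric : (M.metric q).det ≠ 0 := by
  intro h0
  have := congrArg Matrix.det h.metric_mul_inverseMetric
  simp [h0] at this

lemma inv_gs_symm (A B : Fin 2) : (M.gs q)⁻¹ A B = (M.gs q)⁻¹ B A := by
  have h1 : (M.gs q).transpose = M.gs q := by ext A B; exact h.gs_symm B A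
  have h2 := Matrix.transpose_nonsing_inv (M.gs q)
  rw [h1] at h2
  exact congrFun (congrFun h2 B) A

lemma inv_metric_symm (μ ν : Fin 4) : (M.metric q)⁻¹ μ ν = (M.metric q)⁻¹ ν μ := by
  rw [h.inv_metric]
  revert μ ν
  refine forall_four (forall_four ?_ ?_ ?_) (forall_four ?_ ?_ ?_)
    (fun A => forall_four ?_ ?_ fun B => ?_) <;> intros <;>
  simp [inverseMetric_zero_one, inverseMetric_one_zero,
    inverseMetric_zero_sph, inverseMetric_sph_zero, inverseMetric_one_sph, inverseMetric_sph_one,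
    inverseMetric_sph_sph]
  exact h.inv_gs_symm A B

lemma pd_metric_symm (μ ν c : Fin 4) :
    pd (fun y => M.metric y μ ν) c q = pd (fun y => M.metric y ν μ) c q := by
  revert μ ν
  refine forall_four (forall_four rfl ?_ fun A => ?_) (forall_four ?_ rfl fun A => ?_)
    (fun A => forall_four ?_ ?_ fun B => ?_)
  · simp only [metric_zero_one, metric_one_zero]
  · rw [h.pd_zero_sph, h.pd_sph_zero]; simp [h.b_eq, h.gs_symm A]
  · simp only [metric_zero_one, metric_one_zero]
  · rw [pd_metric_one_sph, pd_metric_sph_one]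
  · rw [h.pd_zero_sph, h.pd_sph_zero]; simp [h.b_eq, h.gs_symm A]
  · rw [pd_metric_one_sph, pd_metric_sph_one]
  · simp only [metric_sph_sph]; exact h.pd_gs_symm A B c

/-! ### Connection coefficients on the initial cone -/

section Connection

variable (A B C : Fin 2)

/-- The lower pair `(1,1)` is left out of these formulas: `∂_u Ω` enters only through `Γ_{0,11}`,
and no curvature component computed below needs it. -/
lemma low_zero_zero_zero : christoffelLow M.metric q 0 0 0 = 0 := by
  simp [christoffelLow, h.pd_zero_zero]

lemma low_zero_zero_one : christoffelLow M.metric q 0 0 1 = 0 := by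
  simp [christoffelLow, h.pd_zero_zero, h.pd_zero_one, h.pd_one_zero]

lemma low_zero_one_zero : christoffelLow M.metric q 0 1 0 = 0 := by
  simp [christoffelLow, h.pd_zero_zero, h.pd_zero_one, h.pd_one_zero]

lemma low_zero_zero_sph : christoffelLow M.metric q 0 0 (sph A) = 0 := by
  simp [christoffelLow, h.pd_zero_zero, h.pd_zero_sph_of_ne, h.pd_sph_zero_of_ne]

lemma low_zero_sph_zero : christoffelLow M.metric q 0 (sph A) 0 = 0 := by
  simp [christoffelLow, h.pd_zero_zero, h.pd_zero_sph_of_ne, h.pd_sph_zero_of_ne]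

lemma low_zero_one_sph : christoffelLow M.metric q 0 1 (sph A) = -(1 / 2) * M.twist A q := by
  simp [christoffelLow, h.pd_sph_zero_one, h.pd_one_zero _ (sph_ne_one A), pd_metric_one_sph]

lemma low_zero_sph_one : christoffelLow M.metric q 0 (sph A) 1 = -(1 / 2) * M.twist A q := by
  simp [christoffelLow, h.pd_sph_zero_one, h.pd_one_zero _ (sph_ne_one A), pd_metric_sph_one]

lemma low_zero_sph_sph : christoffelLow M.metric q 0 (sph A) (sph B)
    = -(1 / 2) * pd (fun y => M.gs y A B) 0 q := by
  simp [christoffelLow, h.pd_sph_zero_of_ne _ _ (sph_ne_one _), metric_sph_sph]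

lemma low_one_zero_zero : christoffelLow M.metric q 1 0 0 = 0 := by
  simp [christoffelLow, h.pd_zero_one, h.pd_zero_zero]

lemma low_one_zero_one : christoffelLow M.metric q 1 0 1 = 0 := by
  simp [christoffelLow, pd_metric_one_one]

lemma low_one_one_zero : christoffelLow M.metric q 1 1 0 = 0 := by
  simp [christoffelLow, pd_metric_one_one, metric_zero_one, metric_one_zero]

lemma low_one_zero_sph : christoffelLow M.metric q 1 0 (sph A) = (1 / 2) * M.twist A q := by
  simp [christoffelLow, h.pd_zero_sph_one, h.pd_zero_one _ (sph_ne_one A), pd_metric_sph_one]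

lemma low_one_sph_zero : christoffelLow M.metric q 1 (sph A) 0 = (1 / 2) * M.twist A q := by
  simp [christoffelLow, h.pd_sph_zero_one, h.pd_zero_one _ (sph_ne_one A), pd_metric_sph_one]

lemma low_one_one_sph : christoffelLow M.metric q 1 1 (sph A) = 0 := by
  simp [christoffelLow, pd_metric_one_one, pd_metric_sph_one, pd_metric_one_sph]

lemma low_one_sph_one : christoffelLow M.metric q 1 (sph A) 1 = 0 := by
  simp [christoffelLow, pd_metric_one_one, pd_metric_sph_one, pd_metric_one_sph]

lemma low_one_sph_sph : christoffelLow M.metric q 1 (sph A) (sph B)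
    = -(1 / 2) * pd (fun y => M.gs y A B) 1 q := by
  simp [christoffelLow, pd_metric_sph_one, metric_sph_sph]

lemma low_sph_zero_zero : christoffelLow M.metric q (sph A) 0 0 = 0 := by
  simp [christoffelLow, h.pd_zero_sph_of_ne, h.pd_zero_zero]

lemma low_sph_zero_one : christoffelLow M.metric q (sph A) 0 1 = -(1 / 2) * M.twist A q := by
  simp [christoffelLow, h.pd_zero_sph_one, h.pd_zero_one _ (sph_ne_one A), pd_metric_one_sph]

lemma low_sph_one_zero : christoffelLow M.metric q (sph A) 1 0 = -(1 / 2) * M.twist A q := by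
  simp [christoffelLow, h.pd_zero_sph_one, h.pd_one_zero _ (sph_ne_one A), pd_metric_one_sph]

lemma low_sph_zero_sph : christoffelLow M.metric q (sph A) 0 (sph B)
    = (1 / 2) * pd (fun y => M.gs y A B) 0 q := by
  simp [christoffelLow, h.pd_zero_sph_of_ne _ _ (sph_ne_one _), metric_sph_sph, h.pd_gs_symm A B]

lemma low_sph_sph_zero : christoffelLow M.metric q (sph A) (sph B) 0
    = (1 / 2) * pd (fun y => M.gs y A B) 0 q := by
  simp [christoffelLow, h.pd_zero_sph_of_ne _ _ (sph_ne_one _),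
    h.pd_sph_zero_of_ne _ _ (sph_ne_one _), metric_sph_sph, h.pd_gs_symm A B]

lemma low_sph_one_sph : christoffelLow M.metric q (sph A) 1 (sph B)
    = (1 / 2) * pd (fun y => M.gs y A B) 1 q := by
  simp [christoffelLow, pd_metric_one_sph, metric_sph_sph, h.pd_gs_symm A B]

lemma low_sph_sph_one : christoffelLow M.metric q (sph A) (sph B) 1
    = (1 / 2) * pd (fun y => M.gs y A B) 1 q := by
  simp [christoffelLow, pd_metric_one_sph, pd_metric_sph_one, metric_sph_sph, h.pd_gs_symm A B]

omit h in
lemma low_sph_sph_sph : christoffelLow M.metric q (sph C) (sph A) (sph B) = M.sphereLow q C A B := by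
  simp only [christoffelLow, metric_sph_sph, sphereLow]

end Connection

/-- The inverse metric pairs the two null directions with each other, with coefficient `-1/2`, and
the angular directions among themselves. -/
lemma contract (X Y Z W : Fin 4 → ℝ) :
    ∑ p, ∑ r, (M.metric q)⁻¹ p r * (X p * Y r - Z p * W r)
      = -(1 / 2) * (X 0 * Y 1 + X 1 * Y 0 - Z 0 * W 1 - Z 1 * W 0)
        + ∑ A, ∑ B, (M.gs q)⁻¹ A B * (X (sph A) * Y (sph B) - Z (sph A) * W (sph B)) := by
  rw [h.inv_metric]
  simp only [sum_four, inverseMetric_zero_zero, inverseMetric_zero_one, inverseMetric_one_zero,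
    inverseMetric_one_one, inverseMetric_zero_sph, inverseMetric_sph_zero, inverseMetric_one_sph,
    inverseMetric_sph_one, inverseMetric_sph_sph, zero_mul, Finset.sum_const_zero, zero_add, add_zero]
  ring

/-! ### Curvature components free of `∂_u Ω` and of second `∂_u` derivatives -/

section Curvature

variable (A B C D : Fin 2)

/-- The torsion drops out, because its partner in the null contraction is `Γ_{0,0A} = 0`. -/
lemma curv_sph_zero_sph_zero : curvLow M.metric q (sph A) 0 (sph B) 0
    = -(1 / 2) * pd (pd (fun y => M.gs y B A) 0) 0 q
      + (1 / 4) * ∑ C, ∑ D, (M.gs q)⁻¹ C D * (pd (fun y => M.gs y C A) 0 q * pd (fun y => M.gs y D B) 0 q) := by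
  rw [curvLow_eq h.metric h.det_metric h.pd_metric_symm, h.contract]
  simp only [low_sph_sph_sph, h.low_zero_zero_zero, h.low_one_zero_zero, h.low_sph_zero_zero, h.low_one_sph_zero, h.low_zero_zero_sph, h.low_one_zero_sph, h.low_sph_zero_sph, h.low_sph_sph_zero, h.low_zero_sph_zero, metric_sph_sph, pd_metric_one_one, pd_metric_one_sph,
    pd_metric_sph_one, pd_const, h.pd_pd_zero_sph_of_ne _ 0 _ (by decide) (sph_ne_one _), h.pd_pd_zero_zero _ _ (Or.inl (sph_ne_one _)), h.pd_pd_sph_zero_of_ne _ _ 0 (sph_ne_one _) (by decide)]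
  simp only [Fin.sum_univ_two]
  ring

lemma curv_sph_zero_one_zero : curvLow M.metric q (sph A) 0 1 0
    = -(1 / 2) * pd (M.twist A) 0 q
      - (1 / 4) * ∑ B, ∑ C, (M.gs q)⁻¹ B C * (pd (fun y => M.gs y B A) 0 q * M.twist C q) := by
  rw [curvLow_eq h.metric h.det_metric h.pd_metric_symm, h.contract]
  simp only [h.low_zero_zero_zero, h.low_one_zero_zero, h.low_sph_zero_zero, h.low_zero_one_zero, h.low_one_one_zero, h.low_sph_one_zero, h.low_zero_zero_sph, h.low_one_zero_sph, h.low_sph_zero_sph, metric_sph_sph, pd_metric_one_one, pd_metric_one_sph,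
    pd_metric_sph_one, pd_const, h.pd_pd_zero_sph_one' _ 0 (by decide), h.pd_pd_zero_zero _ _ (Or.inl (sph_ne_one _)), h.pd_pd_one_zero _ 0 (sph_ne_one _) (by decide)]
  simp only [Fin.sum_univ_two]
  ring

lemma curv_sph_sph_sph_zero : curvLow M.metric q (sph B) (sph A) (sph C) 0
    = (1 / 2) * (pd (pd (fun y => M.gs y C A) (sph B)) 0 q
        - pd (pd (fun y => M.gs y C B) (sph A)) 0 q)
      - (1 / 2) * ∑ D, ∑ E, (M.gs q)⁻¹ D E * (M.sphereLow q D C B * pd (fun y => M.gs y E A) 0 q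
        - pd (fun y => M.gs y D B) 0 q * M.sphereLow q E C A)
      + (1 / 8) * (M.twist B q * pd (fun y => M.gs y C A) 0 q - pd (fun y => M.gs y C B) 0 q * M.twist A q) := by
  rw [curvLow_eq h.metric h.det_metric h.pd_metric_symm, h.contract]
  simp only [low_sph_sph_sph, h.low_zero_sph_sph, h.low_one_sph_sph, h.low_zero_zero_sph, h.low_one_zero_sph, h.low_sph_zero_sph, metric_sph_sph, pd_metric_one_one, pd_metric_one_sph,
    pd_metric_sph_one, pd_const, h.pd_pd_zero_sph_of_ne _ _ _ (sph_ne_one _) (sph_ne_one _)]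
  simp only [Fin.sum_univ_two]
  ring

lemma curv_zero_sph_one_sph : curvLow M.metric q 0 (sph A) 1 (sph B)
    = -(1 / 2) * pd (M.twist B) (sph A) q - (1 / 2) * pd (pd (fun y => M.gs y B A) 1) 0 q
      + (1 / 2) * ∑ C, ∑ D, (M.gs q)⁻¹ C D * (M.twist C q * M.sphereLow q D B A)
      + (1 / 4) * ∑ C, ∑ D, (M.gs q)⁻¹ C D * (pd (fun y => M.gs y C B) 0 q * pd (fun y => M.gs y D A) 1 q)
      + (1 / 8) * (M.twist A q * M.twist B q) := by
  rw [curvLow_eq h.metric h.det_metric h.pd_metric_symm, h.contract]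
  simp only [low_sph_sph_sph, h.low_zero_sph_sph, h.low_one_sph_sph, h.low_zero_one_zero, h.low_one_one_zero, h.low_sph_one_zero, h.low_zero_sph_zero, h.low_one_sph_zero, h.low_sph_sph_zero, h.low_zero_one_sph, h.low_one_one_sph, h.low_sph_one_sph, metric_sph_sph, pd_metric_one_one, pd_metric_one_sph,
    pd_metric_sph_one, pd_const, h.pd_pd_sph_zero_one' _ _ (sph_ne_one _), pd_comm (h.gs _ _) 0 1, h.pd_pd_one_zero _ _ (sph_ne_one _) (sph_ne_one _)]
  simp only [Fin.sum_univ_two]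
  ring

lemma curv_sph_zero_sph_one : curvLow M.metric q (sph A) 0 (sph B) 1
    = curvLow M.metric q 0 (sph A) 1 (sph B) := by
  rw [curvLow_swap_left h.metric h.det_metric h.pd_metric_symm h.inv_metric_symm,
    curvLow_swap_right, neg_neg]

/-- Up to exchanging `A` and `B` this is `curv_zero_sph_one_sph`, so the two components have the
same trace. -/
lemma curv_one_sph_zero_sph : curvLow M.metric q 1 (sph A) 0 (sph B)
    = -(1 / 2) * pd (M.twist A) (sph B) q - (1 / 2) * pd (pd (fun y => M.gs y B A) 1) 0 q
      + (1 / 2) * ∑ C, ∑ D, (M.gs q)⁻¹ C D * (M.twist C q * M.sphereLow q D B A)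
      + (1 / 4) * ∑ C, ∑ D, (M.gs q)⁻¹ C D * (pd (fun y => M.gs y C B) 1 q * pd (fun y => M.gs y D A) 0 q)
      + (1 / 8) * (M.twist A q * M.twist B q) := by
  rw [curvLow_eq h.metric h.det_metric h.pd_metric_symm, h.contract]
  simp only [low_sph_sph_sph, h.low_zero_sph_sph, h.low_one_sph_sph, h.low_zero_zero_one, h.low_one_zero_one, h.low_sph_zero_one, h.low_zero_sph_one, h.low_one_sph_one, h.low_sph_sph_one, h.low_zero_zero_sph, h.low_one_zero_sph, h.low_sph_zero_sph, metric_sph_sph, pd_metric_one_one, pd_metric_one_sph,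
    pd_metric_sph_one, pd_const, h.pd_pd_zero_sph_one _ _ (sph_ne_one _), h.pd_pd_one_zero _ _ (sph_ne_one _) (sph_ne_one _), metric_zero_one, ← metric_one_zero]
  simp only [Fin.sum_univ_two]
  ring

lemma curv_sph_sph_sph_sph : curvLow M.metric q (sph C) (sph A) (sph D) (sph B)
    = M.sphereCurv q C A D B
      + (1 / 8) * (pd (fun y => M.gs y D C) 0 q * pd (fun y => M.gs y B A) 1 q + pd (fun y => M.gs y D C) 1 q * pd (fun y => M.gs y B A) 0 q
        - pd (fun y => M.gs y B C) 0 q * pd (fun y => M.gs y D A) 1 q - pd (fun y => M.gs y B C) 1 q * pd (fun y => M.gs y D A) 0 q) := by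
  rw [curvLow_eq h.metric h.det_metric h.pd_metric_symm, h.contract]
  simp only [low_sph_sph_sph, h.low_zero_sph_sph, h.low_one_sph_sph, metric_sph_sph, pd_metric_one_one, pd_metric_one_sph,
    pd_metric_sph_one, pd_const, sphereCurv]
  simp only [Fin.sum_univ_two]
  ring

lemma curv_one_zero_sph_sph : curvLow M.metric q 1 0 (sph A) (sph B)
    = (1 / 2) * (pd (M.twist B) (sph A) q - pd (M.twist A) (sph B) q)
      + (1 / 4) * ∑ C, ∑ D, (M.gs q)⁻¹ C D * (pd (fun y => M.gs y C B) 1 q * pd (fun y => M.gs y D A) 0 q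
        - pd (fun y => M.gs y C A) 1 q * pd (fun y => M.gs y D B) 0 q) := by
  rw [curvLow_eq h.metric h.det_metric h.pd_metric_symm, h.contract]
  simp only [h.low_zero_sph_one, h.low_one_sph_one, h.low_sph_sph_one, h.low_zero_sph_zero, h.low_one_sph_zero, h.low_sph_sph_zero, metric_sph_sph, pd_metric_one_one, pd_metric_one_sph,
    pd_metric_sph_one, pd_const, h.pd_pd_sph_zero_one _ _ (sph_ne_one _)]
  simp only [Fin.sum_univ_two]
  ring

end Curvature

end AdaptedAt

end DoubleNull

/-! ### Null components and the Einstein equations on the initial cone -/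

namespace DoubleNull.AdaptedAt

variable {M : DoubleNull} {q : Fin 4 → ℝ} (h : M.AdaptedAt q)

include h

lemma ricci_eq (l j : Fin 4) : ricci M.metric q l j
    = -(1 / 2) * (curvLow M.metric q 1 l 0 j + curvLow M.metric q 0 l 1 j)
      + ∑ A, ∑ B, (M.gs q)⁻¹ A B * curvLow M.metric q (sph B) l (sph A) j := by
  rw [NullGeom.ricci_eq h.det_metric, h.inv_metric]
  simp only [sum_four, inverseMetric_zero_zero, inverseMetric_zero_one, inverseMetric_one_zero,
    inverseMetric_one_one, inverseMetric_zero_sph, inverseMetric_sph_zero, inverseMetric_one_sph,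
    inverseMetric_sph_one, inverseMetric_sph_sph, zero_mul, Finset.sum_const_zero, zero_add, add_zero]
  ring

lemma curv_left_self (n i j : Fin 4) : curvLow M.metric q n n i j = 0 := by
  have := curvLow_swap_left h.metric h.det_metric h.pd_metric_symm h.inv_metric_symm n n i j
  linarith

omit h in
lemma curv_right_self (n l i : Fin 4) : curvLow M.metric q n l i i = 0 := by
  have := curvLow_swap_right M.metric q n l i i
  linarith

lemma curv_swap_left (n l i j : Fin 4) :
    curvLow M.metric q n l i j = - curvLow M.metric q l n i j :=
  curvLow_swap_left h.metric h.det_metric h.pd_metric_symm h.inv_metric_symm n l i j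

lemma e4_eq : M.e4 q = Pi.single 0 1 := by simp [e4, h.Ω_eq, h.b_eq]

lemma e3_eq : M.e3 q = Pi.single 1 1 := by simp [e3, h.Ω_eq]

lemma alpha_eq (A B : Fin 2) : M.alpha q A B = curvLow M.metric q (sph A) 0 (sph B) 0 := by
  simp only [alpha, h.e4_eq, eA, riem_single]

lemma beta_eq (A : Fin 2) : M.beta q A = (1 / 2) * curvLow M.metric q (sph A) 0 1 0 := by
  simp only [beta, h.e4_eq, h.e3_eq, eA, riem_single]

lemma rho_eq : M.rho q = (1 / 4) * curvLow M.metric q 1 0 1 0 := by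
  simp only [rho, h.e4_eq, h.e3_eq, riem_single]

lemma sigma_eq : M.sigma q
    = (1 / 4) * ∑ A, ∑ B, curvLow M.metric q 1 0 (sph A) (sph B) * M.epsUp q A B := by
  simp only [sigma, h.e4_eq, h.e3_eq, eA, riem_single]

/-- Along the initial cone `e₄ = ∂_{u̲}`, with constant components, so that `∇_A e₄` reduces to
connection coefficients and `χ` becomes half the `u̲` derivative of the induced metric. -/
lemma pd_e4 (A : Fin 2) (k : Fin 4) : pd (fun y => M.e4 y k) (sph A) q = 0 := by
  have h1 : DifferentiableAt ℝ M.Ω q := h.Ω.differentiable (by simp) q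
  have h2 : DifferentiableAt ℝ (fun y => (M.Ω y)⁻¹) q := h1.inv (by simp [h.Ω_eq])
  have h3 : pd (fun y => (M.Ω y)⁻¹) (sph A) q = 0 := by
    have h4 : pd (fun y => M.Ω y * (M.Ω y)⁻¹) (sph A) q = 0 := by
      have : (fun y => M.Ω y * (M.Ω y)⁻¹) =ᶠ[nhds q] fun _ => 1 := by
        have := h.Ω.continuous.continuousAt.eventually_ne (x := q) (y := 0) (by simp [h.Ω_eq])
        filter_upwards [this] with y hy using mul_inv_cancel₀ hy
      rw [pd, this.fderiv_eq]; simp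
    rw [pd_mul_at h1 h2] at h4
    simpa [h.pd_Ω _ (sph_ne_one A), h.Ω_eq] using h4
  have h5 : ContDiff ℝ ∞ fun y => (Pi.single 0 1 : Fin 4 → ℝ) k + ∑ B, M.b y B * eA B k :=
    contDiff_const.add (ContDiff.sum fun B _ => (h.b B).mul contDiff_const)
  have h6 : (fun y => M.e4 y k)
      = fun y => (M.Ω y)⁻¹ * ((Pi.single 0 1 : Fin 4 → ℝ) k + ∑ B, M.b y B * eA B k) := by
    ext y; simp [e4]
  rw [h6, pd_mul_at h2 (h5.differentiable (by simp) q), h3,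
    pd_add contDiff_const (ContDiff.sum fun B _ => (h.b B).mul contDiff_const),
    pd_sum fun B _ => (h.b B).mul contDiff_const]
  simp [pd_const, pd_mul (h.b _) contDiff_const, h.pd_b _ _ (sph_ne_one A)]

lemma chi_eq (A B : Fin 2) : M.chi q A B = (1 / 2) * pd (fun y => M.gs y A B) 0 q := by
  have h1 : ∀ k, covVec M.metric (eA A) M.e4 q k = christoffel M.metric q k (sph A) 0 := by
    intro k
    simp only [covVec, h.pd_e4, h.e4_eq, eA]
    simp [Pi.single_apply, h.pd_e4]
  have h2 : M.chi q A B = ∑ μ, M.metric q (sph B) μ * christoffel M.metric q μ (sph A) 0 := by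
    simp only [chi, h1]
    refine Finset.sum_congr rfl fun μ _ => ?_
    have h3 : M.metric q μ (sph B) = M.metric q (sph B) μ := by
      revert μ
      refine forall_four ?_ ?_ fun C => ?_
      · simp [metric_zero_sph, metric_sph_zero, h.b_eq]
      · simp [metric_one_sph, metric_sph_one]
      · intro _; simp only [metric_sph_sph, h.gs_symm C B]
    simp [eA, Pi.single_apply, h3]
  rw [h2, sum_mul_christoffel h.det_metric, h.low_sph_sph_zero, h.pd_gs_symm]

lemma trchi_eq : M.trchi q
    = (1 / 2) * ∑ A, ∑ B, (M.gs q)⁻¹ A B * pd (fun y => M.gs y A B) 0 q := by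
  simp only [trchi, h.chi_eq, Finset.mul_sum]
  exact Finset.sum_congr rfl fun A _ => Finset.sum_congr rfl fun B _ => by ring

section Vacuum

variable (hv : ∀ μ ν, ricci M.metric q μ ν = 0)

include hv

/-- The Raychaudhuri equation. -/
lemma trace_alpha : ∑ A, ∑ B, (M.gs q)⁻¹ A B * curvLow M.metric q (sph B) 0 (sph A) 0 = 0 := by
  have := hv 0 0
  rw [h.ricci_eq, curv_right_self, h.curv_left_self] at this
  simpa using this

/-- The Codazzi equation. -/
lemma codazzi (A : Fin 2) : (1 / 2) * curvLow M.metric q (sph A) 0 1 0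
    = - ∑ B, ∑ C, (M.gs q)⁻¹ B C * curvLow M.metric q (sph C) (sph A) (sph B) 0 := by
  have := hv (sph A) 0
  rw [h.ricci_eq, curv_right_self, h.curv_swap_left 0] at this
  linarith

/-- The Gauss equation. -/
lemma gauss : curvLow M.metric q 1 0 1 0
    = -2 * ∑ A, ∑ B, (M.gs q)⁻¹ A B * curvLow M.metric q 0 (sph B) 1 (sph A) := by
  -- Computed directly, `R_{1010}` contains `∂_u ∂_{u̲} Ω`, on which the gauge gives no information;
  -- the Ricci equation exchanges it for an angular trace.
  have := hv 0 1
  rw [h.ricci_eq, curvLow_swap_right, h.curv_left_self] at this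
  simp only [h.curv_sph_zero_sph_one] at this
  have e : ∑ A, ∑ B, (M.gs q)⁻¹ A B * curvLow M.metric q 0 (sph B) 1 (sph A)
    = ∑ A, ∑ B, (M.gs q)⁻¹ A B * curvLow M.metric q (sph B) 0 (sph A) 1 := by
    simp only [h.curv_sph_zero_sph_one]
  linarith

/-- The trace of the Ricci curvature of the spheres. -/
lemma trace_ricci : ∑ A, ∑ B, (M.gs q)⁻¹ A B * curvLow M.metric q 0 (sph B) 1 (sph A)
    = ∑ A, ∑ B, ∑ C, ∑ D, (M.gs q)⁻¹ A B * (M.gs q)⁻¹ C D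
        * curvLow M.metric q (sph D) (sph B) (sph C) (sph A) := by
  have h1 : ∑ A, ∑ B, (M.gs q)⁻¹ A B * ricci M.metric q (sph B) (sph A) = 0 := by simp [hv]
  have h2 : ∑ A, ∑ B, (M.gs q)⁻¹ A B * curvLow M.metric q 1 (sph B) 0 (sph A)
      = ∑ A, ∑ B, (M.gs q)⁻¹ A B * curvLow M.metric q 0 (sph B) 1 (sph A) := by
    -- The two mixed components differ by transposition only, and the trace does not see it.
    have e1 : ∀ C A B, M.sphereLow q C A B = M.sphereLow q C B A := by
      intro C A B; simp only [sphereLow, h.pd_gs_symm A B]; ring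
    simp only [h.curv_one_sph_zero_sph, h.curv_zero_sph_one_sph, Fin.sum_univ_two,
      h.inv_gs_symm 1 0, e1 _ 1 0, h.pd_gs_symm 1 0]
    ring
  simp only [h.ricci_eq, mul_add, Finset.sum_add_distrib, Finset.mul_sum] at h1
  have h3 : ∀ f : Fin 2 → Fin 2 → ℝ, ∑ A, ∑ B, (M.gs q)⁻¹ A B * (-(1 / 2) * f A B)
      = -(1 / 2) * ∑ A, ∑ B, (M.gs q)⁻¹ A B * f A B := by
    intro f; simp only [Finset.mul_sum]
    exact Finset.sum_congr rfl fun A _ => Finset.sum_congr rfl fun B _ => by ring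
  rw [h3, h3, h2] at h1
  have h4 : ∑ A, ∑ B, ∑ C, ∑ D, (M.gs q)⁻¹ A B * (M.gs q)⁻¹ C D
        * curvLow M.metric q (sph D) (sph B) (sph C) (sph A)
      = ∑ A, ∑ B, ∑ C, ∑ D, (M.gs q)⁻¹ A B * ((M.gs q)⁻¹ C D
        * curvLow M.metric q (sph D) (sph B) (sph C) (sph A)) := by simp only [mul_assoc]
  rw [h4]
  linarith

end Vacuum

end DoubleNull.AdaptedAt


/-! ### Pulling back to the initial cone, and the Minkowskian initial values -/

/-- A short pulse development with one of its two charts. -/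
structure PulseData where
  u₀ : ℝ
  u₁ : ℝ
  δ : ℝ
  m₀ : ℝ
  S : Seed
  D : Development u₀ u₁ δ
  i : Fin 2
  hu₀ : u₀ < -2
  hu₀₁ : u₀ < u₁
  hu₁ : u₁ < 0
  hδ : 0 < δ
  hδ1 : δ ≤ 1
  pulse : D.IsShortPulse S
  energy : D.ShearEnergy m₀ ∨ S.Energy m₀

namespace PulseData

variable (p : PulseData)

/-- The metric in the chosen chart. -/
def M : DoubleNull := p.D.M p.i

/-- The parametrization of the initial cone by the strip. -/
def pos (x : Strip) : Fin 4 → ℝ := pt (p.δ * x.1) p.u₀ x.2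

/-- The restriction of a function to the initial cone. -/
def pull (f : (Fin 4 → ℝ) → ℝ) : Strip → ℝ := fun x => f (p.pos x)

lemma pos_mem {x : Strip} (hx : x ∈ strip) : p.pos x ∈ region p.u₀ p.u₁ p.δ := by
  obtain ⟨h0, h1⟩ := mem_strip.1 hx
  have := p.hδ; have := p.hu₀; have := p.hu₀₁
  refine ⟨?_, ?_, ?_, ?_⟩ <;> simp only [pos, pt, Matrix.cons_val_zero, Matrix.cons_val_one] <;>
    nlinarith

lemma smooth : p.M.IsSmooth := ⟨p.D.smooth_Ω p.i, p.D.smooth_b p.i, p.D.smooth_gs p.i⟩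

lemma hasFDerivAt_pos (x : Strip) : HasFDerivAt p.pos (ContinuousLinearMap.pi
    ![p.δ • ContinuousLinearMap.fst ℝ ℝ (Fin 2 → ℝ), 0,
      (ContinuousLinearMap.proj 0).comp (ContinuousLinearMap.snd ℝ ℝ (Fin 2 → ℝ)),
      (ContinuousLinearMap.proj 1).comp (ContinuousLinearMap.snd ℝ ℝ (Fin 2 → ℝ))]) x := by
  have h : p.pos = fun x => (ContinuousLinearMap.pi
    ![p.δ • ContinuousLinearMap.fst ℝ ℝ (Fin 2 → ℝ), 0,
      (ContinuousLinearMap.proj 0).comp (ContinuousLinearMap.snd ℝ ℝ (Fin 2 → ℝ)),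
      (ContinuousLinearMap.proj 1).comp (ContinuousLinearMap.snd ℝ ℝ (Fin 2 → ℝ))]) x
      + Pi.single 1 p.u₀ := by
    ext x μ
    fin_cases μ <;> simp [pos, pt]
  rw [h]
  exact (ContinuousLinearMap.hasFDerivAt _).add_const _

lemma contDiff_pos : ContDiff ℝ ∞ p.pos := by
  refine contDiff_pi.2 fun μ => ?_
  fin_cases μ <;> simp only [pos, pt] <;> simp <;> fun_prop

variable {f : (Fin 4 → ℝ) → ℝ}

lemma contDiff_pull (hf : ContDiff ℝ ∞ f) : ContDiff ℝ ∞ (p.pull f) := hf.comp p.contDiff_pos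

lemma sm_pull (hf : ContDiff ℝ ∞ f) : Sm (p.pull f) := Sm.of_contDiff (p.contDiff_pull hf)

lemma dS_pull (hf : ContDiff ℝ ∞ f) (x : Strip) : dS (p.pull f) x = p.δ * p.pull (pd f 0) x := by
  have h := ((hf.differentiable (by simp) (p.pos x)).hasFDerivAt).comp x (p.hasFDerivAt_pos x)
  have e : dS (p.pull f) x = fderiv ℝ f (p.pos x) (p.δ • Pi.single 0 1) := by
    rw [dirD, show p.pull f = f ∘ p.pos from rfl, h.fderiv, ContinuousLinearMap.comp_apply]
    congr 1
    ext μ; fin_cases μ <;> simp [vS]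
  rw [e, map_smul]; rfl

lemma dT_pull (hf : ContDiff ℝ ∞ f) (A : Fin 2) (x : Strip) :
    dT A (p.pull f) x = p.pull (pd f (sph A)) x := by
  have h := ((hf.differentiable (by simp) (p.pos x)).hasFDerivAt).comp x (p.hasFDerivAt_pos x)
  rw [dirD, show p.pull f = f ∘ p.pos from rfl, h.fderiv, ContinuousLinearMap.comp_apply]
  unfold pull pd
  congr 1
  ext μ; fin_cases A <;> fin_cases μ <;> simp [vT, sph]

lemma pull_pd_zero (hf : ContDiff ℝ ∞ f) : p.pull (pd f 0) = fun x => p.δ⁻¹ * dS (p.pull f) x := by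
  ext x
  rw [p.dS_pull hf, inv_mul_cancel_left₀ p.hδ.ne']

lemma pull_pd_sph (hf : ContDiff ℝ ∞ f) (A : Fin 2) : p.pull (pd f (sph A)) = dT A (p.pull f) := by
  ext x
  rw [p.dT_pull hf]

/-- All coordinate directions but `∂_u` are tangent to the cone. Applied once to the gauge
conditions and once more to the resulting first derivatives, this yields the conditions of
`AdaptedAt`. -/
lemma pull_pd_eq_zero (hf : ContDiff ℝ ∞ f) {c : ℝ} (h : EqOn (p.pull f) (fun _ => c) strip) :
    ∀ μ, μ ≠ 1 → EqOn (p.pull (pd f μ)) (fun _ => 0) strip := by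
  have h1 : ∀ v, EqOn (dirD v (p.pull f)) (fun _ => 0) strip := fun v x hx => by
    rw [(p.sm_pull hf).dirD_congr (Sm.const c) h v hx, dirD_const]
  refine DoubleNull.forall_four (fun _ x hx => ?_) (fun h => absurd rfl h) (fun A _ x hx => ?_)
  · rw [p.pull_pd_zero hf]
    simp [h1 _ hx]
  · rw [p.pull_pd_sph hf, h1 _ hx]

/-- The region is convex with nonempty interior. Thus derivatives at its points, including those on
`C_{u₀}`, do not depend on the extension. -/
lemma uniqueDiffOn_region {u₀ u₁ δ : ℝ} (h1 : u₀ < u₁) (h2 : u₁ < 0) (h3 : 0 < δ) :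
    UniqueDiffOn ℝ (region u₀ u₁ δ) := by
  refine uniqueDiffOn_convex ?_ ?_
  · intro x hx y hy a b ha hb hab
    obtain ⟨x1, x2, x3, x4⟩ := hx
    obtain ⟨y1, y2, y3, y4⟩ := hy
    refine ⟨?_, ?_, ?_, ?_⟩ <;> simp only [Pi.add_apply, Pi.smul_apply, smul_eq_mul]
    · calc u₀ = a * u₀ + b * u₀ := by rw [← add_mul, hab, one_mul]
        _ ≤ _ := by gcongr
    · calc _ ≤ a * u₁ + b * u₁ := by gcongr
        _ = u₁ := by rw [← add_mul, hab, one_mul]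
    · rcases ha.eq_or_lt with h | h
      · have : b = 1 := by linarith
        subst this; subst h; simpa using y3
      · exact add_lt_add_of_lt_of_le (by gcongr) (by gcongr)
    · calc _ ≤ a * δ + b * δ := by gcongr
        _ = δ := by rw [← add_mul, hab, one_mul]
  · let U : Set (Fin 4 → ℝ) := {x | u₀ < x 1 ∧ x 1 < u₁ ∧ x 1 < x 0 ∧ x 0 < δ}
    have hU : IsOpen U := (isOpen_lt continuous_const (continuous_apply 1)).inter
      ((isOpen_lt (continuous_apply 1) continuous_const).inter
        ((isOpen_lt (continuous_apply 1) (continuous_apply 0)).inter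
          (isOpen_lt (continuous_apply 0) continuous_const)))
    refine ⟨pt 0 ((u₀ + u₁) / 2) 0, (interior_maximal ?_ hU) ?_⟩
    · exact fun x hx => ⟨hx.1.le, hx.2.1.le, hx.2.2.1, hx.2.2.2.le⟩
    · refine ⟨?_, ?_, ?_, ?_⟩ <;> simp [pt] <;> linarith

lemma pd_eq_of_eqOn_region {f g : (Fin 4 → ℝ) → ℝ} (hf : ContDiff ℝ ∞ f) (hg : ContDiff ℝ ∞ g)
    (h : EqOn f g (region p.u₀ p.u₁ p.δ)) (c : Fin 4) :
    EqOn (pd f c) (pd g c) (region p.u₀ p.u₁ p.δ) := by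
  intro q hq
  have hu := uniqueDiffOn_region p.hu₀₁ p.hu₁ p.hδ q hq
  have h1 := (hf.differentiable (by simp) q).fderivWithin hu
  have h2 := (hg.differentiable (by simp) q).fderivWithin hu
  simp only [pd, ← h1, ← h2, fderivWithin_congr h (h hq)]

lemma gs_symm {q : Fin 4 → ℝ} (hq : q ∈ region p.u₀ p.u₁ p.δ) (A B : Fin 2) :
    p.M.gs q A B = p.M.gs q B A := by
  have := (p.D.gs_posDef p.i q hq).isHermitian.apply A B
  have h : (p.D.M p.i).gs q A B = (p.D.M p.i).gs q B A := by simpa using this.symm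
  exact h

lemma adapted {x : Strip} (hx : x ∈ strip) : p.M.AdaptedAt (p.pos x) := by
  have hg : ∀ y ∈ strip, p.M.Ω (p.pos y) = 1 ∧ p.M.b (p.pos y) = 0 := fun y hy =>
    p.D.gauge p.i _ (p.pos_mem hy) (by simp [pos, pt])
  have hΩ : EqOn (p.pull p.M.Ω) (fun _ => 1) strip := fun y hy => (hg y hy).1
  have hb : ∀ A, EqOn (p.pull fun z => p.M.b z A) (fun _ => 0) strip := fun A y hy => by
    simp [pull, (hg y hy).2]
  have hs := p.smooth
  have hsym : ∀ A B, EqOn (fun z => p.M.gs z A B) (fun z => p.M.gs z B A)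
      (region p.u₀ p.u₁ p.δ) := fun A B q hq => p.gs_symm hq A B
  exact
    { hs with
      Ω_eq := hΩ hx
      b_eq := fun A => hb A hx
      gs_symm := fun A B => hsym A B (p.pos_mem hx)
      gs_det := (p.D.gs_posDef p.i _ (p.pos_mem hx)).det_pos.ne'
      pd_gs_symm := fun A B c =>
        p.pd_eq_of_eqOn_region (hs.gs A B) (hs.gs B A) (hsym A B) c (p.pos_mem hx)
      pd_Ω := fun c hc => p.pull_pd_eq_zero hs.Ω hΩ c hc hx
      pd_b := fun A c hc => p.pull_pd_eq_zero (hs.b A) (hb A) c hc hx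
      pd_pd_Ω := fun c d hc hd => p.pull_pd_eq_zero (contDiff_pd hs.Ω c)
        (p.pull_pd_eq_zero hs.Ω hΩ c hc) d hd hx
      pd_pd_b := fun A c d hc hd => p.pull_pd_eq_zero (contDiff_pd (hs.b A) c)
        (p.pull_pd_eq_zero (hs.b A) (hb A) c hc) d hd hx }

lemma vacuum {x : Strip} (hx : x ∈ strip) (μ ν : Fin 4) : ricci p.M.metric (p.pos x) μ ν = 0 :=
  p.D.vacuum p.i _ (p.pos_mem hx) μ ν

lemma hasDerivAt_zero (hf : ContDiff ℝ ∞ f) (t u : ℝ) (θ : Fin 2 → ℝ) :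
    HasDerivAt (fun t => f (pt t u θ)) (pd f 0 (pt t u θ)) t := by
  have h1 : HasDerivAt (fun t => pt t u θ) (Pi.single 0 1) t := by
    refine hasDerivAt_pi.2 fun μ => ?_
    fin_cases μ <;> simp [pt, hasDerivAt_id', hasDerivAt_const]
  exact ((hf.differentiable (by simp) _).hasFDerivAt).comp_hasDerivAt t h1

lemma hasDerivAt_one (hf : ContDiff ℝ ∞ f) (t u : ℝ) (θ : Fin 2 → ℝ) :
    HasDerivAt (fun u => f (pt t u θ)) (pd f 1 (pt t u θ)) u := by
  have h1 : HasDerivAt (fun u => pt t u θ) (Pi.single 1 1) u := by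
    refine hasDerivAt_pi.2 fun μ => ?_
    fin_cases μ <;> simp [pt, hasDerivAt_id', hasDerivAt_const]
  exact ((hf.differentiable (by simp) _).hasFDerivAt).comp_hasDerivAt u h1

lemma mem_past {t u : ℝ} (ht : t ≤ 0) (hu : p.u₀ ≤ u) (hu' : u ≤ p.u₁) (htu : u < t)
    (θ : Fin 2 → ℝ) : pt t u θ ∈ region p.u₀ p.u₁ p.δ ∧ (pt t u θ) 0 ≤ 0 := by
  have := p.hδ
  refine ⟨⟨?_, ?_, ?_, ?_⟩, ?_⟩ <;> simp [pt] <;> linarith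

/-- On `u̲ = 0` the shift vanishes for all `u` in `[u₀, u₁]`, which determines its one-sided `u`
derivative at `u₀`. -/
lemma twist_init (A : Fin 2) (θ : Fin 2 → ℝ) : p.pull (p.M.twist A) (0, θ) = 0 := by
  have h := p.hu₀₁; have h' := p.hu₁
  have hb : ∀ B, pd (fun y => p.M.b y B) 1 (pt 0 p.u₀ θ) = 0 := by
    intro B
    have h1 := (hasDerivAt_one (p.smooth.b B) 0 p.u₀ θ).hasDerivWithinAt (s := Icc p.u₀ p.u₁)
    have h2 : HasDerivWithinAt (fun u => p.M.b (pt 0 u θ) B) 0 (Icc p.u₀ p.u₁) p.u₀ := by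
      refine (hasDerivWithinAt_const p.u₀ _ (0 : ℝ)).congr_of_mem (fun u hu => ?_) ⟨le_rfl, h.le⟩
      obtain ⟨m1, m2⟩ := p.mem_past le_rfl hu.1 hu.2 (by linarith [hu.2]) θ
      exact congrFun (p.D.minkowski p.i _ m1 m2).2.1 B
    exact (uniqueDiffOn_Icc h p.u₀ ⟨le_rfl, h.le⟩).eq_deriv _ h1 h2
  simp [pull, DoubleNull.twist, pos, hb]

lemma gs_past {t u : ℝ} (ht : t ≤ 0) (hu : p.u₀ ≤ u) (hu' : u ≤ p.u₁) (htu : u < t)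
    (θ : Fin 2 → ℝ) (A B : Fin 2) : p.M.gs (pt t u θ) A B
      = (t - u) ^ 2 * (roundFactor θ ^ 2 * (1 : Matrix (Fin 2) (Fin 2) ℝ) A B) := by
  obtain ⟨m1, m2⟩ := p.mem_past ht hu hu' htu θ
  have h := (p.D.minkowski p.i _ m1 m2).2.2
  have h2 : ang (pt t u θ) = θ := by ext A; fin_cases A <;> simp [ang, pt]
  rw [M, h, h2]
  simp [pt]; ring

lemma gs_init (θ : Fin 2 → ℝ) (A B : Fin 2) : p.pull (fun y => p.M.gs y A B) (0, θ)
    = p.u₀ ^ 2 * (roundFactor θ ^ 2 * (1 : Matrix (Fin 2) (Fin 2) ℝ) A B) := by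
  have h := p.hu₀; have h' := p.hu₀₁
  have := p.gs_past le_rfl le_rfl h'.le (by linarith) θ A B
  simpa [pull, pos] using this

lemma gs_one_init (θ : Fin 2 → ℝ) (A B : Fin 2) :
    p.pull (pd (fun y => p.M.gs y A B) 1) (0, θ)
      = 2 * p.u₀ * (roundFactor θ ^ 2 * (1 : Matrix (Fin 2) (Fin 2) ℝ) A B) := by
  have h := p.hu₀₁; have h' := p.hu₁
  set c := roundFactor θ ^ 2 * (1 : Matrix (Fin 2) (Fin 2) ℝ) A B
  have h1 := (hasDerivAt_one (p.smooth.gs A B) 0 p.u₀ θ).hasDerivWithinAt (s := Icc p.u₀ p.u₁)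
  have h2 : HasDerivWithinAt (fun u => p.M.gs (pt 0 u θ) A B) (2 * p.u₀ * c) (Icc p.u₀ p.u₁)
      p.u₀ := by
    have h3 : HasDerivAt (fun u : ℝ => u ^ 2 * c) (2 * p.u₀ * c) p.u₀ := by
      simpa using ((hasDerivAt_pow 2 p.u₀).mul_const c)
    refine h3.hasDerivWithinAt.congr_of_mem (fun u hu => ?_) ⟨le_rfl, h.le⟩
    rw [p.gs_past le_rfl hu.1 hu.2 (by linarith [hu.2]) θ A B]; ring
  have h4 := (uniqueDiffOn_Icc h p.u₀ ⟨le_rfl, h.le⟩).eq_deriv _ h1 h2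
  simpa [pull, pos] using h4

lemma dS_gs_init (θ : Fin 2 → ℝ) (A B : Fin 2) : dS (p.pull fun y => p.M.gs y A B) (0, θ)
      = -2 * p.δ * p.u₀ * (roundFactor θ ^ 2 * (1 : Matrix (Fin 2) (Fin 2) ℝ) A B) := by
  have h := p.hu₀; have h' := p.hu₀₁
  set c := roundFactor θ ^ 2 * (1 : Matrix (Fin 2) (Fin 2) ℝ) A B
  -- The `u̲` derivative is taken from the Minkowskian side; on `[u₀/2, 0]` the condition `u₀ < u̲`
  -- holds.
  have hm : (0 : ℝ) ∈ Icc (p.u₀ / 2) 0 := ⟨by linarith, le_rfl⟩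
  have h1 := (hasDerivAt_zero (p.smooth.gs A B) 0 p.u₀ θ).hasDerivWithinAt (s := Icc (p.u₀ / 2) 0)
  have h2 : HasDerivWithinAt (fun t => p.M.gs (pt t p.u₀ θ) A B) (-2 * p.u₀ * c)
      (Icc (p.u₀ / 2) 0) 0 := by
    have h3 : HasDerivAt (fun t : ℝ => (t - p.u₀) ^ 2 * c) (-2 * p.u₀ * c) 0 := by
      have := (((hasDerivAt_id (0 : ℝ)).sub_const p.u₀).pow 2).mul_const c
      simpa using this
    refine h3.hasDerivWithinAt.congr_of_mem (fun t ht => ?_) hm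
    rw [p.gs_past ht.2 le_rfl h'.le (by linarith [ht.1]) θ A B]
  have h4 := (uniqueDiffOn_Icc (by linarith) 0 hm).eq_deriv _ h1 h2
  rw [p.dS_pull (p.smooth.gs A B)]
  simp only [pull, pos, mul_zero, h4]
  ring

end PulseData


/-! ### The exponential of symmetric trace-free matrices -/

/-- The exponential of the symmetric trace-free matrix with entries `z.1`, `z.2`. -/
noncomputable def expTF (z : ℝ × ℝ) : Matrix (Fin 2) (Fin 2) ℝ :=
  NormedSpace.exp !![z.1, z.2; z.2, -z.1]

section Exponential

attribute [local instance] Matrix.linftyOpNormedRing Matrix.linftyOpNormedAlgebra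

/-- A symmetric trace-free matrix as a linear function of its entries. -/
noncomputable def tfMatrix : ℝ × ℝ →L[ℝ] Matrix (Fin 2) (Fin 2) ℝ :=
  (ContinuousLinearMap.fst ℝ ℝ ℝ).smulRight !![1, 0; 0, -1]
    + (ContinuousLinearMap.snd ℝ ℝ ℝ).smulRight !![0, 1; 1, 0]

lemma tfMatrix_apply (z : ℝ × ℝ) : tfMatrix z = !![z.1, z.2; z.2, -z.1] := by
  ext A B; fin_cases A <;> fin_cases B <;> simp [tfMatrix]

/-- An entry of a matrix as a linear function. -/
noncomputable def entryCLM (A B : Fin 2) : Matrix (Fin 2) (Fin 2) ℝ →L[ℝ] ℝ :=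
  LinearMap.toContinuousLinearMap (Matrix.entryLinearMap ℝ ℝ A B)

lemma expTF_eq (A B : Fin 2) : (fun z => expTF z A B)
    = fun z => entryCLM A B (NormedSpace.exp (tfMatrix z)) := by
  ext z; rw [tfMatrix_apply]; rfl

lemma contDiff_expTF (A B : Fin 2) : ContDiff ℝ ∞ fun z => expTF z A B := by
  rw [expTF_eq]
  refine (entryCLM A B).contDiff.comp (ContDiff.comp ?_ tfMatrix.contDiff)
  exact contDiff_iff_contDiffAt.2 fun x => (NormedSpace.exp_analytic (𝕂 := ℝ) x).contDiffAt

lemma expTF_zero : expTF (0, 0) = 1 := by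
  have h : (!![0, 0; 0, -0] : Matrix (Fin 2) (Fin 2) ℝ) = 0 := by
    ext A B; fin_cases A <;> fin_cases B <;> simp
  simp only [expTF, h, NormedSpace.exp_zero]

lemma fderiv_expTF_zero (A B : Fin 2) (v : ℝ × ℝ) :
    fderiv ℝ (fun z => expTF z A B) (0, 0) v = !![v.1, v.2; v.2, -v.1] A B := by
  rw [expTF_eq]
  have h1 : HasFDerivAt (NormedSpace.exp : Matrix (Fin 2) (Fin 2) ℝ → _)
      (1 : Matrix (Fin 2) (Fin 2) ℝ →L[ℝ] Matrix (Fin 2) (Fin 2) ℝ) (tfMatrix (0, 0)) := by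
    have : tfMatrix (0, 0) = 0 := tfMatrix.map_zero
    rw [this]
    exact hasFDerivAt_exp_zero
  have h2 := (entryCLM A B).hasFDerivAt.comp (0, 0) (h1.comp (0, 0) tfMatrix.hasFDerivAt)
  have h3 := congrArg (fun l => l v) h2.fderiv
  refine h3.trans ?_
  rw [← tfMatrix_apply]; rfl

end Exponential

lemma expTF_symm (z : ℝ × ℝ) (A B : Fin 2) : expTF z A B = expTF z B A := by
  have h : (!![z.1, z.2; z.2, -z.1] : Matrix (Fin 2) (Fin 2) ℝ).IsSymm := by
    ext A B; fin_cases A <;> fin_cases B <;> simp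
  exact (h.exp.apply A B).symm

/-- A rotation by a right angle conjugates a symmetric trace-free matrix `X` to `-X`. Hence `exp X`
and its inverse have the same determinant, whose square is one. -/
lemma expTF_det (z : ℝ × ℝ) : (expTF z).det = 1 := by
  set X : Matrix (Fin 2) (Fin 2) ℝ := !![z.1, z.2; z.2, -z.1] with hX
  set J : Matrix (Fin 2) (Fin 2) ℝ := !![0, 1; -1, 0]
  have hJ : IsUnit J := (Matrix.isUnit_iff_isUnit_det _).2 (by simp [J])
  have hJi : J⁻¹ = !![0, -1; 1, 0] := by
    refine Matrix.inv_eq_right_inv ?_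
    ext A B; fin_cases A <;> fin_cases B <;> simp [J]
  have h1 : J * X * J⁻¹ = -X := by
    rw [hJi]
    ext A B; fin_cases A <;> fin_cases B <;> simp [J, hX]
  have h2 : NormedSpace.exp (-X) = J * NormedSpace.exp X * J⁻¹ := by
    rw [← h1, Matrix.exp_conj _ _ hJ]
  have h3 : ∀ Y : Matrix (Fin 2) (Fin 2) ℝ, IsUnit (NormedSpace.exp Y).det := fun Y =>
    (Matrix.isUnit_iff_isUnit_det _).1 (Matrix.isUnit_exp Y)
  have h4 : (NormedSpace.exp X).det * (NormedSpace.exp X).det = 1 := by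
    have e1 : (NormedSpace.exp (-X)).det = (NormedSpace.exp X).det := by
      rw [h2, Matrix.det_conj hJ]
    have e2 : NormedSpace.exp X * NormedSpace.exp (-X) = 1 := by
      rw [Matrix.exp_neg]; exact Matrix.mul_nonsing_inv _ (h3 X)
    have := congrArg Matrix.det e2
    rwa [Matrix.det_mul, e1, Matrix.det_one] at this
  -- The sign is positive because `exp X` is the square of `exp (X/2)`.
  have h5 : 0 < (NormedSpace.exp X).det := by
    have e1 : NormedSpace.exp X = NormedSpace.exp ((1 / 2 : ℝ) • X) * NormedSpace.exp ((1 / 2 : ℝ) • X) := by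
      rw [← Matrix.exp_add_of_commute _ _ (Commute.refl _), ← add_smul]
      norm_num
    rw [e1, Matrix.det_mul]
    exact mul_self_pos.2 (h3 _).ne_zero
  change (NormedSpace.exp X).det = 1
  nlinarith

/-! ### The amplitude and the conformal class of the pulse -/

namespace PulseData

variable (p : PulseData)

/-- `|u₀|` -/
def L : ℝ := -p.u₀

/-- The amplitude of the pulse. -/
noncomputable def ε : ℝ := Real.sqrt p.δ / p.L

lemma L_gt : 2 < p.L := by have := p.hu₀; unfold L; linarith

lemma L_pos : 0 < p.L := by linarith [p.L_gt]

lemma abs_u₀ : |p.u₀| = p.L := abs_of_neg (by linarith [p.hu₀])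

lemma ε_pos : 0 < p.ε := div_pos (Real.sqrt_pos.2 p.hδ) p.L_pos

lemma ε_sq : p.ε ^ 2 = p.δ / p.L ^ 2 := by
  rw [ε, div_pow, Real.sq_sqrt p.hδ.le]

lemma sqrt_le_one : Real.sqrt p.δ ≤ 1 := Real.sqrt_le_one.2 p.hδ1

lemma ε_le_one : p.ε ≤ 1 := by
  rw [ε, div_le_one p.L_pos]; linarith [p.L_gt, p.sqrt_le_one]

/-- The entries of the seed. -/
def seed (A B : Fin 2) : Strip → ℝ := fun x => p.S.ψ p.i x.1 x.2 A B

lemma contDiff_seed (A B : Fin 2) : ContDiff ℝ ∞ (p.seed A B) := p.S.smooth p.i A B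

lemma seed_symm (A B : Fin 2) : p.seed A B = p.seed B A := by
  ext x; exact (p.S.symm p.i x.1 x.2).apply B A

lemma seed_one_one : p.seed 1 1 = fun x => - p.seed 0 0 x := by
  ext x
  have := p.S.traceless p.i x.1 x.2
  rw [Matrix.trace_fin_two] at this
  simp only [seed]; linarith

lemma seed_zero (A B : Fin 2) (θ : Fin 2 → ℝ) : p.seed A B (0, θ) = 0 := by
  obtain ⟨a, c, ha, _, h⟩ := p.S.compact_support
  simp [seed, h p.i 0 θ (fun h => by linarith [h.1])]

/-- The conformal class of the induced metric, `exp ψ`. -/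
noncomputable def E (A B : Fin 2) : Strip → ℝ :=
  fun x => expTF (p.ε * p.seed 0 0 x, p.ε * p.seed 0 1 x) A B

lemma E_eq (A B : Fin 2) (x : Strip) : p.E A B x
    = NormedSpace.exp ((Real.sqrt p.δ / |p.u₀|) • p.S.ψ p.i x.1 x.2) A B := by
  have h : (Real.sqrt p.δ / |p.u₀|) • p.S.ψ p.i x.1 x.2
      = !![p.ε * p.seed 0 0 x, p.ε * p.seed 0 1 x; p.ε * p.seed 0 1 x, -(p.ε * p.seed 0 0 x)] := by
    have h1 := congrFun (p.seed_symm 1 0) x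
    have h2 := congrFun p.seed_one_one x
    rw [p.abs_u₀]
    ext A B
    fin_cases A <;> fin_cases B <;> simp [seed, ε]
    · exact Or.inl h1
    · have h3 : p.S.ψ p.i x.1 x.2 1 1 = -p.S.ψ p.i x.1 x.2 0 0 := h2
      rw [h3]; ring
  rw [h]; rfl

lemma contDiff_scaled (A B : Fin 2) : ContDiff ℝ ∞ fun x => p.ε * p.seed A B x :=
  contDiff_const.mul (p.contDiff_seed A B)

lemma contDiff_E (A B : Fin 2) : ContDiff ℝ ∞ (p.E A B) :=
  (contDiff_expTF A B).comp ((p.contDiff_scaled 0 0).prodMk (p.contDiff_scaled 0 1))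

lemma sm_E (A B : Fin 2) : Sm (p.E A B) := Sm.of_contDiff (p.contDiff_E A B)

lemma E_symm (A B : Fin 2) : p.E A B = p.E B A := by
  ext x; exact expTF_symm _ A B

lemma E_det (x : Strip) : p.E 0 0 x * p.E 1 1 x - p.E 0 1 x * p.E 0 1 x = 1 := by
  have := expTF_det (p.ε * p.seed 0 0 x, p.ε * p.seed 0 1 x)
  rw [Matrix.det_fin_two, expTF_symm _ 1 0] at this
  exact this

lemma E_of_seed_eq_zero {x : Strip} (h : ∀ A B, p.seed A B x = 0) (A B : Fin 2) :
    p.E A B x = (1 : Matrix (Fin 2) (Fin 2) ℝ) A B := by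
  simp only [E, h, mul_zero, expTF_zero]

lemma E_zero (A B : Fin 2) (θ : Fin 2 → ℝ) :
    p.E A B (0, θ) = (1 : Matrix (Fin 2) (Fin 2) ℝ) A B :=
  p.E_of_seed_eq_zero (fun A B => p.seed_zero A B θ) A B

/-- The source in the equation for the conformal factor. -/
noncomputable def source : Strip → ℝ := fun x =>
  -(1 / 4) * (dS (p.E 0 0) x * dS (p.E 1 1) x - dS (p.E 0 1) x * dS (p.E 0 1) x)

lemma contDiff_dirD {f : Strip → ℝ} (hf : ContDiff ℝ ∞ f) (v : Strip) : ContDiff ℝ ∞ (dirD v f) :=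
  (hf.fderiv_right (by simp)).clm_apply contDiff_const

lemma contDiff_source : ContDiff ℝ ∞ p.source :=
  contDiff_const.mul ((((contDiff_dirD (p.contDiff_E 0 0) _).mul
    (contDiff_dirD (p.contDiff_E 1 1) _))).sub
    ((contDiff_dirD (p.contDiff_E 0 1) _).mul (contDiff_dirD (p.contDiff_E 0 1) _)))

end PulseData

/-! ### Size of the conformal class and of the source -/

section Bounds

variable {ι : Type*} {P : ι → PulseData} {n : ℕ}

/-- The amplitudes of a family. -/
noncomputable def amp (P : ι → PulseData) : ι → ℝ := fun j => (P j).ε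

lemma Bd.amp_const (n : ℕ) : Bd (amp P) n fun j _ => (P j).ε :=
  Bd.const_fun _ 1 (fun j => by rw [abs_of_pos (P j).ε_pos, one_mul]; rfl) n

lemma Bd.amp_to_one {f : ι → Strip → ℝ} (h : Bd (amp P) n f) : Bd (fun _ => 1) n f :=
  h.weaken 1 fun j => by rw [amp, abs_of_pos (P j).ε_pos, _root_.mul_one]; exact (P j).ε_le_one

variable (hψ : ∀ A B, Bd (fun _ => 1) n fun j => (P j).seed A B)
  (hψs : ∀ A B, Bd (fun _ => 1) n fun j => dS ((P j).seed A B))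

include hψ

lemma bd_scaled (A B : Fin 2) : Bd (fun _ => 1) n fun j x => (P j).ε * (P j).seed A B x :=
  (Bd.amp_const n).amp_to_one.mul_one (hψ A B)

lemma bd_comp {G : ℝ × ℝ → ℝ} (hG : ContDiff ℝ ∞ G) : Bd (fun _ => 1) n fun j x =>
    G ((P j).ε * (P j).seed 0 0 x, (P j).ε * (P j).seed 0 1 x) :=
  Bd.comp_pair hG (bd_scaled hψ 0 0) (bd_scaled hψ 0 1)

include hψs

/-- The argument of `G` is `ε` times the seed, so the derivative in `s` brings out a factor `ε`. -/
lemma bd_dS_comp {G : ℝ × ℝ → ℝ} (hG : ContDiff ℝ ∞ G) : Bd (amp P) n fun j =>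
    dS fun x => G ((P j).ε * (P j).seed 0 0 x, (P j).ε * (P j).seed 0 1 x) := by
  have hd : ∀ v : ℝ × ℝ, ContDiff ℝ ∞ fun z => fderiv ℝ G z v := fun v =>
    (hG.fderiv_right (by simp)).clm_apply contDiff_const
  have hs : ∀ j A B, Sm fun x => (P j).ε * (P j).seed A B x := fun j A B =>
    Sm.of_contDiff ((P j).contDiff_scaled A B)
  have h1 : ∀ A B, Bd (amp P) n fun j x => (P j).ε * dS ((P j).seed A B) x := fun A B => by
    simpa using (Bd.amp_const (P := P) n).mul (hψs A B)
  refine (((bd_comp hψ (hd (1, 0))).mul_one (h1 0 0)).add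
    ((bd_comp hψ (hd (0, 1))).mul_one (h1 0 1))).congr
    (fun j => (Sm.comp_pair hG (hs j 0 0) (hs j 0 1)).dirD _) (fun j x hx => ?_)
  simp only
  rw [dirD_comp_pair hG (hs j 0 0) (hs j 0 1) _ hx,
    dirD_const_mul _ (Sm.of_contDiff ((P j).contDiff_seed 0 0)) _ hx,
    dirD_const_mul _ (Sm.of_contDiff ((P j).contDiff_seed 0 1)) _ hx]

/-- The seed vanishes at `s = 0`, so the difference is the integral of an `s` derivative of size
`ε`. -/
lemma bd_comp_sub {G : ℝ × ℝ → ℝ} (hG : ContDiff ℝ ∞ G) : Bd (amp P) n fun j x =>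
    G ((P j).ε * (P j).seed 0 0 x, (P j).ε * (P j).seed 0 1 x) - G (0, 0) := by
  have hs : ∀ j, Sm fun x => G ((P j).ε * (P j).seed 0 0 x, (P j).ε * (P j).seed 0 1 x) :=
    fun j => Sm.comp_pair hG (Sm.of_contDiff ((P j).contDiff_scaled 0 0))
      (Sm.of_contDiff ((P j).contDiff_scaled 0 1))
  refine Bd.integrate (fun j => (hs j).sub (Sm.const _))
    (fun j θ => by simp [(P j).seed_zero]) ?_
  refine (bd_dS_comp hψ hψs hG).congr (fun j => ((hs j).sub (Sm.const _)).dirD _)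
    (fun j x hx => ?_)
  rw [dirD_sub _ (hs j) (Sm.const _) hx, dirD_const, sub_zero]

omit hψs in
lemma bd_E (A B : Fin 2) : Bd (fun _ => 1) n fun j => (P j).E A B :=
  bd_comp hψ (contDiff_expTF A B)

lemma bd_dS_E (A B : Fin 2) : Bd (amp P) n fun j => dS ((P j).E A B) :=
  bd_dS_comp hψ hψs (contDiff_expTF A B)

/-- The differential of the exponential at `ε ψ₀` differs from that at zero, the identity, by
`O(ε)`, and it multiplies `ε ∂_s ψ₀`. -/
lemma bd_dS_E_sub (A B : Fin 2) : Bd (fun j => amp P j * amp P j) n fun j x =>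
    dS ((P j).E A B) x - (P j).ε * dS ((P j).seed A B) x := by
  have hG := contDiff_expTF A B
  have hd : ∀ v : ℝ × ℝ, ContDiff ℝ ∞ fun z => fderiv ℝ (fun z => expTF z A B) z v := fun v =>
    (hG.fderiv_right (by simp)).clm_apply contDiff_const
  have hs : ∀ j A B, Sm fun x => (P j).ε * (P j).seed A B x := fun j A B =>
    Sm.of_contDiff ((P j).contDiff_scaled A B)
  have h1 : ∀ A B, Bd (amp P) n fun j x => (P j).ε * dS ((P j).seed A B) x := fun A B => by
    simpa using (Bd.amp_const (P := P) n).mul (hψs A B)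
  refine (((bd_comp_sub hψ hψs (hd (1, 0))).mul (h1 0 0)).add
    ((bd_comp_sub hψ hψs (hd (0, 1))).mul (h1 0 1))).congr
    (fun j => (((P j).sm_E A B).dirD _).sub ((Sm.const _).mul
      ((Sm.of_contDiff ((P j).contDiff_seed A B)).dirD _))) (fun j x hx => ?_)
  simp only
  have e : dS ((P j).E A B) x = _ := dirD_comp_pair hG (hs j 0 0) (hs j 0 1) vS hx
  rw [e, dirD_const_mul _ (Sm.of_contDiff ((P j).contDiff_seed 0 0)) _ hx,
    dirD_const_mul _ (Sm.of_contDiff ((P j).contDiff_seed 0 1)) _ hx,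
    fderiv_expTF_zero, fderiv_expTF_zero]
  have h2 : dS ((P j).seed 1 1) x = - dS ((P j).seed 0 0) x := by
    rw [(P j).seed_one_one, dirD_neg]
  fin_cases A <;> fin_cases B <;> simp [h2, (P j).seed_symm 1 0] <;> ring

lemma bd_source : Bd (fun j => amp P j * amp P j) n fun j => (P j).source :=
  (((bd_dS_E hψ hψs 0 0).mul (bd_dS_E hψ hψs 1 1)).sub
    ((bd_dS_E hψ hψs 0 1).mul (bd_dS_E hψ hψs 0 1))).const_mul _

/-- To leading order the source is the energy density of the seed. -/
lemma bd_source_sub : Bd (fun j => amp P j * (amp P j * amp P j)) n fun j x => (P j).source x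
    - (1 / 8) * (P j).ε ^ 2 * ∑ A, ∑ B, dS ((P j).seed A B) x ^ 2 := by
  have h1 : ∀ A B, Bd (amp P) n fun j x => (P j).ε * dS ((P j).seed A B) x := fun A B => by
    simpa using (Bd.amp_const (P := P) n).mul (hψs A B)
  have hr := bd_dS_E_sub hψ hψs
  have he := bd_dS_E hψ hψs
  -- Each product of derivatives of `E` minus its leading part telescopes into a factor of size `ε`
  -- times a remainder of size `ε²`. For trace-free symmetric matrices `-2 det` is the squared
  -- length, which turns the coefficient `1/4` into `1/8`.
  have h := (((((he 1 1).mul (hr 0 0)).add ((h1 0 0).mul (hr 1 1))).sub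
    (((he 0 1).mul (hr 0 1)).add ((h1 0 1).mul (hr 0 1)))).const_mul (-(1 / 4)))
  refine h.congr (fun j => (Sm.of_contDiff (P j).contDiff_source).sub
    ((Sm.const _).mul (Sm.sum fun A _ => Sm.sum fun B _ =>
      ((Sm.of_contDiff ((P j).contDiff_seed A B)).dirD _).pow 2))) (fun j x hx => ?_)
  have h2 : dS ((P j).seed 1 1) x = - dS ((P j).seed 0 0) x := by
    rw [(P j).seed_one_one, dirD_neg]
  simp only [Fin.sum_univ_two, PulseData.source, h2, (P j).seed_symm 1 0]
  ring

end Bounds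


/-! ### The conformal factor of the induced metric and the Raychaudhuri equation -/

/-- The round conformal factor as a function on the strip. -/
noncomputable def rf : Strip → ℝ := fun x => roundFactor x.2

lemma rf_pos (x : Strip) : 0 < rf x := by unfold rf roundFactor eucSq; positivity

lemma contDiff_rf : ContDiff ℝ ∞ rf := by
  unfold rf roundFactor eucSq
  refine ContDiff.inv (by fun_prop) fun x => ?_
  positivity

lemma sm_rf : Sm rf := Sm.of_contDiff contDiff_rf

lemma dS_rf {x : Strip} (hx : x ∈ strip) : dS rf x = 0 :=
  (sm_rf.hasDerivAt (θ := x.2) (mem_strip.1 hx)).unique (hasDerivAt_const x.1 (rf x))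

/-- For a symmetric matrix `E` of determinant one the adjugate is the inverse. The three traces with
`E⁻¹` are `tr E⁻¹E = 2`, `tr E⁻¹E' = 0` and `tr E⁻¹E'' = -2 det E'`. -/
lemma second_trace (e f g e' f' g' e'' f'' g'' a b c : ℝ) (d0 : e * g - f * f = 1)
    (d1 : e' * g + e * g' - 2 * f * f' = 0)
    (d2 : e'' * g + e * g'' - 2 * f * f'' = -2 * (e' * g' - f' ^ 2)) :
    g * (a * e + b * e' + c * e'') - 2 * f * (a * f + b * f' + c * f'')
      + e * (a * g + b * g' + c * g'') = 2 * a - 2 * c * (e' * g' - f' ^ 2) := by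
  linear_combination (2 * a) * d0 + b * d1 + c * d2

/-- The squared length of `a E + b E'` with respect to `E`: the mixed term is `tr E⁻¹E' = 0`, and
`tr (E⁻¹E')² = -2 det E'`. -/
lemma square_trace (e f g e' f' g' a b : ℝ) (d0 : e * g - f * f = 1)
    (d1 : e' * g + e * g' - 2 * f * f' = 0) :
    g * (g * ((a * e + b * e') * (a * e + b * e')) - 2 * f * ((a * e + b * e') * (a * f + b * f'))
        + e * ((a * f + b * f') * (a * f + b * f')))
      - 2 * f * (g * ((a * e + b * e') * (a * f + b * f'))
        - f * ((a * e + b * e') * (a * g + b * g') + (a * f + b * f') * (a * f + b * f'))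
        + e * ((a * f + b * f') * (a * g + b * g')))
      + e * (g * ((a * f + b * f') * (a * f + b * f')) - 2 * f * ((a * f + b * f') * (a * g + b * g'))
        + e * ((a * g + b * g') * (a * g + b * g')))
      = 2 * a ^ 2 - 2 * b ^ 2 * (e' * g' - f' ^ 2) := by
  linear_combination (2 * a ^ 2 * (e * g - f * f + 1) - 2 * b ^ 2 * (e' * g' - f' ^ 2)) * d0
    + (2 * a * b * (e * g - f * f) + b ^ 2 * (e' * g + e * g' - 2 * f * f')) * d1

namespace PulseData

variable (p : PulseData)

/-- The components of the induced metric. -/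
def gm (A B : Fin 2) : Strip → ℝ := p.pull fun y => p.M.gs y A B

lemma contDiff_gm (A B : Fin 2) : ContDiff ℝ ∞ (p.gm A B) := p.contDiff_pull (p.smooth.gs A B)

lemma sm_gm (A B : Fin 2) : Sm (p.gm A B) := Sm.of_contDiff (p.contDiff_gm A B)

/-- The conformal factor `φ` of the short pulse ansatz. -/
noncomputable def φ : Strip → ℝ := fun x =>
  Real.sqrt (Real.sqrt (p.gm 0 0 x * p.gm 1 1 x - p.gm 0 1 x * p.gm 1 0 x))
    * (p.L⁻¹ * (1 + eucSq x.2 / 4))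

lemma sm_φ : Sm p.φ := by
  have hdet : ∀ x ∈ strip, 0 < p.gm 0 0 x * p.gm 1 1 x - p.gm 0 1 x * p.gm 1 0 x := fun x hx => by
    have := (p.D.gs_posDef p.i _ (p.pos_mem hx)).det_pos
    rwa [Matrix.det_fin_two] at this
  have h1 : Sm fun x => p.gm 0 0 x * p.gm 1 1 x - p.gm 0 1 x * p.gm 1 0 x :=
    ((p.sm_gm 0 0).mul (p.sm_gm 1 1)).sub ((p.sm_gm 0 1).mul (p.sm_gm 1 0))
  have h2 := (h1.sqrt fun x hx => (hdet x hx).ne').sqrt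
    fun x hx => (Real.sqrt_pos.2 (hdet x hx)).ne'
  exact h2.mul (Sm.of_contDiff (by unfold eucSq; fun_prop))

/-- The ansatz supplies a positive factor point by point. As `det E = 1`, the determinant of the
metric is its fourth power times `(L r)⁴`, so it equals the explicit fourth root `φ`, whose
smoothness is clear. -/
lemma φ_spec {x : Strip} (hx : x ∈ strip) :
    0 < p.φ x ∧ ∀ A B, p.gm A B x = p.L ^ 2 * (p.φ x ^ 2 * rf x ^ 2 * p.E A B x) := by
  obtain ⟨h0, h1⟩ := mem_strip.1 hx
  have hδ := p.hδ
  obtain ⟨f, hf, h⟩ := p.pulse p.i (p.δ * x.1) ⟨by positivity, by nlinarith⟩ x.2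
  have hs : p.δ * x.1 / p.δ = x.1 := by field_simp
  rw [hs, p.abs_u₀] at h
  have hg : ∀ A B, p.gm A B x = (f ^ 2 * (p.L * rf x) ^ 2) * p.E A B x := fun A B => by
    rw [p.E_eq, p.abs_u₀]
    exact congrFun (congrFun h A) B
  have hE := p.E_det x
  have hL := p.L_pos
  have hr := rf_pos x
  have hphi : p.φ x = f := by
    have e1 : p.gm 0 0 x * p.gm 1 1 x - p.gm 0 1 x * p.gm 1 0 x = ((f * (p.L * rf x)) ^ 2) ^ 2 := by
      rw [hg, hg, hg, hg, p.E_symm 1 0]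
      linear_combination (f ^ 2 * (p.L * rf x) ^ 2) ^ 2 * hE
    rw [φ, e1, Real.sqrt_sq (by positivity), Real.sqrt_sq (by positivity)]
    have e2 : 1 + eucSq x.2 / 4 = (rf x)⁻¹ := by simp [rf, roundFactor]
    rw [e2]; field_simp
  rw [hphi]
  exact ⟨hf, fun A B => by rw [hg]; ring⟩

lemma φ_pos {x : Strip} (hx : x ∈ strip) : 0 < p.φ x := (p.φ_spec hx).1

/-- The induced metric of the spheres, rescaled to unit size. -/
noncomputable def gh (A B : Fin 2) : Strip → ℝ := fun x => p.φ x * p.φ x * (rf x * rf x) * p.E A B x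

/-- The inverse of a matrix of determinant one. -/
noncomputable def Ei (A B : Fin 2) : Strip → ℝ := fun x =>
  !![p.E 1 1 x, -p.E 0 1 x; -p.E 0 1 x, p.E 0 0 x] A B

/-- The inverse of the rescaled metric. -/
noncomputable def gi (A B : Fin 2) : Strip → ℝ := fun x =>
  (p.φ x * p.φ x * (rf x * rf x))⁻¹ * p.Ei A B x

lemma sm_Ei (A B : Fin 2) : Sm (p.Ei A B) := by
  have := p.sm_E
  fin_cases A <;> fin_cases B <;> simp only [Ei] <;> simp <;> first | exact this _ _ | exact (this _ _).neg

lemma sm_area : Sm fun x => p.φ x * p.φ x * (rf x * rf x) :=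
  (p.sm_φ.mul p.sm_φ).mul (sm_rf.mul sm_rf)

lemma area_pos {x : Strip} (hx : x ∈ strip) : 0 < p.φ x * p.φ x * (rf x * rf x) := by
  have := p.φ_pos hx; have := rf_pos x; positivity

lemma sm_gh (A B : Fin 2) : Sm (p.gh A B) := p.sm_area.mul (p.sm_E A B)

lemma gm_eq (A B : Fin 2) : EqOn (p.gm A B) (fun x => p.L ^ 2 * p.gh A B x) strip := fun x hx => by
  rw [(p.φ_spec hx).2]; simp only [gh]; ring

lemma dirD_gm (v : Strip) (A B : Fin 2) :
    EqOn (dirD v (p.gm A B)) (fun x => p.L ^ 2 * dirD v (p.gh A B) x) strip := fun x hx => by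
  rw [(p.sm_gm A B).dirD_congr ((Sm.const _).mul (p.sm_gh A B)) (p.gm_eq A B) v hx,
    dirD_const_mul _ (p.sm_gh A B) _ hx]

lemma dirD_dirD_gm (v w : Strip) (A B : Fin 2) : EqOn (dirD v (dirD w (p.gm A B)))
    (fun x => p.L ^ 2 * dirD v (dirD w (p.gh A B)) x) strip := fun x hx => by
  rw [((p.sm_gm A B).dirD w).dirD_congr ((Sm.const _).mul ((p.sm_gh A B).dirD w))
    (p.dirD_gm w A B) v hx, dirD_const_mul _ ((p.sm_gh A B).dirD w) _ hx]

lemma inv_gs (A B : Fin 2) {x : Strip} (hx : x ∈ strip) :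
    (p.M.gs (p.pos x))⁻¹ A B = (p.L ^ 2)⁻¹ * p.gi A B x := by
  have hg : ∀ A B, p.M.gs (p.pos x) A B = p.L ^ 2 * p.gh A B x := fun A B => p.gm_eq A B hx
  have hd := p.E_det x
  have ha := p.area_pos hx
  have hL := p.L_pos
  have : (p.M.gs (p.pos x))⁻¹ = Matrix.of fun A B => (p.L ^ 2)⁻¹ * p.gi A B x := by
    refine Matrix.inv_eq_right_inv ?_
    have e : (p.φ x * p.φ x * (rf x * rf x)) * (p.φ x * p.φ x * (rf x * rf x))⁻¹ = 1 :=
      mul_inv_cancel₀ ha.ne'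
    have e' : p.L ^ 2 * (p.L ^ 2)⁻¹ = 1 := mul_inv_cancel₀ (by positivity)
    ext A B
    rw [Matrix.mul_apply, Fin.sum_univ_two, hg, hg]
    simp only [gi, gh, Matrix.of_apply]
    set a := p.φ x * p.φ x * (rf x * rf x)
    have key : ∀ X Y Z W : ℝ, p.L ^ 2 * (a * X) * ((p.L ^ 2)⁻¹ * (a⁻¹ * Y))
        + p.L ^ 2 * (a * Z) * ((p.L ^ 2)⁻¹ * (a⁻¹ * W)) = X * Y + Z * W := by
      intro X Y Z W
      linear_combination (X * Y + Z * W) * (a * a⁻¹) * e' + (X * Y + Z * W) * e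
    rw [key]
    fin_cases A <;> fin_cases B <;> simp [Ei, p.E_symm 1 0] <;> linarith
  exact congrFun (congrFun this A) B

section Equations

/-! ### Derivatives of the determinant constraint -/

variable {x : Strip} (hx : x ∈ strip)

include hx

lemma dirD_E_det (v : Strip) : dirD v (p.E 0 0) x * p.E 1 1 x + p.E 0 0 x * dirD v (p.E 1 1) x
    - 2 * p.E 0 1 x * dirD v (p.E 0 1) x = 0 := by
  have h1 : EqOn (fun x => p.E 0 0 x * p.E 1 1 x - p.E 0 1 x * p.E 0 1 x) (fun _ => 1) strip :=
    fun x _ => p.E_det x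
  have h2 := (((p.sm_E 0 0).mul (p.sm_E 1 1)).sub ((p.sm_E 0 1).mul (p.sm_E 0 1))).dirD_congr
    (Sm.const 1) h1 v hx
  rw [dirD_sub _ ((p.sm_E 0 0).mul (p.sm_E 1 1)) ((p.sm_E 0 1).mul (p.sm_E 0 1)) hx,
    dirD_mul _ (p.sm_E 0 0) (p.sm_E 1 1) hx, dirD_mul _ (p.sm_E 0 1) (p.sm_E 0 1) hx,
    dirD_const] at h2
  linarith

/-- Differentiating `det E = 1` twice turns the trace of `E''` into a quadratic expression in `E'`,
so no second derivative of the seed enters the equation for `φ`. -/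
lemma dS_dS_E_det : dS (dS (p.E 0 0)) x * p.E 1 1 x + p.E 0 0 x * dS (dS (p.E 1 1)) x
    - 2 * p.E 0 1 x * dS (dS (p.E 0 1)) x = 8 * p.source x := by
  have s := p.sm_E
  have d := fun A B => (s A B).dirD vS
  have h1 : EqOn (fun x => dS (p.E 0 0) x * p.E 1 1 x + p.E 0 0 x * dS (p.E 1 1) x
    - 2 * (p.E 0 1 x * dS (p.E 0 1) x)) (fun _ => 0) strip := fun x hx => by
      have := p.dirD_E_det hx vS
      simp only; linarith
  have a1 := (d 0 0).mul (s 1 1)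
  have a2 := (s 0 0).mul (d 1 1)
  have a3 := (s 0 1).mul (d 0 1)
  have h2 := ((a1.add a2).sub ((Sm.const 2).mul a3)).dirD_congr (Sm.const 0) h1 vS hx
  rw [dirD_sub _ (a1.add a2) ((Sm.const 2).mul a3) hx, dirD_add _ a1 a2 hx,
    dirD_mul _ (d 0 0) (s 1 1) hx, dirD_mul _ (s 0 0) (d 1 1) hx, dirD_const_mul _ a3 _ hx,
    dirD_mul _ (s 0 1) (d 0 1) hx, dirD_const] at h2
  unfold source
  linarith

lemma dS_gh (A B : Fin 2) : dS (p.gh A B) x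
    = rf x ^ 2 * (2 * p.φ x * dS p.φ x * p.E A B x + p.φ x ^ 2 * dS (p.E A B) x) := by
  have e := dS_rf hx
  unfold gh
  rw [dirD_mul _ p.sm_area (p.sm_E A B) hx, dirD_mul _ (p.sm_φ.mul p.sm_φ) (sm_rf.mul sm_rf) hx,
    dirD_mul _ p.sm_φ p.sm_φ hx, dirD_mul _ sm_rf sm_rf hx, e]
  ring

omit hx in
lemma dS_dS_gh (hx : x ∈ strip) (A B : Fin 2) : dS (dS (p.gh A B)) x
    = rf x ^ 2 * ((2 * dS p.φ x ^ 2 + 2 * p.φ x * dS (dS p.φ) x) * p.E A B x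
      + 4 * p.φ x * dS p.φ x * dS (p.E A B) x + p.φ x ^ 2 * dS (dS (p.E A B)) x) := by
  have e := dS_rf hx
  have s := p.sm_φ
  have s1 := s.dirD vS
  have t := p.sm_E A B
  have t1 := t.dirD vS
  have r2 := sm_rf.mul sm_rf
  have a1 := ((Sm.const 2).mul (s.mul s1)).mul t
  have a2 := (s.mul s).mul t1
  have h1 : EqOn (dS (p.gh A B)) (fun x => (rf x * rf x) * (2 * (p.φ x * dS p.φ x) * p.E A B x
      + p.φ x * p.φ x * dS (p.E A B) x)) strip := fun y hy => by
    rw [p.dS_gh hy]; ring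
  rw [((p.sm_gh A B).dirD vS).dirD_congr (r2.mul (a1.add a2)) h1 vS hx,
    dirD_mul _ r2 (a1.add a2) hx, dirD_mul _ sm_rf sm_rf hx, e, dirD_add _ a1 a2 hx,
    dirD_mul _ ((Sm.const 2).mul (s.mul s1)) t hx, dirD_const_mul _ (s.mul s1) _ hx,
    dirD_mul _ s s1 hx, dirD_mul _ (s.mul s) t1 hx, dirD_mul _ s s hx]
  ring

/-- `∂_u̲ gs` in terms of the rescaled metric -/
lemma pd_gs_zero (A B : Fin 2) : pd (fun y => p.M.gs y A B) 0 (p.pos x)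
    = p.δ⁻¹ * (p.L ^ 2 * dS (p.gh A B) x) := by
  have h1 := congrFun (p.pull_pd_zero (p.smooth.gs A B)) x
  have h2 := p.dirD_gm vS A B hx
  rw [gm] at h2
  rw [h2] at h1
  exact h1

lemma pd_gs_sph (A B C : Fin 2) : pd (fun y => p.M.gs y A B) (sph C) (p.pos x)
    = p.L ^ 2 * dT C (p.gh A B) x := by
  have h1 := congrFun (p.pull_pd_sph (p.smooth.gs A B) C) x
  have h2 := p.dirD_gm (vT C) A B hx
  rw [gm] at h2
  rw [h2] at h1
  exact h1

lemma pd_pd_gs_zero_zero (A B : Fin 2) : pd (pd (fun y => p.M.gs y A B) 0) 0 (p.pos x)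
    = (p.δ ^ 2)⁻¹ * (p.L ^ 2 * dS (dS (p.gh A B)) x) := by
  have h1 := congrFun (p.pull_pd_zero (contDiff_pd (p.smooth.gs A B) 0)) x
  rw [p.pull_pd_zero (p.smooth.gs A B), dirD_const_mul vS
    (f := dS (p.pull fun x => p.M.gs x A B)) ((p.sm_gm A B).dirD vS) _ hx] at h1
  refine h1.trans ?_
  have := p.dirD_dirD_gm vS vS A B hx
  rw [gm] at this
  change p.δ⁻¹ * (p.δ⁻¹ * dS (dS (p.pull fun y => p.M.gs y A B)) x) = _
  rw [this]; ring

lemma pd_pd_gs_sph_zero (A B C : Fin 2) : pd (pd (fun y => p.M.gs y A B) (sph C)) 0 (p.pos x)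
    = p.δ⁻¹ * (p.L ^ 2 * dS (dT C (p.gh A B)) x) := by
  have h1 := congrFun (p.pull_pd_zero (contDiff_pd (p.smooth.gs A B) (sph C))) x
  rw [p.pull_pd_sph (p.smooth.gs A B)] at h1
  refine h1.trans ?_
  have := p.dirD_dirD_gm vS (vT C) A B hx
  rw [gm] at this
  change p.δ⁻¹ * dS (dT C (p.pull fun y => p.M.gs y A B)) x = _
  rw [this]

lemma pd_pd_gs_sph_sph (A B C D : Fin 2) :
    pd (pd (fun y => p.M.gs y A B) (sph C)) (sph D) (p.pos x)
      = p.L ^ 2 * dT D (dT C (p.gh A B)) x := by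
  have h1 := congrFun (p.pull_pd_sph (contDiff_pd (p.smooth.gs A B) (sph C)) D) x
  rw [p.pull_pd_sph (p.smooth.gs A B)] at h1
  refine h1.trans ?_
  have := p.dirD_dirD_gm (vT D) (vT C) A B hx
  rw [gm] at this
  exact this

/-- The Raychaudhuri equation for the conformal factor. -/
lemma φ_ode : dS (dS p.φ) x = - p.source x * p.φ x := by
  have h := (p.adapted hx).trace_alpha (p.vacuum hx)
  simp only [(p.adapted hx).curv_sph_zero_sph_zero, p.inv_gs _ _ hx, p.pd_gs_zero hx,
    p.pd_pd_gs_zero_zero hx, p.dS_gh hx, p.dS_dS_gh hx, gi] at h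
  have d0 := p.E_det x
  have d1 := p.dirD_E_det hx vS
  have d2 := p.dS_dS_E_det hx
  have hφ := p.φ_pos hx
  have hr := rf_pos x
  have hL := p.L_pos
  have hδ := p.hδ
  have hm : (p.L ^ 2)⁻¹ * p.L ^ 2 = 1 := inv_mul_cancel₀ (by positivity)
  have hk : (p.φ x * p.φ x * (rf x * rf x))⁻¹ * (p.φ x * p.φ x * (rf x * rf x)) = 1 :=
    inv_mul_cancel₀ (by positivity)
  have hd : (p.δ ^ 2)⁻¹ = p.δ⁻¹ ^ 2 := by rw [inv_pow]
  have hd0 : p.δ⁻¹ ≠ 0 := inv_ne_zero hδ.ne'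
  rw [hd] at h
  have e00 : p.Ei 0 0 x = p.E 1 1 x := rfl
  have e01 : p.Ei 0 1 x = -p.E 0 1 x := rfl
  have e10 : p.Ei 1 0 x = -p.E 0 1 x := rfl
  have e11 : p.Ei 1 1 x = p.E 0 0 x := rfl
  simp only [Fin.sum_univ_two, e00, e01, e10, e11, p.E_symm 1 0] at h
  unfold source at d2 ⊢
  generalize p.E 0 0 x = e at *
  generalize p.E 0 1 x = f at *
  generalize p.E 1 1 x = g at *
  generalize dS (p.E 0 0) x = e' at *
  generalize dS (p.E 0 1) x = f' at *
  generalize dS (p.E 1 1) x = g' at *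
  generalize dS (dS (p.E 0 0)) x = e'' at *
  generalize dS (dS (p.E 0 1)) x = f'' at *
  generalize dS (dS (p.E 1 1)) x = g'' at *
  generalize (p.φ x * p.φ x * (rf x * rf x))⁻¹ = k at *
  generalize (p.L ^ 2)⁻¹ = m at *
  generalize p.δ⁻¹ = d at *
  generalize dS (dS p.φ) x = u'' at *
  generalize dS p.φ x = u' at *
  generalize p.φ x = u at *
  generalize rf x = r at *
  generalize p.L = l at *
  have hS := second_trace e f g e' f' g' e'' f'' g'' (2 * u' ^ 2 + 2 * u * u'') (4 * u * u') (u ^ 2)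
    d0 d1 (by linarith)
  have hT := square_trace e f g e' f' g' (2 * u * u') (u ^ 2) d0 d1
  -- After multiplication by `u⁴` the two inverses `m` and `k` occur only in the products `m l²` and
  -- `k u² r²`, both equal to one.
  have h1 : (m * l ^ 2) * (k * (u * u * (r * r))) * (-(1 / 2) * d ^ 2) * u ^ 2
        * (2 * (2 * u' ^ 2 + 2 * u * u'') - 2 * u ^ 2 * (e' * g' - f' ^ 2))
      + (1 / 4) * (m * l ^ 2) ^ 2 * (k * (u * u * (r * r))) ^ 2 * d ^ 2
        * (2 * (2 * u * u') ^ 2 - 2 * (u ^ 2) ^ 2 * (e' * g' - f' ^ 2)) = 0 := by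
    rw [← hS, ← hT]
    linear_combination u ^ 4 * h
  rw [hm, hk] at h1
  have h2 : d ^ 2 * (2 * u ^ 3) * (-(-(1 / 4) * (e' * g' - f' * f')) * u - u'') = 0 := by
    linear_combination h1
  have h3 : d ^ 2 * (2 * u ^ 3) ≠ 0 := by positivity
  linarith [(mul_eq_zero.1 h2).resolve_left h3]

end Equations

end PulseData


/-! ### Initial values of the conformal factor and transport of the torsion -/

namespace PulseData

variable (p : PulseData)

lemma mem_strip_zero (θ : Fin 2 → ℝ) : ((0 : ℝ), θ) ∈ strip := mem_strip.2 (by simp)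

lemma mem_strip_one (θ : Fin 2 → ℝ) : ((1 : ℝ), θ) ∈ strip := mem_strip.2 (by simp)

lemma φ_init (θ : Fin 2 → ℝ) : p.φ (0, θ) = 1 := by
  have hx := mem_strip_zero θ
  obtain ⟨h0, h1⟩ := p.φ_spec hx
  have h2 := h1 0 0
  rw [p.E_zero, gm, p.gs_init] at h2
  have hr := rf_pos (0, θ)
  have hL := p.L_pos
  have hL2 : p.u₀ = -p.L := by simp [L]
  rw [hL2, show roundFactor θ = rf (0, θ) from rfl] at h2
  simp only [Matrix.one_apply_eq, mul_one] at h2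
  have h3 : p.L ^ 2 * rf (0, θ) ^ 2 * (p.φ (0, θ) ^ 2 - 1) = 0 := by linear_combination -h2
  have h4 := (mul_eq_zero.1 h3).resolve_left (by positivity)
  nlinarith

/-- Where `E` is the identity its derivative is trace-free, so adding the two diagonal components of
the metric isolates the derivative of `φ`. -/
lemma dS_φ_init (θ : Fin 2 → ℝ) : dS p.φ (0, θ) = p.δ / p.L := by
  have hx := mem_strip_zero θ
  have h1 := p.dirD_gm vS 0 0 hx
  have h2 := p.dirD_gm vS 1 1 hx
  have h3 := p.dirD_E_det hx vS
  rw [gm, p.dS_gs_init] at h1 h2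
  simp only [p.dS_gh hx, p.φ_init, p.E_zero] at h1 h2 h3
  have hr := rf_pos (0, θ)
  have hL := p.L_pos
  have hL2 : p.u₀ = -p.L := by simp [L]
  rw [hL2, show roundFactor θ = rf (0, θ) from rfl] at h1 h2
  simp at h1 h2 h3
  have h4 : (4 * p.L * rf (0, θ) ^ 2) * (p.L * dS p.φ (0, θ) - p.δ) = 0 := by
    linear_combination -h1 - h2 - p.L ^ 2 * rf (0, θ) ^ 2 * h3
  have h5 := (mul_eq_zero.1 h4).resolve_left (by positivity)
  field_simp
  linarith

/-- The logarithmic derivative of the conformal factor. -/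
noncomputable def T : Strip → ℝ := fun x => dS p.φ x * (p.φ x)⁻¹

lemma sm_T : Sm p.T := (p.sm_φ.dirD _).mul (p.sm_φ.inv fun _ hx => (p.φ_pos hx).ne')

/-- The torsion on the initial cone. -/
noncomputable def tw (A : Fin 2) : Strip → ℝ := p.pull (p.M.twist A)

lemma sm_tw (A : Fin 2) : Sm (p.tw A) := p.sm_pull (p.smooth.twist A)

/-- The Christoffel symbols of the first kind of the rescaled metric. -/
noncomputable def Fh (C A B : Fin 2) : Strip → ℝ := fun x =>
  (1 / 2) * (dT A (p.gh B C) x + dT B (p.gh A C) x - dT C (p.gh A B) x)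

/-- The source in the transport equation for the torsion. -/
noncomputable def J (A : Fin 2) : Strip → ℝ := fun x =>
  4 * ∑ B, ∑ C, p.gi B C x * ((1 / 2) * (dS (dT C (p.gh B A)) x - dS (dT A (p.gh B C)) x)
    - (1 / 2) * ∑ D, ∑ E, p.gi D E x * (p.Fh D B C x * dS (p.gh E A) x
      - dS (p.gh D C) x * p.Fh E B A x))

/-- The `∂_u` derivative of the induced metric. -/
noncomputable def yy (A B : Fin 2) : Strip → ℝ := p.pull (pd (fun y => p.M.gs y A B) 1)

lemma sm_yy (A B : Fin 2) : Sm (p.yy A B) := p.sm_pull (contDiff_pd (p.smooth.gs A B) 1)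

/-- The area density times the incoming expansion, up to a constant. -/
noncomputable def Sy : Strip → ℝ := fun x => ∑ A, ∑ B, p.Ei A B x * p.yy A B x

lemma sm_Sy : Sm p.Sy := Sm.sum fun A _ => Sm.sum fun B _ => (p.sm_Ei A B).mul (p.sm_yy A B)

/-- The curvature of the rescaled metric. -/
noncomputable def curvS (C A D B : Fin 2) : Strip → ℝ := fun x =>
  (1 / 2) * (dT D (dT A (p.gh B C)) x - dT D (dT C (p.gh B A)) x
    - dT B (dT A (p.gh D C)) x + dT B (dT C (p.gh D A)) x)
  - ∑ E, ∑ F, p.gi E F x * (p.Fh E D C x * p.Fh F B A x - p.Fh E B C x * p.Fh F D A x)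

/-- The scalar curvature of the rescaled metric. -/
noncomputable def scal : Strip → ℝ := fun x =>
  ∑ A, ∑ B, ∑ C, ∑ D, p.gi A B x * p.gi C D x * p.curvS D B C A x

/-- The divergence of the torsion with respect to the rescaled metric. -/
noncomputable def divT : Strip → ℝ := fun x => ∑ A, ∑ B, p.gi A B x * (dT B (p.tw A) x
  - ∑ C, ∑ D, p.gi C D x * (p.tw C x * p.Fh D A B x))

/-- The squared length of the torsion with respect to the rescaled metric. -/
noncomputable def sqT : Strip → ℝ := fun x => ∑ A, ∑ B, p.gi A B x * (p.tw B x * p.tw A x)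

section Equations

variable {x : Strip} (hx : x ∈ strip)

include hx

lemma gi_eq (A B : Fin 2) : p.gi A B x = (p.φ x * p.φ x * (rf x * rf x))⁻¹ * p.Ei A B x := rfl

lemma dS_gh' (A B : Fin 2) : dS (p.gh A B) x
    = p.φ x * p.φ x * (rf x * rf x) * (2 * p.T x * p.E A B x + dS (p.E A B) x) := by
  have := (p.φ_pos hx).ne'
  rw [p.dS_gh hx]; unfold T; field_simp

lemma trace_dS_gh : ∑ A, ∑ B, p.gi A B x * dS (p.gh A B) x = 4 * p.T x := by
  have d0 := p.E_det x
  have d1 := p.dirD_E_det hx vS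
  have ha := (p.area_pos hx).ne'
  have e00 : p.Ei 0 0 x = p.E 1 1 x := rfl
  have e01 : p.Ei 0 1 x = -p.E 0 1 x := rfl
  have e10 : p.Ei 1 0 x = -p.E 0 1 x := rfl
  have e11 : p.Ei 1 1 x = p.E 0 0 x := rfl
  simp only [p.dS_gh' hx, p.gi_eq hx, Fin.sum_univ_two, e00, e01, e10, e11, p.E_symm 1 0]
  have hk := inv_mul_cancel₀ ha
  generalize (p.φ x * p.φ x * (rf x * rf x))⁻¹ = k at *
  generalize p.φ x * p.φ x * (rf x * rf x) = a at *
  linear_combination (4 * p.T x) * k * a * d0 + k * a * d1 + 4 * p.T x * hk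

lemma trchi_eq : p.M.trchi (p.pos x) = 2 / p.δ * p.T x := by
  rw [(p.adapted hx).trchi_eq]
  have h := p.trace_dS_gh hx
  have hL := p.L_pos
  simp only [p.inv_gs _ _ hx, p.pd_gs_zero hx]
  have hm : (p.L ^ 2)⁻¹ * p.L ^ 2 = 1 := inv_mul_cancel₀ (by positivity)
  simp only [Fin.sum_univ_two] at h ⊢
  have hd : 2 / p.δ * p.T x = 2 * p.δ⁻¹ * p.T x := by ring
  rw [hd]
  generalize (p.L ^ 2)⁻¹ = m at *
  generalize p.δ⁻¹ = d at *
  linear_combination (1 / 2) * d * m * p.L ^ 2 * h + 2 * d * p.T x * hm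

lemma sphereLow_eq (C A B : Fin 2) : p.M.sphereLow (p.pos x) C A B = p.L ^ 2 * p.Fh C A B x := by
  simp only [DoubleNull.sphereLow, p.pd_gs_sph hx, Fh]; ring

lemma pd_twist_zero (A : Fin 2) : pd (p.M.twist A) 0 (p.pos x) = p.δ⁻¹ * dS (p.tw A) x :=
  congrFun (p.pull_pd_zero (p.smooth.twist A)) x

lemma pd_twist_sph (A B : Fin 2) : pd (p.M.twist A) (sph B) (p.pos x) = dT B (p.tw A) x :=
  congrFun (p.pull_pd_sph (p.smooth.twist A) B) x

lemma twist_eq (A : Fin 2) : p.M.twist A (p.pos x) = p.tw A x := rfl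

lemma pd_gs_one (A B : Fin 2) : pd (fun y => p.M.gs y A B) 1 (p.pos x) = p.yy A B x := rfl

lemma yy_symm (A B : Fin 2) : p.yy A B x = p.yy B A x := (p.adapted hx).pd_gs_symm A B 1

lemma gh_symm (A B : Fin 2) : p.gh A B = p.gh B A := by
  unfold gh; rw [p.E_symm A B]

lemma curv_codazzi (A B C : Fin 2) :
    curvLow p.M.metric (p.pos x) (sph B) (sph A) (sph C) 0
      = p.δ⁻¹ * (p.L ^ 2 * ((1 / 2) * (dS (dT B (p.gh C A)) x - dS (dT A (p.gh C B)) x)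
        - (1 / 2) * ∑ D, ∑ E, p.gi D E x * (p.Fh D C B x * dS (p.gh E A) x
          - dS (p.gh D B) x * p.Fh E C A x)
        + (1 / 8) * (p.tw B x * dS (p.gh C A) x - dS (p.gh C B) x * p.tw A x))) := by
  have hL := p.L_pos
  have hm : (p.L ^ 2)⁻¹ * p.L ^ 2 = 1 := inv_mul_cancel₀ (by positivity)
  rw [(p.adapted hx).curv_sph_sph_sph_zero]
  simp only [p.inv_gs _ _ hx, p.pd_gs_zero hx, p.pd_pd_gs_sph_zero hx, p.sphereLow_eq hx,
    p.twist_eq hx, Fin.sum_univ_two]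
  generalize (p.L ^ 2)⁻¹ = m at *
  generalize p.δ⁻¹ = d at *
  generalize p.L ^ 2 = l at *
  linear_combination -(1 / 2) * d * l * (p.gi 0 0 x * (p.Fh 0 C B x * dS (p.gh 0 A) x
          - dS (p.gh 0 B) x * p.Fh 0 C A x) + p.gi 0 1 x * (p.Fh 0 C B x * dS (p.gh 1 A) x
          - dS (p.gh 0 B) x * p.Fh 1 C A x) + p.gi 1 0 x * (p.Fh 1 C B x * dS (p.gh 0 A) x
          - dS (p.gh 1 B) x * p.Fh 0 C A x) + p.gi 1 1 x * (p.Fh 1 C B x * dS (p.gh 1 A) x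
          - dS (p.gh 1 B) x * p.Fh 1 C A x)) * hm

lemma curv_beta (A : Fin 2) : curvLow p.M.metric (p.pos x) (sph A) 0 1 0
    = p.δ⁻¹ * (-(1 / 2) * dS (p.tw A) x
      - (1 / 4) * ∑ B, ∑ C, p.gi B C x * (dS (p.gh B A) x * p.tw C x)) := by
  have hL := p.L_pos
  have hm : (p.L ^ 2)⁻¹ * p.L ^ 2 = 1 := inv_mul_cancel₀ (by positivity)
  rw [(p.adapted hx).curv_sph_zero_one_zero]
  simp only [p.inv_gs _ _ hx, p.pd_gs_zero hx, p.pd_twist_zero hx, p.twist_eq hx,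
    Fin.sum_univ_two]
  generalize (p.L ^ 2)⁻¹ = m at *
  generalize p.δ⁻¹ = d at *
  generalize p.L ^ 2 = l at *
  linear_combination -(1 / 4) * d * (p.gi 0 0 x * (dS (p.gh 0 A) x * p.tw 0 x)
    + p.gi 0 1 x * (dS (p.gh 0 A) x * p.tw 1 x) + p.gi 1 0 x * (dS (p.gh 1 A) x * p.tw 0 x)
    + p.gi 1 1 x * (dS (p.gh 1 A) x * p.tw 1 x)) * hm

/-- The transport equation for the torsion. -/
lemma dS_tw (A : Fin 2) : dS (p.tw A) x = p.J A x - 2 * p.T x * p.tw A x := by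
  have h := (p.adapted hx).codazzi (p.vacuum hx) A
  have ht := p.trace_dS_gh hx
  have hL := p.L_pos
  have hm : (p.L ^ 2)⁻¹ * p.L ^ 2 = 1 := inv_mul_cancel₀ (by positivity)
  have hd0 : p.δ⁻¹ ≠ 0 := inv_ne_zero p.hδ.ne'
  simp only [p.curv_beta hx, p.curv_codazzi hx, p.inv_gs _ _ hx] at h
  have e : ∀ B C, (p.L ^ 2)⁻¹ * p.gi B C x * (p.δ⁻¹ * (p.L ^ 2 *
        ((1 / 2) * (dS (dT C (p.gh B A)) x - dS (dT A (p.gh B C)) x)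
        - (1 / 2) * ∑ D, ∑ E, p.gi D E x * (p.Fh D B C x * dS (p.gh E A) x
          - dS (p.gh D C) x * p.Fh E B A x)
        + (1 / 8) * (p.tw C x * dS (p.gh B A) x - dS (p.gh B C) x * p.tw A x))))
      = p.δ⁻¹ * (p.gi B C x * (((1 / 2) * (dS (dT C (p.gh B A)) x - dS (dT A (p.gh B C)) x)
        - (1 / 2) * ∑ D, ∑ E, p.gi D E x * (p.Fh D B C x * dS (p.gh E A) x
          - dS (p.gh D C) x * p.Fh E B A x)))
        + (1 / 8) * (p.gi B C x * (dS (p.gh B A) x * p.tw C x))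
        - (1 / 8) * p.tw A x * (p.gi B C x * dS (p.gh B C) x)) := by
    intro B C
    linear_combination (p.gi B C x * (p.δ⁻¹ * (
        ((1 / 2) * (dS (dT C (p.gh B A)) x - dS (dT A (p.gh B C)) x)
        - (1 / 2) * ∑ D, ∑ E, p.gi D E x * (p.Fh D B C x * dS (p.gh E A) x
          - dS (p.gh D C) x * p.Fh E B A x)
        + (1 / 8) * (p.tw C x * dS (p.gh B A) x - dS (p.gh B C) x * p.tw A x))))) * hm
  simp only [e, ← Finset.mul_sum, Finset.sum_add_distrib, Finset.sum_sub_distrib, ht] at h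
  -- The full contractions of the torsion with the derivative of the metric cancel between the two
  -- sides of the Codazzi equation; only the trace `4 T` remains.
  have h2 : p.δ⁻¹ * (dS (p.tw A) x - (p.J A x - 2 * p.T x * p.tw A x)) = 0 := by
    unfold J
    linear_combination (-4) * h
  linarith [(mul_eq_zero.1 h2).resolve_left hd0]

end Equations

end PulseData


/-! ### The Gauss equation and transport of the incoming expansion -/

namespace PulseData

variable (p : PulseData)

/-- The second null fundamental form contracted with the derivative of the metric. -/
noncomputable def cross : Strip → ℝ := fun x => ∑ A, ∑ B, ∑ C, ∑ D,
  p.gi A B x * p.gi C D x * (dS (p.gh C A) x * p.yy D B x)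

/-- The trace of the `∂_u` derivative of the induced metric. -/
noncomputable def trY : Strip → ℝ := fun x => ∑ A, ∑ B, p.gi A B x * p.yy A B x

section Equations

variable {x : Strip} (hx : x ∈ strip)

include hx

lemma sphereCurv_eq (C A D B : Fin 2) :
    p.M.sphereCurv (p.pos x) C A D B = p.L ^ 2 * p.curvS C A D B x := by
  have hL := p.L_pos
  have hm : (p.L ^ 2)⁻¹ * p.L ^ 2 = 1 := inv_mul_cancel₀ (by positivity)
  simp only [DoubleNull.sphereCurv, p.pd_pd_gs_sph_sph hx, p.inv_gs _ _ hx, p.sphereLow_eq hx]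
  have e : ∀ E F, (p.L ^ 2)⁻¹ * p.gi E F x * (p.L ^ 2 * p.Fh E D C x * (p.L ^ 2 * p.Fh F B A x)
      - p.L ^ 2 * p.Fh E B C x * (p.L ^ 2 * p.Fh F D A x))
      = p.L ^ 2 * (p.gi E F x * (p.Fh E D C x * p.Fh F B A x - p.Fh E B C x * p.Fh F D A x)) := by
    intro E F
    linear_combination p.L ^ 2 * (p.gi E F x *
      (p.Fh E D C x * p.Fh F B A x - p.Fh E B C x * p.Fh F D A x)) * hm
  simp only [e, ← Finset.mul_sum, curvS]
  ring

lemma curv_sph4 (C A D B : Fin 2) : curvLow p.M.metric (p.pos x) (sph C) (sph A) (sph D) (sph B)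
    = p.L ^ 2 * (p.curvS C A D B x + (1 / 8) * p.δ⁻¹ *
      (dS (p.gh D C) x * p.yy B A x + p.yy D C x * dS (p.gh B A) x
        - dS (p.gh B C) x * p.yy D A x - p.yy B C x * dS (p.gh D A) x)) := by
  rw [(p.adapted hx).curv_sph_sph_sph_sph, p.sphereCurv_eq hx]
  simp only [p.pd_gs_zero hx, p.pd_gs_one hx]
  ring

lemma pd_yy_zero (A B : Fin 2) :
    pd (pd (fun y => p.M.gs y A B) 1) 0 (p.pos x) = p.δ⁻¹ * dS (p.yy A B) x :=
  congrFun (p.pull_pd_zero (contDiff_pd (p.smooth.gs A B) 1)) x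

lemma curv_zero_one (A B : Fin 2) : curvLow p.M.metric (p.pos x) 0 (sph A) 1 (sph B)
    = -(1 / 2) * dT A (p.tw B) x - (1 / 2) * p.δ⁻¹ * dS (p.yy B A) x
      + (1 / 2) * ∑ C, ∑ D, p.gi C D x * (p.tw C x * p.Fh D B A x)
      + (1 / 4) * p.δ⁻¹ * ∑ C, ∑ D, p.gi C D x * (dS (p.gh C B) x * p.yy D A x)
      + (1 / 8) * (p.tw A x * p.tw B x) := by
  have hL := p.L_pos
  have hm : (p.L ^ 2)⁻¹ * p.L ^ 2 = 1 := inv_mul_cancel₀ (by positivity)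
  rw [(p.adapted hx).curv_zero_sph_one_sph]
  simp only [p.pd_gs_zero hx, p.pd_gs_one hx, p.pd_twist_sph hx, p.pd_yy_zero hx,
    p.inv_gs _ _ hx, p.sphereLow_eq hx, p.twist_eq hx]
  have e1 : ∀ C D, (p.L ^ 2)⁻¹ * p.gi C D x * (p.tw C x * (p.L ^ 2 * p.Fh D B A x))
      = p.gi C D x * (p.tw C x * p.Fh D B A x) := fun C D => by
    linear_combination p.gi C D x * (p.tw C x * p.Fh D B A x) * hm
  have e2 : ∀ C D, (p.L ^ 2)⁻¹ * p.gi C D x * (p.δ⁻¹ * (p.L ^ 2 * dS (p.gh C B) x) * p.yy D A x)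
      = p.δ⁻¹ * (p.gi C D x * (dS (p.gh C B) x * p.yy D A x)) := fun C D => by
    linear_combination p.δ⁻¹ * (p.gi C D x * (dS (p.gh C B) x * p.yy D A x)) * hm
  simp only [e1, e2, ← Finset.mul_sum]
  ring

/-- The two null second fundamental forms contribute the product of their traces minus their full
contraction. -/
lemma trace_curv_sph4 : ∑ A, ∑ B, ∑ C, ∑ D, (p.M.gs (p.pos x))⁻¹ A B * (p.M.gs (p.pos x))⁻¹ C D
        * curvLow p.M.metric (p.pos x) (sph D) (sph B) (sph C) (sph A)
    = (p.L ^ 2)⁻¹ * (p.scal x + p.δ⁻¹ * p.T x * p.trY x - (1 / 4) * p.δ⁻¹ * p.cross x) := by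
  have hL := p.L_pos
  have hm : (p.L ^ 2)⁻¹ * p.L ^ 2 = 1 := inv_mul_cancel₀ (by positivity)
  have ht := p.trace_dS_gh hx
  have g10 : p.gi 1 0 x = p.gi 0 1 x := rfl
  have hsc : p.scal x = ∑ A, ∑ B, ∑ C, ∑ D, p.gi A B x * p.gi C D x * p.curvS D B C A x := rfl
  simp only [p.curv_sph4 hx, p.inv_gs _ _ hx]
  have e : ∀ A B C D, (p.L ^ 2)⁻¹ * p.gi A B x * ((p.L ^ 2)⁻¹ * p.gi C D x) *
      (p.L ^ 2 * (p.curvS D B C A x + (1 / 8) * p.δ⁻¹ *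
      (dS (p.gh C D) x * p.yy A B x + p.yy C D x * dS (p.gh A B) x
        - dS (p.gh A D) x * p.yy C B x - p.yy A D x * dS (p.gh C B) x)))
      = (p.L ^ 2)⁻¹ * (p.gi A B x * p.gi C D x * p.curvS D B C A x + (1 / 8) * p.δ⁻¹ *
      (p.gi A B x * p.gi C D x * (dS (p.gh C D) x * p.yy A B x + p.yy C D x * dS (p.gh A B) x
        - dS (p.gh A D) x * p.yy C B x - p.yy A D x * dS (p.gh C B) x))) := by
    intro A B C D
    linear_combination (p.L ^ 2)⁻¹ * (p.gi A B x * p.gi C D x * (p.curvS D B C A x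
      + (1 / 8) * p.δ⁻¹ * (dS (p.gh C D) x * p.yy A B x + p.yy C D x * dS (p.gh A B) x
        - dS (p.gh A D) x * p.yy C B x - p.yy A D x * dS (p.gh C B) x))) * hm
  simp only [e, ← Finset.mul_sum, Finset.sum_add_distrib, ← hsc]
  have key : ∑ A, ∑ B, ∑ C, ∑ D, (p.gi A B x * p.gi C D x * (dS (p.gh C D) x * p.yy A B x
        + p.yy C D x * dS (p.gh A B) x - dS (p.gh A D) x * p.yy C B x
        - p.yy A D x * dS (p.gh C B) x)) = 8 * p.T x * p.trY x - 2 * p.cross x := by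
    unfold trY cross
    simp only [Fin.sum_univ_two, p.gh_symm hx 1 0, p.yy_symm hx 1 0, g10] at ht ⊢
    linear_combination 2 * (p.gi 0 0 x * p.yy 0 0 x + p.gi 0 1 x * p.yy 0 1 x
      + (p.gi 0 1 x * p.yy 0 1 x + p.gi 1 1 x * p.yy 1 1 x)) * ht
  rw [key]
  ring

/-- The trace of the Ricci equation is a transport equation for the incoming expansion. Contracting
with the inverse of the determinant-one matrix `E`, that is, weighting the trace by the area,
absorbs every term in which `∂_u gs` meets the outgoing expansion or shear. -/
lemma dS_Sy : dS p.Sy x = p.δ * (p.φ x * p.φ x * (rf x * rf x))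
    * (-2 * p.scal x - p.divT x + (1 / 4) * p.sqT x) := by
  have hE := p.sm_E
  have hy := p.sm_yy
  have d0 := p.E_det x
  have d1 := p.dirD_E_det hx vS
  have y10 : dS (p.yy 1 0) x = dS (p.yy 0 1) x :=
    (hy 1 0).dirD_congr (hy 0 1) (fun z hz => p.yy_symm hz 1 0) vS hx
  have hS : dS p.Sy x = dS (p.E 1 1) x * p.yy 0 0 x - 2 * dS (p.E 0 1) x * p.yy 0 1 x
      + dS (p.E 0 0) x * p.yy 1 1 x + p.E 1 1 x * dS (p.yy 0 0) x
      - 2 * p.E 0 1 x * dS (p.yy 0 1) x + p.E 0 0 x * dS (p.yy 1 1) x := by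
    have h1 : EqOn p.Sy (fun x => p.E 1 1 x * p.yy 0 0 x - 2 * (p.E 0 1 x * p.yy 0 1 x)
        + p.E 0 0 x * p.yy 1 1 x) strip := fun z hz => by
      simp only [Sy, Ei, Fin.sum_univ_two, p.yy_symm hz 1 0]
      simp
      ring
    have m1 := (hE 1 1).mul (hy 0 0)
    have m2 := (hE 0 1).mul (hy 0 1)
    have m3 := (hE 0 0).mul (hy 1 1)
    rw [p.sm_Sy.dirD_congr ((m1.sub ((Sm.const 2).mul m2)).add m3) h1 vS hx,
      dirD_add _ (m1.sub ((Sm.const 2).mul m2)) m3 hx, dirD_sub _ m1 ((Sm.const 2).mul m2) hx,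
      dirD_const_mul _ m2 _ hx, dirD_mul _ (hE 1 1) (hy 0 0) hx, dirD_mul _ (hE 0 1) (hy 0 1) hx,
      dirD_mul _ (hE 0 0) (hy 1 1) hx]
    ring
  have h := (p.adapted hx).trace_ricci (p.vacuum hx)
  rw [p.trace_curv_sph4 hx] at h
  have hL := p.L_pos
  have hm0 : (p.L ^ 2)⁻¹ ≠ 0 := by positivity
  simp only [p.curv_zero_one hx, p.inv_gs _ _ hx, mul_assoc, ← Finset.mul_sum] at h
  have h := mul_left_cancel₀ hm0 h
  have hA : ∑ A, ∑ B, p.gi A B x * (-(1 / 2) * dT B (p.tw A) x - (1 / 2) * (p.δ⁻¹ * dS (p.yy A B) x)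
      + (1 / 2) * ∑ C, ∑ D, p.gi C D x * (p.tw C x * p.Fh D A B x)
      + (1 / 4) * (p.δ⁻¹ * ∑ C, ∑ D, p.gi C D x * (dS (p.gh C A) x * p.yy D B x))
      + (1 / 8) * (p.tw B x * p.tw A x))
      = -(1 / 2) * p.divT x - (1 / 2) * p.δ⁻¹ * (∑ A, ∑ B, p.gi A B x * dS (p.yy A B) x)
      + (1 / 4) * p.δ⁻¹ * p.cross x + (1 / 8) * p.sqT x := by
    unfold divT cross sqT
    simp only [Fin.sum_univ_two]
    ring
  rw [hA] at h
  have hδ := p.hδ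
  have hdd : p.δ * p.δ⁻¹ = 1 := mul_inv_cancel₀ hδ.ne'
  have ha := (p.area_pos hx).ne'
  have hk := mul_inv_cancel₀ ha
  have e00 : p.Ei 0 0 x = p.E 1 1 x := rfl
  have e01 : p.Ei 0 1 x = -p.E 0 1 x := rfl
  have e10 : p.Ei 1 0 x = -p.E 0 1 x := rfl
  have e11 : p.Ei 1 1 x = p.E 0 0 x := rfl
  rw [hS]
  unfold cross trY at h
  simp only [Fin.sum_univ_two, p.dS_gh' hx, p.gi_eq hx, e00, e01, e10, e11, p.E_symm 1 0,
    p.yy_symm hx 1 0, y10] at h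
  generalize p.scal x = sc at *
  generalize p.divT x = dv at *
  generalize p.sqT x = sq at *
  generalize (p.φ x * p.φ x * (rf x * rf x))⁻¹ = k at *
  generalize p.φ x * p.φ x * (rf x * rf x) = a at *
  generalize p.E 0 0 x = e at *
  generalize p.E 0 1 x = f at *
  generalize p.E 1 1 x = g at *
  generalize dS (p.E 0 0) x = e' at *
  generalize dS (p.E 0 1) x = f' at *
  generalize dS (p.E 1 1) x = g' at *
  generalize p.yy 0 0 x = y0 at *
  generalize p.yy 0 1 x = y1 at *
  generalize p.yy 1 1 x = y2 at *
  generalize dS (p.yy 0 0) x = z0 at *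
  generalize dS (p.yy 0 1) x = z1 at *
  generalize dS (p.yy 1 1) x = z2 at *
  generalize p.T x = t at *
  generalize p.δ⁻¹ = d at *
  generalize p.δ = D at *
  have hQ : (e * g - f * f) * (g * y0 - 2 * f * y1 + e * y2) = g * y0 - 2 * f * y1 + e * y2 := by
    rw [d0, one_mul]
  have hQ' : g * (g * (e' * y0) - f * (e' * y1) - f * (f' * y0) + e * (f' * y1))
      - f * (g * (e' * y1) - f * (e' * y2) - f * (f' * y1) + e * (f' * y2))
      - f * (g * (f' * y0) - f * (f' * y1) - f * (g' * y0) + e * (g' * y1))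
      + e * (g * (f' * y1) - f * (f' * y2) - f * (g' * y1) + e * (g' * y2))
      = - (g' * y0 - 2 * f' * y1 + e' * y2) := by
    linear_combination (g * y0 - 2 * f * y1 + e * y2) * d1 - (g' * y0 - 2 * f' * y1 + e' * y2) * d0
  linear_combination (-2 * D * a) * h + d * D * a * (k * k * a) * (2 * t * hQ + hQ')
    - (g * z0 - 2 * f * z1 + e * z2) * (d * D * hk + hdd)
    - (g' * y0 - 2 * f' * y1 + e' * y2) * ((a * k + 1) * d * D * hk + hdd)
    + 2 * t * (g * y0 - 2 * f * y1 + e * y2) * (a * k * d * D) * hk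

end Equations

end PulseData


/-! ### The final sphere, after the pulse -/

/-- The part `s ≥ c` of the strip. -/
def lateStrip (c : ℝ) : Set Strip := Icc c 1 ×ˢ univ

lemma Sm.dirD_congr_late {f g : Strip → ℝ} (hf : Sm f) (hg : Sm g) {c : ℝ} (h0 : 0 ≤ c)
    (h1 : c < 1) (h : EqOn f g (lateStrip c)) (v : Strip) :
    EqOn (NullGeom.dirD v f) (NullGeom.dirD v g) (lateStrip c) := by
  intro x hx
  have hx' : x ∈ strip := mem_strip.2 ⟨h0.trans hx.1.1, hx.1.2⟩
  have hu : UniqueDiffOn ℝ (lateStrip c) := (uniqueDiffOn_Icc h1).prod uniqueDiffOn_univ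
  have h1 := (hf.diff hx').fderivWithin (hu x hx)
  have h2 := (hg.diff hx').fderivWithin (hu x hx)
  simp only [NullGeom.dirD, ← h1, ← h2, fderivWithin_congr h (h hx)]

/-- The round metric `r² δ_{AB}` has Gauss curvature one: `Δ log r = -r²`. -/
lemma rf_identity {x : Strip} (hx : x ∈ strip) :
    ∑ A, (rf x * dT A (dT A rf) x - dT A rf x * dT A rf x) = - (rf x) ^ 4 := by
  set q : Strip → ℝ := fun x => 1 + (x.2 0 * x.2 0 + x.2 1 * x.2 1) * (1 / 4) with hq
  have hqp : ∀ x, 0 < q x := fun x => by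
    have := mul_self_nonneg (x.2 0); have := mul_self_nonneg (x.2 1); simp only [hq]; linarith
  have hqs : ContDiff ℝ ∞ q := by simp only [hq]; fun_prop
  have hr : rf = fun x => (q x)⁻¹ := by
    ext x; simp only [rf, roundFactor, eucSq, hq]; ring
  have c : ∀ A : Fin 2, Sm fun x => x.2 A := fun A => Sm.of_contDiff (by fun_prop)
  have hc : ∀ (A B : Fin 2) (x : Strip), dT A (fun x => x.2 B) x = (Pi.single A (1 : ℝ) : Fin 2 → ℝ) B := by
    intro A B x
    have : HasFDerivAt (fun x : Strip => x.2 B) ((ContinuousLinearMap.proj B).comp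
      (ContinuousLinearMap.snd ℝ ℝ (Fin 2 → ℝ))) x :=
      ((ContinuousLinearMap.proj (R := ℝ) (φ := fun _ : Fin 2 => ℝ) B).comp
        (ContinuousLinearMap.snd ℝ ℝ (Fin 2 → ℝ))).hasFDerivAt
    rw [dirD, this.fderiv]; rfl
  have hsq : Sm q := Sm.of_contDiff hqs
  have h1 : ∀ A, EqOn (dT A q) (fun x => (1 / 2) * x.2 A) strip := fun A y hy => by
    have m0 := (c 0).mul (c 0)
    have m1 := (c 1).mul (c 1)
    simp only [hq]
    rw [dirD_add _ (Sm.const 1) ((m0.add m1).mul (Sm.const _)) hy, dirD_const,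
      dirD_mul _ (m0.add m1) (Sm.const _) hy, dirD_const, dirD_add _ m0 m1 hy,
      dirD_mul _ (c 0) (c 0) hy, dirD_mul _ (c 1) (c 1) hy, hc, hc]
    fin_cases A <;> simp <;> ring
  have h2 : ∀ A, EqOn (dT A rf) (fun x => -(1 / 2) * (rf x * rf x * x.2 A)) strip := fun A y hy => by
    rw [hr, dirD_inv _ hsq (fun x _ => (hqp x).ne') hy, h1 A hy]; ring
  have h3 : ∀ A, dT A (dT A rf) x = -(1 / 2) * (rf x * rf x
      + 2 * rf x * (-(1 / 2) * (rf x * rf x * x.2 A)) * x.2 A) := fun A => by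
    have m := sm_rf.mul sm_rf
    rw [(sm_rf.dirD _).dirD_congr ((Sm.const _).mul (m.mul (c A))) (h2 A) _ hx,
      dirD_const_mul _ (m.mul (c A)) _ hx, dirD_mul _ m (c A) hx, dirD_mul _ sm_rf sm_rf hx,
      h2 A hx, hc]
    simp; ring
  have h4 : rf x * (1 + (x.2 0 * x.2 0 + x.2 1 * x.2 1) * (1 / 4)) = 1 := by
    rw [hr]; exact inv_mul_cancel₀ (hqp x).ne'
  simp only [h3, h2 _ hx, Fin.sum_univ_two]
  linear_combination (rf x) ^ 3 * h4

namespace PulseData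

variable (p : PulseData)

/-- The area density. -/
noncomputable def area : Strip → ℝ := fun x => p.φ x * p.φ x * (rf x * rf x)

lemma sm_area' : Sm p.area := p.sm_area

/-- The support of the seed ends before `s = 1`, so `E` is the identity on a one-sided neighbourhood
of the final sphere, and its derivatives vanish on that sphere. -/
lemma exists_late : ∃ c : ℝ, 0 ≤ c ∧ c < 1 ∧ ∀ A B,
    EqOn (p.E A B) (fun _ => (1 : Matrix (Fin 2) (Fin 2) ℝ) A B) (lateStrip c) := by
  obtain ⟨a, c, ha, hc, h⟩ := p.S.compact_support
  refine ⟨max 0 ((c + 1) / 2), le_max_left _ _, max_lt one_pos (by linarith), fun A B x hx => ?_⟩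
  refine p.E_of_seed_eq_zero (fun A B => ?_) A B
  have h1 : (c + 1) / 2 ≤ x.1 := (le_max_right _ _).trans hx.1.1
  simp [seed, h p.i x.1 x.2 (fun h => by linarith [h.2])]

lemma mem_late {c : ℝ} (hc : c < 1) (θ : Fin 2 → ℝ) : ((1 : ℝ), θ) ∈ lateStrip c :=
  ⟨⟨hc.le, le_rfl⟩, mem_univ _⟩

section Late

variable (θ : Fin 2 → ℝ)

lemma E_late (A B : Fin 2) : p.E A B (1, θ) = (1 : Matrix (Fin 2) (Fin 2) ℝ) A B := by
  obtain ⟨c, h0, h1, h⟩ := p.exists_late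
  exact h A B (mem_late h1 θ)

lemma dirD_E_late (v : Strip) (A B : Fin 2) : dirD v (p.E A B) (1, θ) = 0 := by
  obtain ⟨c, h0, h1, h⟩ := p.exists_late
  rw [(p.sm_E A B).dirD_congr_late (Sm.const _) h0 h1 (h A B) v (mem_late h1 θ), dirD_const]

lemma dirD_dirD_E_late (v w : Strip) (A B : Fin 2) : dirD v (dirD w (p.E A B)) (1, θ) = 0 := by
  obtain ⟨c, h0, h1, h⟩ := p.exists_late
  have h2 : EqOn (dirD w (p.E A B)) (fun _ => 0) (lateStrip c) := fun x hx => by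
    rw [(p.sm_E A B).dirD_congr_late (Sm.const _) h0 h1 (h A B) w hx, dirD_const]
  rw [((p.sm_E A B).dirD w).dirD_congr_late (Sm.const _) h0 h1 h2 v (mem_late h1 θ), dirD_const]

lemma source_late : p.source (1, θ) = 0 := by simp [source, p.dirD_E_late]

lemma gh_late (A B : Fin 2) :
    p.gh A B (1, θ) = p.area (1, θ) * (1 : Matrix (Fin 2) (Fin 2) ℝ) A B := by
  rw [gh, p.E_late]; rfl

lemma Ei_late (A B : Fin 2) : p.Ei A B (1, θ) = (1 : Matrix (Fin 2) (Fin 2) ℝ) A B := by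
  fin_cases A <;> fin_cases B <;> simp [Ei, p.E_late]

lemma gi_late (A B : Fin 2) :
    p.gi A B (1, θ) = (p.area (1, θ))⁻¹ * (1 : Matrix (Fin 2) (Fin 2) ℝ) A B := by
  rw [gi, p.Ei_late]; rfl

lemma dirD_gh_late (v : Strip) (A B : Fin 2) :
    dirD v (p.gh A B) (1, θ) = dirD v p.area (1, θ) * (1 : Matrix (Fin 2) (Fin 2) ℝ) A B := by
  have hx := mem_strip_one θ
  have e : p.gh A B = fun x => p.area x * p.E A B x := rfl
  rw [e, dirD_mul _ p.sm_area' (p.sm_E A B) hx, p.E_late, p.dirD_E_late]; ring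

lemma dirD_dirD_gh_late (v w : Strip) (A B : Fin 2) : dirD v (dirD w (p.gh A B)) (1, θ)
    = dirD v (dirD w p.area) (1, θ) * (1 : Matrix (Fin 2) (Fin 2) ℝ) A B := by
  have hx := mem_strip_one θ
  have s := p.sm_area'
  have t := p.sm_E A B
  have e : EqOn (dirD w (p.gh A B)) (fun x => dirD w p.area x * p.E A B x
      + p.area x * dirD w (p.E A B) x) strip := fun y hy => dirD_mul _ s t hy
  have m1 := (s.dirD w).mul t
  have m2 := s.mul (t.dirD w)
  rw [((p.sm_gh A B).dirD w).dirD_congr (m1.add m2) e v hx, dirD_add _ m1 m2 hx,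
    dirD_mul _ (s.dirD w) t hx, dirD_mul _ s (t.dirD w) hx, p.E_late, p.dirD_E_late,
    p.dirD_E_late, p.dirD_dirD_E_late]
  ring

lemma dS_area {x : Strip} (hx : x ∈ strip) : dS p.area x = 2 * (p.T x * p.area x) := by
  have := (p.φ_pos hx).ne'
  have e := dS_rf hx
  unfold area T
  rw [dirD_mul _ (p.sm_φ.mul p.sm_φ) (sm_rf.mul sm_rf) hx, dirD_mul _ p.sm_φ p.sm_φ hx,
    dirD_mul _ sm_rf sm_rf hx, e]
  field_simp; ring

lemma dS_dT_area {x : Strip} (hx : x ∈ strip) (A : Fin 2) :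
    dS (dT A p.area) x = 2 * (dT A p.T x * p.area x + p.T x * dT A p.area x) := by
  have s := p.sm_area'
  have m := p.sm_T.mul s
  rw [s.dirD_comm _ _ hx, (s.dirD vS).dirD_congr ((Sm.const 2).mul m) (fun y hy => p.dS_area hy) _ hx,
    dirD_const_mul _ m _ hx, dirD_mul _ p.sm_T s hx]

lemma area_pos' {x : Strip} (hx : x ∈ strip) : 0 < p.area x := p.area_pos hx

/-- The metric evolves conformally after the pulse, at the rate `2 T`. The terms with derivatives of
the area cancel, and the gradient of the rate survives. -/
lemma J_late (A : Fin 2) : p.J A (1, θ) = -4 * dT A p.T (1, θ) := by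
  have hx := mem_strip_one θ
  have ha := inv_mul_cancel₀ (p.area_pos' hx).ne'
  simp only [J, Fh, p.gi_late, p.dirD_gh_late, p.dirD_dirD_gh_late, p.dS_area hx, p.dS_dT_area hx,
    Fin.sum_univ_two]
  generalize (p.area (1, θ))⁻¹ = k at *
  generalize p.area (1, θ) = a at *
  revert A
  refine Fin.forall_fin_two.2 ⟨?_, ?_⟩ <;> simp
  · linear_combination (-4 * dT 0 p.T (1, θ)) * ha + (4 * p.T (1, θ) * k * dT 0 p.area (1, θ)) * ha
  · linear_combination (-4 * dT 1 p.T (1, θ)) * ha + (4 * p.T (1, θ) * k * dT 1 p.area (1, θ)) * ha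

/-- The transport equation eliminates the `s` derivative of the torsion from the curvature
component. -/
lemma beta_late (A : Fin 2) : p.M.beta (p.pos (1, θ)) A
    = p.δ⁻¹ * (dT A p.T (1, θ) + (1 / 4) * (p.T (1, θ) * p.tw A (1, θ))) := by
  have hx := mem_strip_one θ
  have ha := inv_mul_cancel₀ (p.area_pos' hx).ne'
  rw [(p.adapted hx).beta_eq, p.curv_beta hx, p.dS_tw hx, p.J_late]
  simp only [p.gi_late, p.dirD_gh_late, p.dS_area hx, Fin.sum_univ_two]
  generalize (p.area (1, θ))⁻¹ = k at *
  generalize p.area (1, θ) = a at *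
  revert A
  refine Fin.forall_fin_two.2 ⟨?_, ?_⟩ <;> simp
  · linear_combination (-(1 / 4) * p.δ⁻¹ * p.T (1, θ) * p.tw 0 (1, θ)) * ha
  · linear_combination (-(1 / 4) * p.δ⁻¹ * p.T (1, θ) * p.tw 1 (1, θ)) * ha

/-- With `E` constant, `α` is a pure trace proportional to `φ''`, and this vanishes by the
Raychaudhuri equation because the source does. -/
lemma alpha_late (A B : Fin 2) : p.M.alpha (p.pos (1, θ)) A B = 0 := by
  have hx := mem_strip_one θ
  rw [(p.adapted hx).alpha_eq, (p.adapted hx).curv_sph_zero_sph_zero]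
  simp only [p.inv_gs _ _ hx, p.pd_gs_zero hx, p.pd_pd_gs_zero_zero hx, p.dS_gh hx, p.dS_dS_gh hx,
    p.gi_late, p.E_late, p.dirD_E_late, p.dirD_dirD_E_late, p.φ_ode hx, p.source_late, area,
    Fin.sum_univ_two]
  have hφ := p.φ_pos hx
  have hr := rf_pos (1, θ)
  have hL := p.L_pos
  have hδ := p.hδ
  revert A B
  refine Fin.forall_fin_two.2 ⟨Fin.forall_fin_two.2 ⟨?_, ?_⟩, Fin.forall_fin_two.2 ⟨?_, ?_⟩⟩ <;>
    simp <;> field_simp <;> ring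

/-- The antisymmetric product of the second fundamental forms disappears because the outgoing one is
a pure trace; the curl of the torsion remains. -/
lemma sigma_late : p.M.sigma (p.pos (1, θ)) = (1 / 4) * (p.L ^ 2)⁻¹ * ((p.area (1, θ))⁻¹
    * (dT 0 (p.tw 1) (1, θ) - dT 1 (p.tw 0) (1, θ))) := by
  have hx := mem_strip_one θ
  have hL := p.L_pos
  have ha := p.area_pos' hx
  have hg : ∀ A B, p.M.gs (p.pos (1, θ)) A B = p.L ^ 2 * p.gh A B (1, θ) := fun A B => p.gm_eq A B hx
  have hdet : Real.sqrt (p.M.gs (p.pos (1, θ))).det = p.L ^ 2 * p.area (1, θ) := by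
    rw [Matrix.det_fin_two, hg, hg, hg, hg]
    simp only [p.gh_late]
    have : p.L ^ 2 * (p.area (1, θ) * (1 : Matrix (Fin 2) (Fin 2) ℝ) 0 0)
        * (p.L ^ 2 * (p.area (1, θ) * (1 : Matrix (Fin 2) (Fin 2) ℝ) 1 1))
        - p.L ^ 2 * (p.area (1, θ) * (1 : Matrix (Fin 2) (Fin 2) ℝ) 0 1)
          * (p.L ^ 2 * (p.area (1, θ) * (1 : Matrix (Fin 2) (Fin 2) ℝ) 1 0))
        = (p.L ^ 2 * p.area (1, θ)) ^ 2 := by simp; ring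
    rw [this, Real.sqrt_sq (by positivity)]
  rw [(p.adapted hx).sigma_eq]
  simp only [(p.adapted hx).curv_one_zero_sph_sph, DoubleNull.epsUp, hdet, p.inv_gs _ _ hx,
    p.pd_gs_zero hx, p.pd_gs_one hx, p.pd_twist_sph hx, p.gi_late, p.dirD_gh_late, p.yy_symm hx 1 0,
    Fin.sum_univ_two, mul_inv]
  simp
  ring

lemma cross_late : p.cross (1, θ) = 2 * p.T (1, θ) * p.trY (1, θ) := by
  have hx := mem_strip_one θ
  have ha := inv_mul_cancel₀ (p.area_pos' hx).ne'
  simp only [cross, trY, p.gi_late, p.dirD_gh_late, p.dS_area hx, Fin.sum_univ_two]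
  generalize (p.area (1, θ))⁻¹ = k at *
  generalize p.area (1, θ) = a at *
  simp
  linear_combination (2 * p.T (1, θ) * k * (p.yy 0 0 (1, θ) + p.yy 1 1 (1, θ))) * ha

lemma trY_eq {x : Strip} : p.trY x = (p.area x)⁻¹ * p.Sy x := by
  simp only [trY, Sy, Finset.mul_sum]
  exact Finset.sum_congr rfl fun A _ => Finset.sum_congr rfl fun B _ => by
    rw [gi, area]; ring

/-- The Gauss equation without outgoing shear: intrinsic curvature and the product of the two
expansions. -/
lemma rho_late : p.M.rho (p.pos (1, θ)) = -(1 / 2) * (p.L ^ 2)⁻¹ * p.scal (1, θ)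
    - (1 / 4) * p.δ⁻¹ * (p.L ^ 2)⁻¹ * (p.T (1, θ) * ((p.area (1, θ))⁻¹ * p.Sy (1, θ))) := by
  have hx := mem_strip_one θ
  rw [(p.adapted hx).rho_eq, (p.adapted hx).gauss (p.vacuum hx), (p.adapted hx).trace_ricci (p.vacuum hx),
    p.trace_curv_sph4 hx, p.cross_late, p.trY_eq]
  ring

/-- The conformal transformation law `K = φ⁻² (1 - Δ log φ)`, with the Laplacian of the unit sphere,
whose own curvature enters through `rf_identity`. -/
lemma scal_late : p.scal (1, θ) = 2 * ((p.φ (1, θ))⁻¹ * (p.φ (1, θ))⁻¹)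
    - 2 * ((p.area (1, θ))⁻¹ * ((p.φ (1, θ))⁻¹ * (p.φ (1, θ))⁻¹)
      * ∑ A, (p.φ (1, θ) * dT A (dT A p.φ) (1, θ) - dT A p.φ (1, θ) * dT A p.φ (1, θ))) := by
  have hx := mem_strip_one θ
  have ha := inv_mul_cancel₀ (p.area_pos' hx).ne'
  have h1 : p.scal (1, θ) = - ((p.area (1, θ))⁻¹ * (p.area (1, θ))⁻¹)
      * (dT 0 (dT 0 p.area) (1, θ) + dT 1 (dT 1 p.area) (1, θ))
      + ((p.area (1, θ))⁻¹) ^ 3 * (dT 0 p.area (1, θ) ^ 2 + dT 1 p.area (1, θ) ^ 2) := by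
    simp only [scal, curvS, Fh, p.gi_late, p.dirD_gh_late, p.dirD_dirD_gh_late,
      Fin.sum_univ_two]
    simp
    ring
  have hA : ∀ A, EqOn (dT A p.area) (fun x => 2 * (p.φ x * dT A p.φ x * (rf x * rf x)
      + p.φ x * p.φ x * (rf x * dT A rf x))) strip := fun A y hy => by
    unfold area
    rw [dirD_mul _ (p.sm_φ.mul p.sm_φ) (sm_rf.mul sm_rf) hy, dirD_mul _ p.sm_φ p.sm_φ hy,
      dirD_mul _ sm_rf sm_rf hy]
    ring
  have hAA : ∀ A, dT A (dT A p.area) (1, θ) = 2 * ((dT A p.φ (1, θ) * dT A p.φ (1, θ)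
        + p.φ (1, θ) * dT A (dT A p.φ) (1, θ)) * (rf (1, θ) * rf (1, θ))
      + 4 * (p.φ (1, θ) * dT A p.φ (1, θ) * (rf (1, θ) * dT A rf (1, θ)))
      + p.φ (1, θ) * p.φ (1, θ) * (dT A rf (1, θ) * dT A rf (1, θ)
        + rf (1, θ) * dT A (dT A rf) (1, θ))) := fun A => by
    have s := p.sm_φ
    have s' := s.dirD (vT A)
    have r := sm_rf
    have r' := r.dirD (vT A)
    have m1 := (s.mul s').mul (r.mul r)
    have m2 := (s.mul s).mul (r.mul r')
    rw [(p.sm_area'.dirD _).dirD_congr ((Sm.const 2).mul (m1.add m2)) (hA A) _ hx,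
      dirD_const_mul _ (m1.add m2) _ hx, dirD_add _ m1 m2 hx, dirD_mul _ (s.mul s') (r.mul r) hx,
      dirD_mul _ (s.mul s) (r.mul r') hx, dirD_mul _ s s' hx, dirD_mul _ s s hx, dirD_mul _ r r hx,
      dirD_mul _ r r' hx]
    ring
  have hr := rf_identity hx
  have hφ := p.φ_pos hx
  have hrp := rf_pos (1, θ)
  rw [h1, hAA, hAA, hA 0 hx, hA 1 hx]
  simp only [area, Fin.sum_univ_two] at hr ⊢
  generalize dT 0 (dT 0 p.φ) (1, θ) = f00 at *
  generalize dT 1 (dT 1 p.φ) (1, θ) = f11 at *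
  generalize dT 0 (dT 0 rf) (1, θ) = r00 at *
  generalize dT 1 (dT 1 rf) (1, θ) = r11 at *
  generalize dT 0 p.φ (1, θ) = f0 at *
  generalize dT 1 p.φ (1, θ) = f1 at *
  generalize dT 0 rf (1, θ) = r0 at *
  generalize dT 1 rf (1, θ) = r1 at *
  generalize p.φ (1, θ) = f at *
  generalize rf (1, θ) = r at *
  field_simp
  linear_combination (-f ^ 2) * hr

end Late

end PulseData


/-! ### The expansion and the energy -/

/-- The restriction to the final sphere, as a function on the strip. -/
def slice (f : Strip → ℝ) : Strip → ℝ := fun x => f (1, x.2)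

lemma Sm.slice {f : Strip → ℝ} (hf : Sm f) : Sm (slice f) := fun x _ => by
  have h : ContDiffAt ℝ ∞ (fun x : Strip => ((1 : ℝ), x.2)) x := by fun_prop
  exact (hf (1, x.2) (mem_strip.2 (by simp))).comp x h

lemma dT_slice {f : Strip → ℝ} (hf : Sm f) (A : Fin 2) : dT A (slice f) = slice (dT A f) := by
  ext x
  have h1 : HasFDerivAt (fun x : Strip => ((1 : ℝ), x.2))
      ((0 : Strip →L[ℝ] ℝ).prod (ContinuousLinearMap.snd ℝ ℝ (Fin 2 → ℝ))) x :=
    (hasFDerivAt_const _ _).prodMk hasFDerivAt_snd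
  have h2 := ((hf.diff (x := (1, x.2)) (mem_strip.2 (by simp))).hasFDerivAt).comp x h1
  have h3 : dT A (slice f) x = ((fderiv ℝ f (1, x.2)).comp ((0 : Strip →L[ℝ] ℝ).prod
      (ContinuousLinearMap.snd ℝ ℝ (Fin 2 → ℝ)))) (vT A) := by
    rw [dirD, show slice f = f ∘ (fun x : Strip => ((1 : ℝ), x.2)) from rfl, h2.fderiv]
  rw [h3]; rfl

lemma Bd.slice {ι : Type*} {κ : ι → ℝ} {k : ℕ} {f : ι → Strip → ℝ} (h : Bd κ k f) :
    Bd κ k fun p => slice (f p) := by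
  have key : ∀ {f : ι → Strip → ℝ}, (∃ C, ∀ p, ∀ x ∈ disc, |f p x| ≤ C * κ p) →
      ∃ C, ∀ p, ∀ x ∈ disc, |NullGeom.slice (f p) x| ≤ C * κ p := by
    rintro f ⟨C, hC⟩
    exact ⟨C, fun p x hx => hC p (1, x.2) ⟨by simp, hx.2⟩⟩
  induction k generalizing f with
  | zero => exact ⟨fun p => (h.sm p).slice, key h.bound⟩
  | succ k ih =>
    refine ⟨fun p => (h.sm p).slice, key h.bound, fun a => ?_⟩
    have := ih (h.ang a)
    have e : (fun p => dT a (NullGeom.slice (f p))) = fun p => NullGeom.slice (dT a (f p)) := by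
      ext p : 1; exact dT_slice (h.sm p) a
    rw [e]; exact this

/-- Different members of the family may satisfy different ones of the two energy hypotheses. The
indicator of the alternative is constant in `x`, so it does not affect angular derivatives. -/
lemma Bd.of_or {ι : Type*} {κ : ι → ℝ} {k : ℕ} {f g : ι → Strip → ℝ} (h : Bd κ k g)
    (hf : ∀ p, f p = 0 ∨ f p = g p) : Bd κ k f := by
  classical
  have h1 := (Bd.const_fun (κ := fun _ : ι => (1 : ℝ)) (fun p => if f p = 0 then 0 else 1) 1
    (fun p => by split_ifs <;> simp) k).mul_one h
  have e : f = fun p x => (if f p = 0 then 0 else 1) * g p x := by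
    ext p x
    rcases hf p with h2 | h2
    · simp [h2]
    · by_cases h3 : f p = 0
      · simp [h3]
      · rw [if_neg h3, one_mul, h2]
  rw [e]; exact h1

lemma sum_two_arrow (F : Fin 2 → Fin 2 → ℝ) :
    ∑ a : Fin 2 → Fin 2, F (a 0) (a 1) = ∑ A, ∑ B, F A B := by
  rw [← Fintype.sum_prod_type']
  exact Fintype.sum_equiv (finTwoArrowEquiv (Fin 2)) _ _ fun a => rfl

namespace PulseData

variable (p : PulseData)

/-- The initial value of the expansion, up to a constant. -/
noncomputable def μ : ℝ := p.δ / p.L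

lemma T_init (θ : Fin 2 → ℝ) : p.T (0, θ) = p.μ := by
  simp [T, p.φ_init, p.dS_φ_init, μ]

/-- The Riccati form of `φ_ode`. It isolates the integral of the source, the quantity given by the
energy, from a quadratic error. -/
lemma dS_T {x : Strip} (hx : x ∈ strip) : dS p.T x = - p.source x - p.T x * p.T x := by
  have h0 : ∀ x ∈ strip, p.φ x ≠ 0 := fun x hx => (p.φ_pos hx).ne'
  have := h0 x hx
  unfold T
  rw [dirD_mul _ (p.sm_φ.dirD _) (p.sm_φ.inv h0) hx, dirD_inv _ p.sm_φ h0 hx, p.φ_ode hx]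
  field_simp
  ring

/-- The nonlinear part of the expansion. -/
noncomputable def W : Strip → ℝ := fun x => p.T x - p.μ + prim p.source x

lemma sm_prim_source : Sm (prim p.source) := Sm.of_contDiff (contDiff_prim p.contDiff_source)

lemma sm_W : Sm p.W := (p.sm_T.sub (Sm.const _)).add p.sm_prim_source

lemma W_init (θ : Fin 2 → ℝ) : p.W (0, θ) = 0 := by simp [W, p.T_init, prim_zero]

lemma dS_W {x : Strip} (hx : x ∈ strip) : dS p.W x = - (p.T x * p.T x) := by
  unfold W
  rw [dirD_add _ (p.sm_T.sub (Sm.const _)) p.sm_prim_source hx,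
    dirD_sub _ p.sm_T (Sm.const _) hx, dirD_const, dS_prim p.contDiff_source hx, p.dS_T hx]
  ring

lemma chih_eq {x : Strip} (hx : x ∈ strip) (A B : Fin 2) : p.M.chih (p.pos x) A B
    = (1 / 2) * p.δ⁻¹ * p.L ^ 2 * (p.φ x * p.φ x * (rf x * rf x) * dS (p.E A B) x) := by
  have hg : p.M.gs (p.pos x) A B = p.L ^ 2 * p.gh A B x := p.gm_eq A B hx
  rw [DoubleNull.chih, (p.adapted hx).chi_eq, p.trchi_eq hx, p.pd_gs_zero hx, p.dS_gh' hx, hg, gh]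
  ring

/-- The shear is proportional to `E'`, which is trace-free with respect to `E`. The powers of `L`
cancel in its length, and `square_trace` evaluates it. -/
lemma shearSq_eq {x : Strip} (hx : x ∈ strip) :
    p.M.shearSq (p.δ * x.1) p.u₀ x.2 = 2 * (p.δ⁻¹ * p.δ⁻¹) * p.source x := by
  have e : p.M.shearSq (p.δ * x.1) p.u₀ x.2 = ∑ A, ∑ B, ∑ C, ∑ D,
      (p.M.gs (p.pos x))⁻¹ A C * (p.M.gs (p.pos x))⁻¹ B D
        * p.M.chih (p.pos x) A B * p.M.chih (p.pos x) C D := by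
    simp only [DoubleNull.shearSq, normSq, DoubleNull.onSphere₂, DoubleNull.sphereMetric,
      Fin.prod_univ_two]
    have h1 : ∀ a : Fin 2 → Fin 2, ∑ c : Fin 2 → Fin 2,
        (p.M.gs (p.pos x))⁻¹ (a 0) (c 0) * (p.M.gs (p.pos x))⁻¹ (a 1) (c 1)
          * p.M.chih (p.pos x) (a 0) (a 1) * p.M.chih (p.pos x) (c 0) (c 1)
        = ∑ C, ∑ D, (p.M.gs (p.pos x))⁻¹ (a 0) C * (p.M.gs (p.pos x))⁻¹ (a 1) D
          * p.M.chih (p.pos x) (a 0) (a 1) * p.M.chih (p.pos x) C D := fun a =>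
      sum_two_arrow fun C D => (p.M.gs (p.pos x))⁻¹ (a 0) C * (p.M.gs (p.pos x))⁻¹ (a 1) D
          * p.M.chih (p.pos x) (a 0) (a 1) * p.M.chih (p.pos x) C D
    refine (Finset.sum_congr rfl fun a _ => h1 a).trans ?_
    exact sum_two_arrow fun A B => ∑ C, ∑ D, (p.M.gs (p.pos x))⁻¹ A C * (p.M.gs (p.pos x))⁻¹ B D
          * p.M.chih (p.pos x) A B * p.M.chih (p.pos x) C D
  rw [e]
  have hL := p.L_pos
  have hm : (p.L ^ 2)⁻¹ * p.L ^ 2 = 1 := inv_mul_cancel₀ (by positivity)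
  have ha := inv_mul_cancel₀ (p.area_pos hx).ne'
  have d0 := p.E_det x
  have d1 := p.dirD_E_det hx vS
  have hs := square_trace (p.E 0 0 x) (p.E 0 1 x) (p.E 1 1 x) (dS (p.E 0 0) x) (dS (p.E 0 1) x)
    (dS (p.E 1 1) x) 0 1 d0 (by linear_combination d1)
  have e00 : p.Ei 0 0 x = p.E 1 1 x := rfl
  have e01 : p.Ei 0 1 x = -p.E 0 1 x := rfl
  have e10 : p.Ei 1 0 x = -p.E 0 1 x := rfl
  have e11 : p.Ei 1 1 x = p.E 0 0 x := rfl
  have key : ∀ A B C D, (p.M.gs (p.pos x))⁻¹ A C * (p.M.gs (p.pos x))⁻¹ B D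
        * p.M.chih (p.pos x) A B * p.M.chih (p.pos x) C D
      = (1 / 4) * (p.δ⁻¹ * p.δ⁻¹) *
        (p.Ei A C x * p.Ei B D x * dS (p.E A B) x * dS (p.E C D) x) := by
    intro A B C D
    rw [p.inv_gs _ _ hx, p.inv_gs _ _ hx, p.chih_eq hx, p.chih_eq hx, gi, gi]
    generalize (p.L ^ 2)⁻¹ = m at *
    generalize p.L ^ 2 = l at *
    generalize (p.φ x * p.φ x * (rf x * rf x))⁻¹ = k at *
    generalize p.φ x * p.φ x * (rf x * rf x) = a at *
    have : m * l * (m * l) * (k * a) * (k * a) = 1 := by rw [hm, ha]; ring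
    linear_combination (1 / 4) * (p.δ⁻¹ * p.δ⁻¹) *
        (p.Ei A C x * p.Ei B D x * dS (p.E A B) x * dS (p.E C D) x) * this
  simp only [key, ← Finset.mul_sum]
  simp only [Fin.sum_univ_two, e00, e01, e10, e11, p.E_symm 1 0, source]
  linear_combination (1 / 4) * (p.δ⁻¹ * p.δ⁻¹) * hs

lemma prim_source_of_shear (h : p.D.ShearEnergy p.m₀) (θ : Fin 2 → ℝ) :
    prim p.source (1, θ) = 2 * p.m₀ * p.ε ^ 2 := by
  have h1 := h p.i θ
  have hδ := p.hδ
  have hL := p.L_pos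
  have h2 := intervalIntegral.smul_integral_comp_mul_left (a := 0) (b := 1)
    (fun ub => (p.D.M p.i).shearSq ub p.u₀ θ) p.δ
  have h3 : ∫ s in (0 : ℝ)..1, (p.D.M p.i).shearSq (p.δ * s) p.u₀ θ
      = ∫ s in (0 : ℝ)..1, 2 * (p.δ⁻¹ * p.δ⁻¹) * p.source (s, θ) := by
    refine intervalIntegral.integral_congr fun s hs => ?_
    rw [uIcc_of_le zero_le_one] at hs
    exact p.shearSq_eq (x := (s, θ)) (mem_strip.2 hs)
  rw [h3, intervalIntegral.integral_const_mul] at h2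
  simp only [mul_zero, mul_one, smul_eq_mul] at h2
  rw [← h2, p.abs_u₀] at h1
  have e : prim p.source (1, θ) = ∫ s in (0 : ℝ)..1, p.source (s, θ) := rfl
  rw [e, p.ε_sq]
  field_simp at h1 ⊢
  linarith

/-- The difference of the source and its leading part. -/
noncomputable def rest : Strip → ℝ := fun x => p.source x
    - (1 / 8) * p.ε ^ 2 * ∑ A, ∑ B, dS (p.seed A B) x ^ 2

lemma contDiff_rest : ContDiff ℝ ∞ p.rest := by
  refine p.contDiff_source.sub (contDiff_const.mul ?_)
  refine ContDiff.sum fun A _ => ContDiff.sum fun B _ => ?_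
  exact (contDiff_dirD (p.contDiff_seed A B) _).pow 2

/-- The two normalizations of the energy agree to leading order, since `(ε² / 8) · 16 m₀ = 2 m₀ ε²`.
-/
lemma prim_source_of_seed (h : p.S.Energy p.m₀) (θ : Fin 2 → ℝ) :
    prim p.source (1, θ) = 2 * p.m₀ * p.ε ^ 2 + prim p.rest (1, θ) := by
  have h1 := h p.i θ
  have h2 : ∫ s in (0 : ℝ)..1, ∑ A, ∑ B, deriv (fun t => p.S.ψ p.i t θ A B) s ^ 2
      = ∫ s in (0 : ℝ)..1, ∑ A, ∑ B, dS (p.seed A B) (s, θ) ^ 2 := by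
    refine intervalIntegral.integral_congr fun s hs => ?_
    rw [uIcc_of_le zero_le_one] at hs
    refine Finset.sum_congr rfl fun A _ => Finset.sum_congr rfl fun B _ => ?_
    congr 1
    exact ((Sm.of_contDiff (p.contDiff_seed A B)).hasDerivAt hs).deriv
  rw [h2] at h1
  have hc : Continuous fun s => p.source (s, θ) := p.contDiff_source.continuous.comp (by fun_prop)
  have hd : Continuous fun s => ∑ A, ∑ B, dS (p.seed A B) (s, θ) ^ 2 :=
    continuous_finsetSum _ fun A _ => continuous_finsetSum _ fun B _ =>
      ((contDiff_dirD (p.contDiff_seed A B) vS).continuous.comp (by fun_prop)).pow 2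
  have h3 : prim p.rest (1, θ) = prim p.source (1, θ) - (1 / 8) * p.ε ^ 2 * (16 * p.m₀) := by
    rw [← h1, ← intervalIntegral.integral_const_mul]
    simp only [prim, rest]
    exact intervalIntegral.integral_sub (hc.intervalIntegrable _ _)
      ((continuous_const.mul hd).intervalIntegrable _ _)
  rw [h3]; ring

/-- The deviation of the expansion from its Schwarzschild value, up to a constant. -/
noncomputable def X : Strip → ℝ := slice fun x => p.T x - p.μ + 2 * p.m₀ * p.ε ^ 2

/-- The error in the energy. -/
noncomputable def V : Strip → ℝ := slice fun x => prim p.source x - 2 * p.m₀ * p.ε ^ 2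

lemma X_eq (x : Strip) : p.X x = slice p.W x - p.V x := by
  simp only [X, V, slice, W]; ring

lemma V_eq : p.V = 0 ∨ p.V = slice (prim p.rest) := by
  rcases p.energy with h | h
  · left; ext x; simp [V, slice, p.prim_source_of_shear h]
  · right; ext x; simp [V, slice, p.prim_source_of_seed h]

lemma trchi_late (θ : Fin 2 → ℝ) : p.M.trchi (p.pos (1, θ)) - (2 / |p.u₀| - 4 * p.m₀ / |p.u₀| ^ 2)
    = 2 * p.δ⁻¹ * p.X (1, θ) := by
  have hL := p.L_pos
  have hδ := p.hδ
  rw [p.trchi_eq (mem_strip_one θ), p.abs_u₀]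
  simp only [X, slice, μ, p.ε_sq]
  field_simp
  ring

lemma Sy_init (θ : Fin 2 → ℝ) : p.Sy (0, θ) = - (4 * p.L * (rf (0, θ) * rf (0, θ))) := by
  have hy : ∀ A B, p.yy A B (0, θ) = 2 * p.u₀ * (rf (0, θ) ^ 2 * (1 : Matrix (Fin 2) (Fin 2) ℝ) A B) :=
    p.gs_one_init θ
  simp only [Sy, hy, Fin.sum_univ_two, Ei, p.E_zero, show p.u₀ = -p.L by simp [L]]
  simp
  ring

end PulseData


/-! ### Comparison of the weights -/

namespace PulseData

variable (p : PulseData)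

lemma μ_pos : 0 < p.μ := div_pos p.hδ p.L_pos

lemma μ_le_one : p.μ ≤ 1 := by
  rw [μ, div_le_one p.L_pos]; linarith [p.L_gt, p.hδ1]

lemma sqrt_pos : 0 < Real.sqrt p.δ := Real.sqrt_pos.2 p.hδ

lemma sqrt_mul_self : Real.sqrt p.δ * Real.sqrt p.δ = p.δ := Real.mul_self_sqrt p.hδ.le

lemma δ_le_sqrt : p.δ ≤ Real.sqrt p.δ := by
  nlinarith [p.sqrt_mul_self, p.sqrt_le_one, p.sqrt_pos]

lemma ε_mul_ε : p.ε * p.ε = p.δ / p.L ^ 2 := by rw [← p.ε_sq]; ring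

/-- A larger sphere only helps, as `L > 1`. Together with `μ ≤ ε`, which uses `δ ≤ 1`, this orders
all weights along the cone. -/
lemma ε_mul_ε_le_μ : p.ε * p.ε ≤ p.μ := by
  have hL := p.L_gt
  have hδ := p.hδ
  rw [p.ε_mul_ε, μ]
  refine div_le_div_of_nonneg_left hδ.le p.L_pos (by nlinarith)

lemma μ_le_ε : p.μ ≤ p.ε := by
  rw [μ, ε]
  exact div_le_div_of_nonneg_right p.δ_le_sqrt p.L_pos.le

/-- The weight of the error in the expansion. -/
noncomputable def wX : ℝ := p.δ * Real.sqrt p.δ / p.L ^ 2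

lemma wX_pos : 0 < p.wX := by
  have := p.hδ; have := p.sqrt_pos; have := p.L_pos; unfold wX; positivity

lemma μ_mul_μ_le : p.μ * p.μ ≤ p.wX := by
  have hL := p.L_pos
  have hδ := p.hδ
  have h : p.μ * p.μ = p.δ * p.δ / p.L ^ 2 := by unfold μ; field_simp
  rw [h, wX]
  have := p.δ_le_sqrt
  gcongr

lemma μ_mul_ε : p.μ * p.ε = p.wX := by unfold μ ε wX; field_simp

lemma ε_cube_le : p.ε * (p.ε * p.ε) ≤ p.wX := by
  have h : p.ε * (p.ε * p.ε) ≤ p.ε * p.μ := by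
    have := p.ε_pos; have := p.ε_mul_ε_le_μ; gcongr
  rw [← p.μ_mul_ε]; linarith

end PulseData

/-! ### Uniform bounds along the initial cone -/

section Bounds

variable {ι : Type*} {P : ι → PulseData}

/-- The initial expansions of a family. -/
noncomputable def mu (P : ι → PulseData) : ι → ℝ := fun j => (P j).μ

/-- The weight of the error in the expansion of a family. -/
noncomputable def wX (P : ι → PulseData) : ι → ℝ := fun j => (P j).wX

variable {n : ℕ} {f g : ι → Strip → ℝ}

lemma Bd.mul_right_one {κ : ι → ℝ} (hf : Bd κ n f) (hg : Bd (fun _ => 1) n g) :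
    Bd κ n fun p x => f p x * g p x := by
  simpa using hf.mul hg

lemma Bd.mu_to_one (h : Bd (mu P) n f) : Bd (fun _ => 1) n f :=
  h.weaken 1 fun j => by rw [mu, abs_of_pos (P j).μ_pos, _root_.mul_one]; exact (P j).μ_le_one

lemma Bd.mu_to_amp (h : Bd (mu P) n f) : Bd (amp P) n f :=
  h.weaken 1 fun j => by rw [mu, amp, abs_of_pos (P j).μ_pos, _root_.one_mul]; exact (P j).μ_le_ε

lemma Bd.amp_amp_to_mu (h : Bd (fun j => amp P j * amp P j) n f) : Bd (mu P) n f :=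
  h.weaken 1 fun j => by
    have := (P j).ε_pos
    rw [mu, amp, abs_of_pos (by positivity), _root_.one_mul]; exact (P j).ε_mul_ε_le_μ

lemma Bd.mu_const (n : ℕ) : Bd (mu P) n fun j _ => (P j).μ :=
  Bd.const_fun _ 1 (fun j => by rw [abs_of_pos (P j).μ_pos, one_mul]; rfl) n

/-- Control of the seeds of a family. -/
structure SeedBd (P : ι → PulseData) (n : ℕ) : Prop where
  seed : ∀ A B, Bd (fun _ => 1) n fun j => (P j).seed A B
  dS_seed : ∀ A B, Bd (fun _ => 1) n fun j => dS ((P j).seed A B)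

namespace SeedBd

lemma mono {m : ℕ} (h : SeedBd P n) (hm : m ≤ n) : SeedBd P m :=
  ⟨fun A B => (h.seed A B).mono hm, fun A B => (h.dS_seed A B).mono hm⟩

variable (h : SeedBd P n)

include h

lemma source : Bd (mu P) n fun j => (P j).source := (bd_source h.seed h.dS_seed).amp_amp_to_mu

/-- The equation is linear in `φ` with bounded coefficient, so the upper bound comes before any
positive lower bound is known; `exists_lower` relies on this order. -/
lemma φ : Bd (fun _ => 1) n fun j => (P j).φ :=
  Bd.ode (fun j => (P j).sm_φ) h.source.mu_to_one.neg (Bd.zero _ n) (fun _ => 1)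
    (fun j => (P j).μ) 1 (by simp)
    (fun j => by rw [abs_of_pos (P j).μ_pos, mul_one]; exact (P j).μ_le_one)
    (fun j θ => (P j).φ_init θ) (fun j θ => (P j).dS_φ_init θ)
    (fun j x hx => by rw [(P j).φ_ode hx, add_zero])

lemma dS_φ : Bd (mu P) n fun j => dS (P j).φ := by
  have h1 : Bd (mu P) n fun j x => dS (P j).φ x - (P j).μ := by
    refine Bd.integrate (fun j => ((P j).sm_φ.dirD _).sub (Sm.const _))
      (fun j θ => by simp [(P j).dS_φ_init, PulseData.μ]) ?_
    refine (h.source.neg.mul_one' h.φ).congr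
      (fun j => (((P j).sm_φ.dirD _).sub (Sm.const _)).dirD _) (fun j x hx => ?_)
    rw [dirD_sub _ ((P j).sm_φ.dirD _) (Sm.const _) hx, dirD_const, (P j).φ_ode hx]
    ring
  refine (h1.add (Bd.mu_const n)).congr (fun j => (P j).sm_φ.dirD _) (fun j x _ => ?_)
  ring

lemma φ_sub_one : Bd (mu P) n fun j x => (P j).φ x - 1 := by
  refine Bd.integrate (fun j => (P j).sm_φ.sub (Sm.const _)) (fun j θ => by simp [(P j).φ_init]) ?_
  refine h.dS_φ.congr (fun j => ((P j).sm_φ.sub (Sm.const _)).dirD _) (fun j x hx => ?_)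
  rw [dirD_sub _ (P j).sm_φ (Sm.const _) hx, dirD_const, sub_zero]

end SeedBd

/-- Control of the seeds and nondegeneracy of the conformal factors of a family. -/
structure PulseBd (P : ι → PulseData) (n : ℕ) : Prop extends SeedBd P n where
  lower : ∀ j, ∀ x ∈ disc, 1 / 2 ≤ (P j).φ x

namespace PulseBd

lemma mono {m : ℕ} (h : PulseBd P n) (hm : m ≤ n) : PulseBd P m :=
  ⟨h.toSeedBd.mono hm, h.lower⟩

section

variable (h : PulseBd P n)

include h

lemma inv_φ : Bd (fun _ => 1) n fun j x => ((P j).φ x)⁻¹ :=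
  h.φ.inv (fun j x hx => ((P j).φ_pos hx).ne') (1 / 2) (by norm_num)
    fun j x hx => (h.lower j x hx).trans (le_abs_self _)

lemma inv_sq_φ : Bd (fun _ => 1) n fun j x => ((P j).φ x)⁻¹ * ((P j).φ x)⁻¹ :=
  h.inv_φ.mul_one h.inv_φ

lemma T : Bd (mu P) n fun j => (P j).T := h.dS_φ.mul_one' h.inv_φ |>.congr
  (fun j => (P j).sm_T) (fun j x _ => by simp only [PulseData.T]; ring)

lemma area : Bd (fun _ => 1) n fun j => (P j).area :=
  (h.φ.mul_one h.φ).mul_one (Bd.fixed (contDiff_rf.mul contDiff_rf) n)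

lemma inv_area : Bd (fun _ => 1) n fun j x => ((P j).area x)⁻¹ := by
  have hq : ContDiff ℝ ∞ fun x : Strip => (1 + eucSq x.2 / 4) * (1 + eucSq x.2 / 4) := by
    unfold eucSq; fun_prop
  refine (h.inv_sq_φ.mul_one (Bd.fixed hq n)).congr
    (fun j => (P j).sm_area'.inv fun x hx => ((P j).area_pos' hx).ne') (fun j x hx => ?_)
  simp only [PulseData.area, rf, roundFactor, mul_inv, inv_inv]

lemma E (A B : Fin 2) : Bd (fun _ => 1) n fun j => (P j).E A B := bd_E h.seed A B

lemma Ei (A B : Fin 2) : Bd (fun _ => 1) n fun j => (P j).Ei A B := by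
  revert A B
  refine Fin.forall_fin_two.2 ⟨Fin.forall_fin_two.2 ⟨h.E 1 1, (h.E 0 1).neg⟩,
    Fin.forall_fin_two.2 ⟨(h.E 0 1).neg, h.E 0 0⟩⟩

lemma gh (A B : Fin 2) : Bd (fun _ => 1) n fun j => (P j).gh A B := h.area.mul_one (h.E A B)

lemma gi (A B : Fin 2) : Bd (fun _ => 1) n fun j => (P j).gi A B := h.inv_area.mul_one (h.Ei A B)

/-- The shear has size `ε` and dominates the expansion, of size `μ ≤ ε`. -/
lemma dS_gh (A B : Fin 2) : Bd (amp P) n fun j => dS ((P j).gh A B) := by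
  refine (h.area.mul_one (((h.T.mu_to_amp.const_mul 2).mul_one' (h.E A B)).add
    (bd_dS_E h.seed h.dS_seed A B))).congr (fun j => ((P j).sm_gh A B).dirD _) (fun j x hx => ?_)
  rw [(P j).dS_gh' hx]
  simp only [PulseData.area]; ring

end

section

variable (h : PulseBd P (n + 1))

include h

lemma Fh (C A B : Fin 2) : Bd (fun _ => 1) n fun j => (P j).Fh C A B :=
  ((((h.gh B C).ang A).add ((h.gh A C).ang B)).sub ((h.gh A B).ang C)).const_mul _

lemma dS_dT_gh (A B C : Fin 2) : Bd (amp P) n fun j => dS (dT C ((P j).gh A B)) :=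
  ((h.dS_gh A B).ang C).congr (fun j => (((P j).sm_gh A B).dirD _).dirD _)
    (fun j _ hx => ((P j).sm_gh A B).dirD_comm _ _ hx)

lemma J (A : Fin 2) : Bd (amp P) n fun j => (P j).J A := by
  have h0 := h.mono (Nat.le_succ n)
  exact (Bd.sum fun B _ => Bd.sum fun C _ => (h0.gi B C).mul_one
    ((((h.dS_dT_gh B A C).sub (h.dS_dT_gh B C A)).const_mul (1 / 2)).sub
      ((Bd.sum fun D _ => Bd.sum fun E _ => (h0.gi D E).mul_one
        (((h.Fh D B C).mul_one (h0.dS_gh E A)).sub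
          ((h0.dS_gh D C).mul_right_one (h.Fh E B A)))).const_mul (1 / 2)))).const_mul 4

/-- The integrating factor `φ²` absorbs the term `-2 T z`, so that `(φ² z)' = φ² J` is simply
integrated from zero. -/
lemma tw (A : Fin 2) : Bd (amp P) n fun j => (P j).tw A := by
  have h0 := h.mono (Nat.le_succ n)
  have sm : ∀ j, Sm fun x => (P j).φ x * (P j).φ x * (P j).tw A x := fun j =>
    ((P j).sm_φ.mul (P j).sm_φ).mul ((P j).sm_tw A)
  have h1 : Bd (amp P) n fun j x => (P j).φ x * (P j).φ x * (P j).tw A x := by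
    refine Bd.integrate sm (fun j θ => by simp [PulseData.tw, (P j).twist_init]) ?_
    refine ((h0.φ.mul_one h0.φ).mul_one (h.J A)).congr (fun j => (sm j).dirD _) (fun j x hx => ?_)
    rw [dirD_mul _ ((P j).sm_φ.mul (P j).sm_φ) ((P j).sm_tw A) hx,
      dirD_mul _ (P j).sm_φ (P j).sm_φ hx, (P j).dS_tw hx, PulseData.T]
    have := ((P j).φ_pos hx).ne'
    field_simp
    ring
  refine (h0.inv_sq_φ.mul_one h1).congr (fun j => (P j).sm_tw A) (fun j x hx => ?_)
  have := ((P j).φ_pos hx).ne'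
  field_simp

end

section

variable (h : PulseBd P (n + 2))

include h

lemma curvS (C A D B : Fin 2) : Bd (fun _ => 1) n fun j => (P j).curvS C A D B := by
  have h0 := h.mono (Nat.le_add_right n 2)
  have h1 := h.mono (Nat.le_succ (n + 1))
  exact ((((((h.gh B C).ang A).ang D).sub (((h.gh B A).ang C).ang D)).sub
    (((h.gh D C).ang A).ang B)).add (((h.gh D A).ang C).ang B)).const_mul (1 / 2) |>.sub
    (Bd.sum fun E _ => Bd.sum fun F _ => (h0.gi E F).mul_one
      (((h1.Fh E D C).mul_one (h1.Fh F B A)).sub ((h1.Fh E B C).mul_one (h1.Fh F D A))))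

lemma scal : Bd (fun _ => 1) n fun j => (P j).scal := by
  have h0 := h.mono (Nat.le_add_right n 2)
  exact Bd.sum fun A _ => Bd.sum fun B _ => Bd.sum fun C _ => Bd.sum fun D _ =>
    ((h0.gi A B).mul_one (h0.gi C D)).mul_one (h.curvS D B C A)

lemma divT : Bd (fun _ => 1) n fun j => (P j).divT := by
  have h0 := h.mono (Nat.le_add_right n 2)
  have h1 := h.mono (Nat.le_succ (n + 1))
  exact Bd.sum fun A _ => Bd.sum fun B _ => (h0.gi A B).mul_one
    (((h.tw A).ang B).amp_to_one.sub (Bd.sum fun C _ => Bd.sum fun D _ =>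
      (h0.gi C D).mul_one ((h1.tw C).amp_to_one.mul_one (h1.Fh D A B))))

lemma sqT : Bd (fun _ => 1) n fun j => (P j).sqT := by
  have h0 := h.mono (Nat.le_add_right n 2)
  have h1 := h.mono (Nat.le_succ (n + 1))
  exact Bd.sum fun A _ => Bd.sum fun B _ => (h0.gi A B).mul_one
    ((h1.tw B).amp_to_one.mul_one (h1.tw A).amp_to_one)

/-- The incoming expansion is close to its Minkowskian value. -/
lemma Sy_add : Bd (fun j => (P j).δ) n fun j x => (P j).Sy x + 4 * (P j).L * (rf x * rf x) := by
  have h0 := h.mono (Nat.le_add_right n 2)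
  have sr : ∀ j, Sm fun x => 4 * (P j).L * (rf x * rf x) := fun j =>
    (Sm.const _).mul (sm_rf.mul sm_rf)
  have hδ : Bd (fun j => (P j).δ) n fun j _ => (P j).δ :=
    Bd.const_fun _ 1 (fun j => by rw [abs_of_pos (P j).hδ, one_mul]) n
  refine Bd.integrate (fun j => (P j).sm_Sy.add (sr j)) (fun j θ => by simp [(P j).Sy_init]) ?_
  refine (hδ.mul_one' (h0.area.mul_one (((h.scal.const_mul (-2)).sub h.divT).add
    (h.sqT.const_mul (1 / 4))))).congr (fun j => ((P j).sm_Sy.add (sr j)).dirD _) (fun j x hx => ?_)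
  rw [dirD_add _ (P j).sm_Sy (sr j) hx, dirD_const_mul _ (sm_rf.mul sm_rf) _ hx,
    dirD_mul _ sm_rf sm_rf hx, dS_rf hx, (P j).dS_Sy hx]
  simp only [PulseData.area]; ring

end

section

variable (h : PulseBd P n)

include h

lemma inv_sq_φ_sub_one : Bd (mu P) n fun j x => ((P j).φ x)⁻¹ * ((P j).φ x)⁻¹ - 1 := by
  refine (((h.φ.add (Bd.one_const 1 n)).mul_one h.inv_sq_φ).neg.mul_one h.φ_sub_one).congr
    (fun j => (h.inv_sq_φ.sm j).sub (Sm.const _)) (fun j x hx => ?_)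
  have := ((P j).φ_pos hx).ne'
  field_simp
  ring

lemma W : Bd (fun j => mu P j * mu P j) n fun j => (P j).W :=
  Bd.integrate (fun j => (P j).sm_W) (fun j θ => (P j).W_init θ)
    ((h.T.mul h.T).neg.congr (fun j => (P j).sm_W.dirD _) fun j _ hx => ((P j).dS_W hx).symm)

lemma V : Bd (fun j => amp P j * (amp P j * amp P j)) n fun j => (P j).V := by
  refine Bd.of_or (Bd.slice (Bd.integrate (f := fun j => prim (P j).rest)
    (fun j => Sm.of_contDiff (contDiff_prim (P j).contDiff_rest)) (fun j θ => prim_zero _ θ) ?_))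
    fun j => (P j).V_eq
  exact (bd_source_sub h.seed h.dS_seed).congr
    (fun j => (Sm.of_contDiff (contDiff_prim (P j).contDiff_rest)).dirD _)
    fun j _ hx => (dS_prim (P j).contDiff_rest hx).symm

/-- Two errors add up: `μ²` from the Riccati nonlinearity, and `ε³` from replacing the source by its
leading part. Both are at most `δ^{3/2} L⁻²`. -/
lemma X : Bd (wX P) n fun j => (P j).X := by
  have h1 : Bd (wX P) n fun j => slice (P j).W := h.W.slice.weaken 1 fun j => by
    have := (P j).μ_pos
    rw [mu, wX, abs_of_pos (by positivity), one_mul]; exact (P j).μ_mul_μ_le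
  have h2 : Bd (wX P) n fun j => (P j).V := h.V.weaken 1 fun j => by
    have := (P j).ε_pos
    rw [amp, wX, abs_of_pos (by positivity), one_mul]; exact (P j).ε_cube_le
  have e : (fun j => (P j).X) = fun j x => slice (P j).W x - (P j).V x := by
    ext j x; exact (P j).X_eq x
  rw [e]
  exact h1.sub h2

end

end PulseBd

end Bounds


/-! ### Families of tensor fields on conformally flat surfaces -/

/-- A function of the angles as a function on the strip. -/
def flat (F : (Fin 2 → ℝ) → ℝ) : Strip → ℝ := fun x => F x.2

lemma dT_flat {F : (Fin 2 → ℝ) → ℝ} (h : Sm (flat F)) (A : Fin 2) :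
    dT A (flat F) = flat (pd F A) := by
  have h1 : slice (flat F) = flat F := rfl
  rw [← h1, dT_slice h]
  ext x
  exact h.angular_eq (by simp) A x.2

section Families

variable {ι : Type*} {κ : ι → ℝ} {n : ℕ}

lemma Bd.flat_pd {F : ι → (Fin 2 → ℝ) → ℝ} (h : Bd κ (n + 1) fun j => flat (F j)) (A : Fin 2) :
    Bd κ n fun j => flat (pd (F j) A) := by
  have e : (fun j => flat (pd (F j) A)) = fun j => dT A (flat (F j)) := by
    ext j : 1; exact (dT_flat (h.sm j) A).symm
  rw [e]; exact h.ang A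

/-- Each covariant derivative uses up one of the `k` available coordinate derivatives; `l` is the
number kept in reserve. -/
lemma bd_iterCov {g : ι → (Fin 2 → ℝ) → Matrix (Fin 2) (Fin 2) ℝ} {r : ℕ}
    {T : ι → TensorField (Fin 2) r} (k : ℕ)
    (hg : ∀ c A B, Bd (fun _ => 1) k fun j => flat fun θ => christoffel (g j) θ c A B)
    (hT : ∀ a, Bd κ k fun j => flat fun θ => T j θ a) :
    ∀ m l, m + l ≤ k → ∀ a, Bd κ l fun j => flat fun θ => iterCov (g j) (T j) m θ a := by
  intro m
  induction m with
  | zero => exact fun l hl a => (hT a).mono (by omega)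
  | succ m ih =>
    intro l hl a
    have h1 := (ih (l + 1) (by omega) (Fin.tail a)).flat_pd (a 0)
    have h2 := Bd.sum (s := Finset.univ) fun (j : Fin (r + m)) _ =>
      Bd.sum (s := Finset.univ) fun (d : Fin 2) _ =>
        ((hg d (a 0) (Fin.tail a j)).mono (show l ≤ k by omega)).mul_one
          (ih l (by omega) (Function.update (Fin.tail a) j d))
    exact h1.sub h2

lemma normSq_smul_one_le {w D : ℝ} {r : ℕ} {g : (Fin 2 → ℝ) → Matrix (Fin 2) (Fin 2) ℝ}
    {T : TensorField (Fin 2) r} {θ : Fin 2 → ℝ} (hw : 0 < w) (hg : g θ = w • 1)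
    (hT : ∀ a, |T θ a| ≤ D) : normSq g T θ ≤ (2 ^ r) ^ 2 * (w⁻¹ ^ r * D ^ 2) := by
  have hi : (g θ)⁻¹ = w⁻¹ • 1 := by
    rw [hg]
    refine Matrix.inv_eq_right_inv ?_
    rw [smul_mul_smul_comm, mul_inv_cancel₀ hw.ne', one_mul, one_smul]
  have h1 : ∀ a c : Fin r → Fin 2, (∏ j, (g θ)⁻¹ (a j) (c j)) * T θ a * T θ c
      ≤ w⁻¹ ^ r * D ^ 2 := by
    intro a c
    have h2 : |∏ j, (g θ)⁻¹ (a j) (c j)| ≤ w⁻¹ ^ r := by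
      rw [Finset.abs_prod]
      refine (Finset.prod_le_prod (g := fun _ => w⁻¹) (fun _ _ => abs_nonneg _)
        fun j _ => ?_).trans (by simp)
      rw [hi, Matrix.smul_apply, smul_eq_mul, abs_mul, abs_of_pos (inv_pos.2 hw)]
      refine mul_le_of_le_one_right (inv_pos.2 hw).le ?_
      rw [Matrix.one_apply]; split_ifs <;> simp
    calc _ ≤ |(∏ j, (g θ)⁻¹ (a j) (c j)) * T θ a * T θ c| := le_abs_self _
      _ = |∏ j, (g θ)⁻¹ (a j) (c j)| * |T θ a| * |T θ c| := by rw [abs_mul, abs_mul]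
      _ ≤ w⁻¹ ^ r * D * D := by
        have := (abs_nonneg _).trans (hT a)
        gcongr
        exacts [hT a, hT c]
      _ = _ := by ring
  calc normSq g T θ ≤ ∑ _a : Fin r → Fin 2, ∑ _c : Fin r → Fin 2, w⁻¹ ^ r * D ^ 2 :=
        Finset.sum_le_sum fun a _ => Finset.sum_le_sum fun c _ => h1 a c
    _ = _ := by simp; ring

/-- The constant factor `l` cancels: the connection does not see the size of the sphere, so
covariant derivatives are bounded uniformly in it. -/
lemma christoffel_smul_one {g : (Fin 2 → ℝ) → Matrix (Fin 2) (Fin 2) ℝ} {l : ℝ}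
    {w : (Fin 2 → ℝ) → ℝ} (hl : 0 < l) (hw : ∀ θ, 0 < w θ) (hd : Differentiable ℝ w)
    (hg : ∀ θ, g θ = (l * w θ) • 1) (θ : Fin 2 → ℝ) (c A B : Fin 2) : christoffel g θ c A B
      = (1 / 2) * ∑ D, (w θ)⁻¹ * (1 : Matrix (Fin 2) (Fin 2) ℝ) c D
        * ((1 : Matrix (Fin 2) (Fin 2) ℝ) B D * pd w A θ
          + (1 : Matrix (Fin 2) (Fin 2) ℝ) A D * pd w B θ
          - (1 : Matrix (Fin 2) (Fin 2) ℝ) A B * pd w D θ) := by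
  have hi : (g θ)⁻¹ = (l * w θ)⁻¹ • 1 := by
    rw [hg]
    refine Matrix.inv_eq_right_inv ?_
    rw [smul_mul_smul_comm, mul_inv_cancel₀ (mul_pos hl (hw θ)).ne', one_mul, one_smul]
  have hp : ∀ A B C, pd (fun y => g y A B) C θ
      = l * ((1 : Matrix (Fin 2) (Fin 2) ℝ) A B * pd w C θ) := by
    intro A B C
    have e : (fun y => g y A B) = fun y => (l * (1 : Matrix (Fin 2) (Fin 2) ℝ) A B) * w y := by
      ext y; rw [hg]; simp; ring
    rw [e, pd, fderiv_const_mul (hd θ)]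
    simp [pd]; ring
  simp only [christoffel, hi, hp]
  congr 1
  refine Finset.sum_congr rfl fun D _ => ?_
  have := (hw θ).ne'
  simp only [Matrix.smul_apply, smul_eq_mul]
  field_simp

/-- Covariant derivatives of a family of tensor fields on conformally flat surfaces of size `L`. -/
lemma covNorm_le {g : ι → (Fin 2 → ℝ) → Matrix (Fin 2) (Fin 2) ℝ} {L : ι → ℝ}
    {w : ι → (Fin 2 → ℝ) → ℝ} {r : ℕ} {T : ι → TensorField (Fin 2) r} (k : ℕ)
    (hL : ∀ j, 0 < L j) (hw : ∀ j θ, 0 < w j θ) (hg : ∀ j θ, g j θ = (L j ^ 2 * w j θ) • 1)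
    (hwb : Bd (fun _ => 1) (k + 1) fun j => flat (w j))
    (hwi : Bd (fun _ => 1) k fun j x => (flat (w j) x)⁻¹) (hκ : ∀ j, 0 < κ j)
    (hT : ∀ a, Bd κ k fun j => flat fun θ => T j θ a) :
    ∃ C, 0 ≤ C ∧ ∀ j θ, eucSq θ ≤ 4 →
      covNorm (g j) (T j) k θ ≤ C * (κ j * (L j)⁻¹ ^ (r + k)) := by
  have hd : ∀ j, Differentiable ℝ (w j) := fun j θ => by
    have h1 : DifferentiableAt ℝ (flat (w j)) ((1 : ℝ), θ) :=
      (hwb.sm j).diff (mem_strip.2 (by simp))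
    have h2 : DifferentiableAt ℝ (fun θ : Fin 2 → ℝ => ((1 : ℝ), θ)) θ := by fun_prop
    exact h1.comp θ h2
  have hΓ : ∀ c A B, Bd (fun _ => 1) k fun j => flat fun θ => christoffel (g j) θ c A B := by
    intro c A B
    have e : (fun j => flat fun θ => christoffel (g j) θ c A B) = fun j x =>
        (1 / 2) * ∑ D, (flat (w j) x)⁻¹ * (1 : Matrix (Fin 2) (Fin 2) ℝ) c D
        * ((1 : Matrix (Fin 2) (Fin 2) ℝ) B D * flat (pd (w j) A) x
          + (1 : Matrix (Fin 2) (Fin 2) ℝ) A D * flat (pd (w j) B) x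
          - (1 : Matrix (Fin 2) (Fin 2) ℝ) A B * flat (pd (w j) D) x) := by
      ext j x
      exact christoffel_smul_one (by have := hL j; positivity) (hw j) (hd j) (hg j) x.2 c A B
    rw [e]
    exact (Bd.sum fun D _ => (hwi.mul_one (Bd.one_const _ k)).mul_one
      ((((hwb.flat_pd A).const_mul _).add ((hwb.flat_pd B).const_mul _)).sub
        ((hwb.flat_pd D).const_mul _))).const_mul _
  have hI := fun a => (bd_iterCov k hΓ hT k 0 le_rfl a).bound
  choose C hC using hI
  obtain ⟨Cw, hCw⟩ := hwi.bound
  set D := ∑ a, |C a| with hD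
  -- The square root of the bound for the squared length: there are `(2^(r+k))²` pairs of
  -- multi-indices, and each of the `r + k` contractions contributes `1/w`, which is at most `(1 +
  -- |Cw|)²`.
  set K : ℝ := 2 ^ (r + k) * ((1 + |Cw|) ^ (r + k) * D) with hK
  have hD0 : 0 ≤ D := Finset.sum_nonneg fun a _ => abs_nonneg _
  refine ⟨K, by positivity, fun j θ hθ => ?_⟩
  have hx : ((1 : ℝ), θ) ∈ disc := ⟨by simp, hθ⟩
  have hκ := hκ j
  have hL := hL j
  have hwj := hw j θ
  have hTb : ∀ a, |iterCov (g j) (T j) k θ a| ≤ D * κ j := fun a => by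
    refine (hC a j _ hx).trans ?_
    gcongr
    exact (le_abs_self _).trans (Finset.single_le_sum (f := fun a => |C a|)
      (fun a _ => abs_nonneg _) (Finset.mem_univ a))
  have h1 := normSq_smul_one_le (by positivity) (hg j θ) hTb
  refine Real.sqrt_le_iff.2 ⟨by positivity, h1.trans ?_⟩
  have h2 : (w j θ)⁻¹ ≤ (1 + |Cw|) ^ 2 := by
    have := hCw j _ hx
    simp only [flat, mul_one] at this
    nlinarith [le_abs_self (w j θ)⁻¹, le_abs_self Cw, abs_nonneg Cw]
  have h3 : (w j θ)⁻¹ ^ (r + k) ≤ ((1 + |Cw|) ^ 2) ^ (r + k) := by gcongr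
  calc (2 ^ (r + k)) ^ 2 * ((L j ^ 2 * w j θ)⁻¹ ^ (r + k) * (D * κ j) ^ 2)
      = (2 ^ (r + k)) ^ 2 * ((L j)⁻¹ ^ (r + k)) ^ 2 * (D * κ j) ^ 2 * (w j θ)⁻¹ ^ (r + k) := by
        rw [mul_inv, mul_pow, ← inv_pow, ← pow_mul, ← pow_mul, mul_comm 2 (r + k)]; ring
    _ ≤ (2 ^ (r + k)) ^ 2 * ((L j)⁻¹ ^ (r + k)) ^ 2 * (D * κ j) ^ 2
        * ((1 + |Cw|) ^ 2) ^ (r + k) := by gcongr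
    _ = _ := by rw [hK, ← pow_mul (1 + |Cw|), mul_comm 2 (r + k), pow_mul (1 + |Cw|)]; ring

end Families

/-! ### The four estimates on the final sphere -/

section Bounds

variable {ι : Type*} {P : ι → PulseData} {n : ℕ}

/-- The weights of the final estimates. -/
noncomputable def wF (P : ι → PulseData) : ι → ℝ := fun j => Real.sqrt (P j).δ / (P j).L ^ 2

lemma wF_pos (j : ι) : 0 < wF P j := by
  have := (P j).sqrt_pos; have := (P j).L_pos; unfold wF; positivity

lemma Bd.wX_to_wF {f : ι → Strip → ℝ} (h : Bd (wX P) n f) :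
    Bd (wF P) n fun j x => (P j).δ⁻¹ * f j x :=
  (h.smul fun j => (P j).δ⁻¹).weaken 1 fun j => by
    have h1 := (P j).wX_pos; have h2 := (P j).hδ
    rw [abs_of_pos (inv_pos.2 h2), wX, abs_of_pos (by positivity), wF, PulseData.wX, _root_.one_mul]
    have := (P j).L_pos
    field_simp
    exact le_rfl

namespace PulseBd

lemma trchi (h : PulseBd P n) : Bd (wF P) n fun j => flat fun θ =>
    (P j).M.trchi ((P j).pos (1, θ)) - (2 / |(P j).u₀| - 4 * (P j).m₀ / |(P j).u₀| ^ 2) := by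
  have e : ∀ j, (flat fun θ => (P j).M.trchi ((P j).pos (1, θ))
      - (2 / |(P j).u₀| - 4 * (P j).m₀ / |(P j).u₀| ^ 2)) = fun x => 2 * ((P j).δ⁻¹ * (P j).X x) := by
    intro j; ext x
    rw [flat, (P j).trchi_late, mul_assoc]; rfl
  simp only [e]
  exact h.X.wX_to_wF.const_mul 2

/-- On the final sphere `T` and `X` differ by a constant, so `∂T = ∂X`. This is where the isotropy
of the energy makes `β` small. The remaining term has size `δ⁻¹ μ ε`, the same weight. -/
lemma beta (h : PulseBd P (n + 1)) (A : Fin 2) : Bd (wF P) n fun j => flat fun θ =>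
    (P j).M.beta ((P j).pos (1, θ)) A := by
  have h0 := h.mono (Nat.le_succ n)
  have h1 : Bd (wX P) n fun j => slice fun x => (P j).T x * (P j).tw A x :=
    (h0.T.mul (h.tw A)).slice.weaken 1 fun j => by
      have := (P j).μ_pos; have := (P j).ε_pos
      rw [mu, amp, wX, abs_of_pos (by positivity), one_mul, (P j).μ_mul_ε]
  have e : ∀ j, (flat fun θ => (P j).M.beta ((P j).pos (1, θ)) A) = fun x =>
      (P j).δ⁻¹ * (dT A (P j).X x + (1 / 4) * slice (fun x => (P j).T x * (P j).tw A x) x) := by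
    intro j; ext x
    have hs := (P j).sm_T
    rw [flat, (P j).beta_late, PulseData.X,
      dT_slice ((hs.sub (Sm.const _)).add (Sm.const (2 * (P j).m₀ * (P j).ε ^ 2)))]
    have hx := mem_strip.2 (show ((1 : ℝ), x.2).1 ∈ Icc (0 : ℝ) 1 by simp)
    simp only [slice]
    rw [dirD_add _ (hs.sub (Sm.const _)) (Sm.const _) hx, dirD_sub _ hs (Sm.const _) hx,
      dirD_const, dirD_const]
    ring
  simp only [e]
  exact ((h.X.ang A).add (h1.const_mul _)).wX_to_wF

/-- The torsion has size `ε`, and the factor `L⁻²` gives exactly `δ^{1/2} L⁻³`. -/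
lemma sigma (h : PulseBd P (n + 2)) : Bd (fun j => wF P j * (P j).L⁻¹) n fun j => flat fun θ =>
    (P j).M.sigma ((P j).pos (1, θ)) := by
  have h0 := h.mono (Nat.le_add_right n 2)
  have h1 := (h0.inv_area.mul_one (((h.tw 1).ang 0).sub ((h.tw 0).ang 1))).slice
  have h2 := (h1.smul fun j => (1 / 4) * ((P j).L ^ 2)⁻¹).weaken
    (κ' := fun j => wF P j * (P j).L⁻¹) 1 fun j => by
      have := (P j).ε_pos; have hL := (P j).L_pos; have := (P j).sqrt_pos
      rw [amp, abs_of_pos (by positivity), abs_of_pos (by positivity), wF, PulseData.ε]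
      field_simp
      norm_num
  have e : ∀ j, (flat fun θ => (P j).M.sigma ((P j).pos (1, θ))) = fun x =>
      (1 / 4) * ((P j).L ^ 2)⁻¹ * slice (fun x => ((P j).area x)⁻¹
        * (dT 0 ((P j).tw 1) x - dT 1 ((P j).tw 0) x)) x := by
    intro j; ext x
    rw [flat, (P j).sigma_late]; rfl
  simp only [e]
  exact h2

/-- To leading order the scalar curvature is `2` and the weighted incoming expansion divided by the
area is `-4 L`, so `ρ` is close to `-L⁻² + δ⁻¹ L⁻¹ T`. Inserting `T = μ - 2 m₀ ε² + X` leaves `-2 m₀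
L⁻³` and three errors: from the scalar curvature, from the incoming expansion and from `X`. -/
lemma rho (h : PulseBd P (n + 2)) : Bd (fun j => wF P j * (P j).L⁻¹) n fun j => flat fun θ =>
    (P j).M.rho ((P j).pos (1, θ)) + 2 * (P j).m₀ / |(P j).u₀| ^ 3 := by
  have h0 := h.mono (Nat.le_add_right n 2)
  have hS : Bd (mu P) n fun j => slice fun x =>
      2 * (((P j).φ x)⁻¹ * ((P j).φ x)⁻¹ - 1) - 2 * (((P j).area x)⁻¹
        * (((P j).φ x)⁻¹ * ((P j).φ x)⁻¹)
        * ∑ A, ((P j).φ x * dT A (dT A (P j).φ) x - dT A (P j).φ x * dT A (P j).φ x)) := by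
    have hd : ∀ A, Bd (mu P) (n + 1) fun j => dT A (P j).φ := fun A =>
      (h.φ_sub_one.ang A).congr (fun j => (P j).sm_φ.dirD _) (fun j x hx => by
        rw [dirD_sub _ (P j).sm_φ (Sm.const _) hx, dirD_const, sub_zero])
    have hd0 : ∀ A, Bd (mu P) n fun j => dT A (P j).φ := fun A => (hd A).of_succ
    exact ((h0.inv_sq_φ_sub_one.const_mul 2).sub (((h0.inv_area.mul_one h0.inv_sq_φ).mul_one
      (Bd.sum fun A _ => (h0.φ.mul_one ((hd A).ang A)).sub
        ((hd0 A).mu_to_one.mul_one (hd0 A)))).const_mul 2)).slice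
  have hZ : Bd (fun j => (P j).δ) n fun j => slice fun x =>
      ((P j).area x)⁻¹ * ((P j).Sy x + 4 * (P j).L * (rf x * rf x))
        - 4 * ((P j).L * (((P j).φ x)⁻¹ * ((P j).φ x)⁻¹ - 1)) := by
    have h1 := (h0.inv_sq_φ_sub_one.smul fun j => (P j).L).weaken (κ' := fun j => (P j).δ) 1
      fun j => by
        have := (P j).μ_pos; have hL := (P j).L_pos
        rw [mu, abs_of_pos hL, abs_of_pos (by positivity), PulseData.μ]
        field_simp
        exact le_rfl
    exact ((h0.inv_area.mul_one h.Sy_add).sub (h1.const_mul 4)).slice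
  have w1 := (hS.smul fun j => -(1 / 2) * ((P j).L ^ 2)⁻¹).weaken
    (κ' := fun j => wF P j * (P j).L⁻¹) 1 fun j => by
      have := (P j).μ_pos; have hL := (P j).L_pos; have hs := (P j).sqrt_pos
      rw [mu, abs_of_neg (a := -(1 / 2) * ((P j).L ^ 2)⁻¹) (by
        have : 0 < ((P j).L ^ 2)⁻¹ := by positivity
        linarith), abs_of_pos (mul_pos (by have : 0 < ((P j).L ^ 2)⁻¹ := by positivity
                                           linarith) this), wF, PulseData.μ]
      have := (P j).δ_le_sqrt
      field_simp
      linarith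
  have w2 := ((h0.T.slice.mul hZ).smul fun j => -(1 / 4) * (P j).δ⁻¹ * ((P j).L ^ 2)⁻¹).weaken
    (κ' := fun j => wF P j * (P j).L⁻¹) 1 fun j => by
      have := (P j).μ_pos; have hL := (P j).L_pos; have hs := (P j).sqrt_pos; have hδ := (P j).hδ
      have hc : -(1 / 4) * (P j).δ⁻¹ * ((P j).L ^ 2)⁻¹ = -((1 / 4) * (P j).δ⁻¹ * ((P j).L ^ 2)⁻¹) := by
        ring
      rw [mu, hc, abs_neg, abs_of_pos (by positivity), abs_of_pos (by positivity), wF, PulseData.μ]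
      have := (P j).δ_le_sqrt
      field_simp
      linarith
  have w3 := (h0.X.wX_to_wF.smul fun j => (P j).L⁻¹).weaken
    (κ' := fun j => wF P j * (P j).L⁻¹) 1 fun j => by
      have := wF_pos (P := P) j; have hL := (P j).L_pos
      rw [abs_of_pos (by positivity), abs_of_pos (by positivity)]
      linarith
  have e : ∀ j, (flat fun θ => (P j).M.rho ((P j).pos (1, θ)) + 2 * (P j).m₀ / |(P j).u₀| ^ 3)
      = fun x => -(1 / 2) * ((P j).L ^ 2)⁻¹ * slice (fun x =>
      2 * (((P j).φ x)⁻¹ * ((P j).φ x)⁻¹ - 1) - 2 * (((P j).area x)⁻¹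
        * (((P j).φ x)⁻¹ * ((P j).φ x)⁻¹)
        * ∑ A, ((P j).φ x * dT A (dT A (P j).φ) x - dT A (P j).φ x * dT A (P j).φ x))) x
      + -(1 / 4) * (P j).δ⁻¹ * ((P j).L ^ 2)⁻¹ * (slice (P j).T x * slice (fun x =>
        ((P j).area x)⁻¹ * ((P j).Sy x + 4 * (P j).L * (rf x * rf x))
        - 4 * ((P j).L * (((P j).φ x)⁻¹ * ((P j).φ x)⁻¹ - 1))) x)
      + (P j).L⁻¹ * ((P j).δ⁻¹ * (P j).X x) := by
    intro j; ext x
    have hx := mem_strip.2 (show ((1 : ℝ), x.2).1 ∈ Icc (0 : ℝ) 1 by simp)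
    have hφ := (P j).φ_pos hx
    have hr := rf_pos (1, x.2)
    have hL := (P j).L_pos
    have hδ := (P j).hδ
    simp only [flat, slice]
    rw [(P j).rho_late, (P j).scal_late, (P j).abs_u₀]
    simp only [PulseData.X, slice, PulseData.μ, (P j).ε_sq, PulseData.area]
    field_simp
    ring
  simp only [e]
  exact (w1.add w2).add w3

end PulseBd

end Bounds


/-! ### Smallness of `δ` and uniform constants -/

lemma norm_vS_le : ‖vS‖ ≤ 1 := by simp [vS, Prod.norm_def]

lemma seedBd_of_normLE {ι : Type*} {P : ι → PulseData} {n : ℕ} {F : ℝ}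
    (h : ∀ j, (P j).S.NormLE (n + 1) F) : SeedBd P n where
  seed A B := bd_of_iteratedFDeriv (F := F) (fun j => (P j).contDiff_seed A B)
    fun j x hx l hl => h j (P j).i x.1 hx.1 x.2 hx.2 l (by omega) A B
  dS_seed A B := bd_of_iteratedFDeriv (F := F)
    (fun j => PulseData.contDiff_dirD ((P j).contDiff_seed A B) vS)
    fun j x hx l hl => (norm_iteratedFDeriv_dirD_le ((P j).contDiff_seed A B) norm_vS_le l x).trans
      (h j (P j).i x.1 hx.1 x.2 hx.2 (l + 1) (by omega) A B)

lemma Seed.NormLE.mono {S : Seed} {n m : ℕ} {F : ℝ} (h : S.NormLE n F) (hm : m ≤ n) :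
    S.NormLE m F := fun i s hs θ hθ j hj => h i s hs θ hθ j (hj.trans hm)

/-- The conformal factor is nondegenerate for short pulses. -/
lemma exists_lower (F₀ : ℝ) : ∃ δ₀ : ℝ, 0 < δ₀ ∧ δ₀ ≤ 1 ∧ ∀ p : PulseData, p.S.NormLE 1 F₀ →
    p.δ ≤ δ₀ → ∀ x ∈ disc, 1 / 2 ≤ p.φ x := by
  -- All pulses with this bound form one family, so the constant `C`, and with it `δ₀`, depends on
  -- `F₀` alone.
  let P : {p : PulseData // p.S.NormLE 1 F₀} → PulseData := Subtype.val
  obtain ⟨C, hC⟩ := (seedBd_of_normLE (P := P) (n := 0) fun j => j.2).φ_sub_one.bound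
  refine ⟨(1 + |C|)⁻¹, by positivity, inv_le_one_of_one_le₀ (by linarith [abs_nonneg C]),
    fun p hp hδ x hx => ?_⟩
  have h1 : |p.φ x - 1| ≤ C * p.μ := hC ⟨p, hp⟩ x hx
  have hL := p.L_gt
  have hμ : p.μ ≤ (1 / 2) * p.δ := by
    rw [PulseData.μ, div_le_iff₀ p.L_pos]
    nlinarith [p.hδ]
  have hμ0 := p.μ_pos
  have h2 : |C| * p.δ ≤ 1 := by
    have h3 : (1 + |C|) * p.δ ≤ (1 + |C|) * (1 + |C|)⁻¹ := by gcongr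
    rw [mul_inv_cancel₀ (by positivity)] at h3
    nlinarith [p.hδ]
  have h4 : C * p.μ ≤ |C| * p.μ := by gcongr; exact le_abs_self C
  have h5 : |C| * p.μ ≤ |C| * ((1 / 2) * p.δ) := by gcongr
  have := (abs_le.1 h1).1
  linarith

namespace PulseBd

variable {ι : Type*} {P : ι → PulseData}

lemma sphereMetric_eq (p : PulseData) (θ : Fin 2 → ℝ) :
    p.M.sphereMetric p.δ p.u₀ θ = (p.L ^ 2 * p.area (1, θ)) • 1 := by
  have hx := mem_strip.2 (show ((1 : ℝ), θ).1 ∈ Icc (0 : ℝ) 1 by simp)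
  ext A B
  have h := p.gm_eq A B hx
  simp only [p.gh_late, PulseData.gm, PulseData.pull, PulseData.pos, mul_one] at h
  rw [DoubleNull.sphereMetric, h]
  simp [mul_assoc]

lemma covNorm_le {k : ℕ} (h : PulseBd P (k + 1)) {κ : ι → ℝ} (hκ : ∀ j, 0 < κ j) {r : ℕ}
    {T : ι → TensorField (Fin 2) r} (hT : ∀ a, Bd κ k fun j => flat fun θ => T j θ a) :
    ∃ C, 0 ≤ C ∧ ∀ j θ, eucSq θ ≤ 4 → |(P j).u₀| ^ k *
      covNorm ((P j).M.sphereMetric (P j).δ (P j).u₀) (T j) k θ ≤ C * (κ j * (P j).L⁻¹ ^ r) := by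
  have h0 := h.mono (Nat.le_succ k)
  have hx : ∀ θ : Fin 2 → ℝ, ((1 : ℝ), θ) ∈ strip := fun θ => mem_strip.2 (by simp)
  obtain ⟨C, hC0, hC⟩ := NullGeom.covNorm_le (L := fun j => (P j).L)
    (w := fun j θ => (P j).area (1, θ)) k (fun j => (P j).L_pos)
    (fun j θ => (P j).area_pos' (hx θ)) (fun j θ => sphereMetric_eq (P j) θ) h.area.slice
    h0.inv_area.slice hκ hT
  refine ⟨C, hC0, fun j θ hθ => ?_⟩
  have hL := (P j).L_pos
  rw [(P j).abs_u₀]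
  calc _ ≤ (P j).L ^ k * (C * (κ j * (P j).L⁻¹ ^ (r + k))) := by gcongr; exact hC j θ hθ
    _ = (P j).L ^ k * (P j).L⁻¹ ^ k * (C * (κ j * (P j).L⁻¹ ^ r)) := by rw [pow_add]; ring
    _ = _ := by rw [← mul_pow, mul_inv_cancel₀ hL.ne', one_pow, one_mul]

end PulseBd

lemma PulseData.pos_one (p : PulseData) (θ : Fin 2 → ℝ) : p.pos (1, θ) = pt p.δ p.u₀ θ := by
  simp [pos]

lemma PulseBd.final {ι : Type*} {P : ι → PulseData} {k : ℕ} (h : PulseBd P (k + 2)) :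
    ∃ C, ∀ j, ∀ θ : Fin 2 → ℝ, eucSq θ ≤ 4 →
      |(P j).u₀| ^ k * covNorm ((P j).M.sphereMetric (P j).δ (P j).u₀)
          (DoubleNull.onSphere (fun x => (P j).M.trchi x
            - (2 / |(P j).u₀| - 4 * (P j).m₀ / |(P j).u₀| ^ 2)) (P j).δ (P j).u₀) k θ
        ≤ C * (Real.sqrt (P j).δ / |(P j).u₀| ^ 2) ∧
      |(P j).u₀| ^ k * covNorm ((P j).M.sphereMetric (P j).δ (P j).u₀)
          (DoubleNull.onSphere₁ (P j).M.beta (P j).δ (P j).u₀) k θ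
        ≤ C * (Real.sqrt (P j).δ / |(P j).u₀| ^ 2) ∧
      |(P j).u₀| ^ k * (|(P j).u₀| * covNorm ((P j).M.sphereMetric (P j).δ (P j).u₀)
          (DoubleNull.onSphere (fun x => (P j).M.rho x + 2 * (P j).m₀ / |(P j).u₀| ^ 3)
            (P j).δ (P j).u₀) k θ)
        ≤ C * (Real.sqrt (P j).δ / |(P j).u₀| ^ 2) ∧
      |(P j).u₀| ^ k * (|(P j).u₀| * covNorm ((P j).M.sphereMetric (P j).δ (P j).u₀)
          (DoubleNull.onSphere (P j).M.sigma (P j).δ (P j).u₀) k θ)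
        ≤ C * (Real.sqrt (P j).δ / |(P j).u₀| ^ 2) := by
  have h0 := h.mono (Nat.le_add_right k 2)
  have h1 := h.mono (Nat.le_succ (k + 1))
  have b1 := h0.trchi
  have b2 := h1.beta
  have b3 := h.rho
  have b4 := h.sigma
  simp only [PulseData.pos_one] at b1 b2 b3 b4
  have hw : ∀ j, 0 < wF P j := wF_pos
  have hw' : ∀ j, 0 < wF P j * (P j).L⁻¹ := fun j => mul_pos (hw j) (inv_pos.2 (P j).L_pos)
  obtain ⟨C₁, p₁, c₁⟩ := h1.covNorm_le (r := 0) (T := fun j => DoubleNull.onSphere (fun x =>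
    (P j).M.trchi x - (2 / |(P j).u₀| - 4 * (P j).m₀ / |(P j).u₀| ^ 2)) (P j).δ (P j).u₀)
    hw fun _ => b1
  obtain ⟨C₂, p₂, c₂⟩ := h1.covNorm_le (r := 1) (T := fun j =>
    DoubleNull.onSphere₁ (P j).M.beta (P j).δ (P j).u₀) hw fun a => b2 (a 0)
  obtain ⟨C₃, p₃, c₃⟩ := h1.covNorm_le (r := 0) (T := fun j => DoubleNull.onSphere (fun x =>
    (P j).M.rho x + 2 * (P j).m₀ / |(P j).u₀| ^ 3) (P j).δ (P j).u₀) hw' fun _ => b3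
  obtain ⟨C₄, p₄, c₄⟩ := h1.covNorm_le (r := 0) (T := fun j =>
    DoubleNull.onSphere (P j).M.sigma (P j).δ (P j).u₀) hw' fun _ => b4
  refine ⟨C₁ + C₂ + C₃ + C₄, fun j θ hθ => ?_⟩
  have d₁ := c₁ j θ hθ
  have d₂ := c₂ j θ hθ
  have d₃ := c₃ j θ hθ
  have d₄ := c₄ j θ hθ
  have hL := (P j).L_gt
  have hq : Real.sqrt (P j).δ / |(P j).u₀| ^ 2 = wF P j := by rw [(P j).abs_u₀]; rfl
  have hwj := hw j
  simp only [pow_zero, pow_one, mul_one] at d₁ d₂ d₃ d₄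
  have hle : C₁ * wF P j ≤ (C₁ + C₂ + C₃ + C₄) * wF P j ∧ C₂ * wF P j ≤ (C₁ + C₂ + C₃ + C₄) * wF P j
      ∧ C₃ * wF P j ≤ (C₁ + C₂ + C₃ + C₄) * wF P j
      ∧ C₄ * wF P j ≤ (C₁ + C₂ + C₃ + C₄) * wF P j := by
    refine ⟨?_, ?_, ?_, ?_⟩ <;> gcongr <;> linarith
  have hinv : (P j).L⁻¹ ≤ 1 := inv_le_one_of_one_le₀ (by linarith)
  have key : ∀ {C N : ℝ}, N ≤ C * (wF P j * (P j).L⁻¹) → |(P j).u₀| * N ≤ C * wF P j := by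
    intro C N hN
    rw [(P j).abs_u₀]
    have hLp := (P j).L_pos
    calc (P j).L * N ≤ (P j).L * (C * (wF P j * (P j).L⁻¹)) := by gcongr
      _ = C * wF P j := by field_simp
  rw [hq]
  refine ⟨d₁.trans hle.1, d₂.trans (le_trans ?_ hle.2.1), ?_, ?_⟩
  -- The length of a one-form carries an additional `L⁻¹`, which is not needed here.
  · have : wF P j * (P j).L⁻¹ ≤ wF P j := mul_le_of_le_one_right hwj.le hinv
    gcongr
  · rw [mul_left_comm]; exact (key d₃).trans hle.2.2.1
  · rw [mul_left_comm]; exact (key d₄).trans hle.2.2.2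

end NullGeom

theorem mainTheorem5 :
    ∃ N : ℕ, ∀ F₀ : ℝ, ∃ δ₀ : ℝ, 0 < δ₀ ∧
      -- the first bound fixes how small `δ` has to be, the second one the constant `C`
      ∀ (k : ℕ) (F : ℝ), ∃ C : ℝ,
        ∀ (u₀ u₁ δ m₀ : ℝ) (S : NullGeom.Seed) (D : NullGeom.Development u₀ u₁ δ),
          u₀ < -2 → u₀ < u₁ → u₁ < 0 → 0 < δ → δ ≤ δ₀ →
          S.NormLE N F₀ → S.NormLE (k + N) F →
          D.IsShortPulse S →
          (D.ShearEnergy m₀ ∨ S.Energy m₀) →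
          ∀ i : Fin 2,
            (∀ (θ : Fin 2 → ℝ) (A B : Fin 2),
              (D.M i).alpha (NullGeom.pt δ u₀ θ) A B = 0) ∧
            -- the closed discs `|θ| ≤ 2` of the two charts cover the sphere
            ∀ θ : Fin 2 → ℝ, NullGeom.eucSq θ ≤ 4 →
              |u₀| ^ k * NullGeom.covNorm ((D.M i).sphereMetric δ u₀)
                  (NullGeom.DoubleNull.onSphere
                    (fun x => (D.M i).trchi x - (2 / |u₀| - 4 * m₀ / |u₀| ^ 2)) δ u₀) k θ
                ≤ C * (Real.sqrt δ / |u₀| ^ 2) ∧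
              |u₀| ^ k * NullGeom.covNorm ((D.M i).sphereMetric δ u₀)
                  (NullGeom.DoubleNull.onSphere₁ (D.M i).beta δ u₀) k θ
                ≤ C * (Real.sqrt δ / |u₀| ^ 2) ∧
              |u₀| ^ k * (|u₀| * NullGeom.covNorm ((D.M i).sphereMetric δ u₀)
                  (NullGeom.DoubleNull.onSphere
                    (fun x => (D.M i).rho x + 2 * m₀ / |u₀| ^ 3) δ u₀) k θ)
                ≤ C * (Real.sqrt δ / |u₀| ^ 2) ∧
              |u₀| ^ k * (|u₀| * NullGeom.covNorm ((D.M i).sphereMetric δ u₀)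
                  (NullGeom.DoubleNull.onSphere (D.M i).sigma δ u₀) k θ)
                ≤ C * (Real.sqrt δ / |u₀| ^ 2) := by
  -- Two angular derivatives are lost in the curvature of the spheres, and one `s` derivative of the
  -- seed is needed.
  refine ⟨3, fun F₀ => ?_⟩
  obtain ⟨δ₀, h0, h1, hlow⟩ := NullGeom.exists_lower F₀
  refine ⟨δ₀, h0, fun k F => ?_⟩
  -- The family of all admissible pulses, in both charts; its one constant is the required `C`.
  let P : {p : NullGeom.PulseData // p.S.NormLE 3 F₀ ∧ p.S.NormLE (k + 3) F ∧ p.δ ≤ δ₀} →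
    NullGeom.PulseData := Subtype.val
  have hP : NullGeom.PulseBd P (k + 2) :=
    { NullGeom.seedBd_of_normLE (P := P) (n := k + 2) fun j => j.2.2.1 with
      lower := fun j => hlow j.1 (j.2.1.mono (by norm_num)) j.2.2.2 }
  obtain ⟨C, hC⟩ := hP.final
  refine ⟨C, fun u₀ u₁ δ m₀ S D hu₀ hu₀₁ hu₁ hδ hδ₀ hS₀ hS hp he i => ?_⟩
  let p : NullGeom.PulseData := ⟨u₀, u₁, δ, m₀, S, D, i, hu₀, hu₀₁, hu₁, hδ, hδ₀.trans h1, hp, he⟩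
  refine ⟨fun θ A B => ?_, hC ⟨p, hS₀, hS, hδ₀⟩⟩
  have := p.alpha_late θ A B
  rwa [p.pos_one] at this
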